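/- Let $N\ge 3$, $1<p<N$, $p^*=Np/(N-p)$, $\alpha>1$, $\lambda,\beta>0$. Let $V\ge 0$ and $K\in L^\infty(\mathbb R^N)$ be differentiable functions on $\mathbb R^N$ such that $$x\cdot DV(x)\le 0,\qquad x\cdot DK(x)\le 0\qquad\text{for all }x\in\mathbb R^N,$$ and let $k\ge \alpha p^*$. Consider the equation $$-\Delta_{p}u-\frac{\alpha}{2}\,\Delta_p(|u|^\alpha)\,|u|^{\alpha-2}u=\lambda V(x)|u|^{k-2}u+\beta K(x)|u|^{\alpha p^{*}-2}u\quad\text{in }\mathbb R^N, \qquad (*)$$ where $\Delta_p w=\operatorname{div}(|Dw|^{p-2}Dw)$. Put $$g(t)=\Bigl[1+\tfrac{\alpha^p}{2}|t|^{p(\alpha-1)}\Bigr]^{1/p},\qquad G(t)=\int_0^t g(z)\,dz ,$$ and $D^{1,p}(\mathbb R^N)=\{v\in L^{p^*}(\mathbb R^N): Dv\in L^p(\mathbb R^N)\}$, with $Dv$ the weak gradient. A function $u$ is a (weak) solution of $(*)$ if $v=G(u)\in D^{1,p}(\mathbb R^N)$ and, for every $\psi\in D^{1,p}(\mathbb R^N)$,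 the functions $V\frac{|u|^{k-2}u}{g(u)}\psi$ and $K\frac{|u|^{\alpha p^*-2}u}{g(u)}\psi$ are integrable and $$\int_{\mathbb R^N}|Dv|^{p-2}Dv\cdot D\psi\,dx-\lambda\int_{\mathbb R^N}V\frac{|u|^{k-2}u}{g(u)}\,\psi\,dx-\beta\int_{\mathbb R^N}K\frac{|u|^{\alpha p^*-2}u}{g(u)}\,\psi\,dx=0 .$$ Then $(*)$ has no nontrivial solution when $k=\alpha p^*$, and no nontrivial locally bounded solution when $k>\alpha p^*$. That is, every weak solution $u$ of $(*)$, assumed in addition to belong to $L^\infty_{loc}(\mathbb R^N)$ if $k>\alpha p^*$, vanishes almost everywhere. -/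

import Mathlib

open MeasureTheory
open scoped Gradient ENNReal

namespace QuasilinearSchrodinger

noncomputable section

/-- The Sobolev critical exponent `p* = N p / (N - p)`. -/
def sobolevExp (N : ℕ) (p : ℝ) : ℝ := N * p / (N - p)

/-- `g(t) = [1 + (α ^ p / 2) |t| ^ (p (α - 1))] ^ (1 / p)`. -/
def g (p α t : ℝ) : ℝ := (1 + α ^ p / 2 * |t| ^ (p * (α - 1))) ^ (1 / p)

/-- The change of variable `G(t) = ∫₀ᵗ g(z) dz`, an increasing bijection of `ℝ`. -/
def G (p α t : ℝ) : ℝ := ∫ z in (0 : ℝ)..t, g p α z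

/-- `W` is the weak (distributional) gradient on `ℝ^N` of the locally integrable function `v`. -/
structure HasWeakGradient {N : ℕ} (v : EuclideanSpace ℝ (Fin N) → ℝ)
    (W : EuclideanSpace ℝ (Fin N) → EuclideanSpace ℝ (Fin N)) : Prop where
  locallyIntegrable : LocallyIntegrable v volume
  locallyIntegrable_grad : LocallyIntegrable W volume
  integral_eq : ∀ φ : EuclideanSpace ℝ (Fin N) → ℝ, ContDiff ℝ (⊤ : ℕ∞) φ → HasCompactSupport φ →
    ∀ e : EuclideanSpace ℝ (Fin N),
      ∫ x, v x * fderiv ℝ φ x e = - ∫ x, φ x * inner ℝ (W x) e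

/-- `v` belongs to `D^{1,p}(ℝ^N) = {v ∈ L^{p*}(ℝ^N) : Dv ∈ L^p(ℝ^N)}`, and its weak gradient
is `W`. -/
structure IsD1p {N : ℕ} (p : ℝ) (v : EuclideanSpace ℝ (Fin N) → ℝ)
    (W : EuclideanSpace ℝ (Fin N) → EuclideanSpace ℝ (Fin N)) : Prop where
  memLp : MemLp v (ENNReal.ofReal (sobolevExp N p)) volume
  memLp_grad : MemLp W (ENNReal.ofReal p) volume
  hasWeakGradient : HasWeakGradient v W

/-- `u` is a weak solution on `ℝ^N` of
`-Δ_p u - (α/2) Δ_p(|u|^α) |u|^(α-2) u = lam V |u|^(k-2) u + β K |u|^(α p* - 2) u`: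
the function `v = G(u)` (so `u = G⁻¹(v)`) lies in `D^{1,p}(ℝ^N)`, and it is a critical point of
`F(v) = (1/p) ∫ |Dv|^p - (lam/k) ∫ V |G⁻¹(v)|^k - (β/(α p*)) ∫ K |G⁻¹(v)|^(α p*)`,
that is, `F'(v) ψ` is well defined and equal to `0` for all `ψ ∈ D^{1,p}(ℝ^N)`. -/
def IsWeakSolution {N : ℕ} (p α k lam β : ℝ) (V K : EuclideanSpace ℝ (Fin N) → ℝ)
    (u : EuclideanSpace ℝ (Fin N) → ℝ) : Prop :=
  ∃ W : EuclideanSpace ℝ (Fin N) → EuclideanSpace ℝ (Fin N),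
    IsD1p p (fun x => G p α (u x)) W ∧
    ∀ (ψ : EuclideanSpace ℝ (Fin N) → ℝ)
      (Z : EuclideanSpace ℝ (Fin N) → EuclideanSpace ℝ (Fin N)), IsD1p p ψ Z →
      Integrable (fun x => V x * (|u x| ^ (k - 2) * u x / g p α (u x)) * ψ x) volume ∧
      Integrable (fun x =>
        K x * (|u x| ^ (α * sobolevExp N p - 2) * u x / g p α (u x)) * ψ x) volume ∧
      (∫ x, ‖W x‖ ^ (p - 2) * inner ℝ (W x) (Z x))
        - lam * (∫ x, V x * (|u x| ^ (k - 2) * u x / g p α (u x)) * ψ x)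
        - β * (∫ x, K x * (|u x| ^ (α * sobolevExp N p - 2) * u x / g p α (u x)) * ψ x) = 0

/-- `u ∈ L^∞_loc(ℝ^N)`. -/
def LocallyEssBounded {N : ℕ} (u : EuclideanSpace ℝ (Fin N) → ℝ) : Prop :=
  ∀ S : Set (EuclideanSpace ℝ (Fin N)), IsCompact S →
    ∃ C : ℝ, ∀ᵐ x ∂(volume.restrict S), |u x| ≤ C

end

end QuasilinearSchrodinger

/-!
With `v = G(u)` the equation reads `-Δ_p v = f`, where
`f = λ V |u|^(k-2) u / g(u) + β K |u|^(α p* - 2) u / g(u)`. Two integral relations between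
`E = ∫ |Dv|^p` and `I = ∫ (λ V |u|^k + β K |u|^(α p*))` are incompatible unless `Dv = 0`.

*Nehari's identity.* The function `u g(u)`, viewed as a function of `v`, is continuously
differentiable with derivative `1 + u g'(u) / g(u) ∈ [1, α)`, so it is an admissible test function,
and it gives `∫ (1 + u g'(u) / g(u)) |Dv|^p = I`. In particular `I` converges absolutely.

*Pohozaev's inequality* (`pohozaev_le`). Together with `k ≥ α p*` and `V ≥ 0` it yields `α E ≤ I`.
Since the factor in Nehari's identity is strictly less than `α`, it follows that `Dv = 0` almost
everywhere, and then `v = 0` by Sobolev's inequality (`exists_sobolev_const`).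

The classical Pohozaev identity tests with `x · Dv`, which requires regularity of solutions of
`p`-Laplace equations. Here the equation is tested instead with the difference
`η_R (v(t ·) - v)`, an element of `D^{1,p}`, and convexity replaces regularity: Young's inequality
`|a|^(p-2) a · (b - a) ≤ (|b|^p - |a|^p) / p` bounds the gradient term from above, and the
right-hand side is bounded from below by a difference `F(t x) - F(x)` of primitives. Both
differences are evaluated by the change of variables `x ↦ t x`. Division by `t - 1`, then `t → 1`
from above and `R → ∞`, gives the inequality. The sign conditions `x · DV ≤ 0`, `x · DK ≤ 0` enter
as monotonicity of `V` and `K` along rays, with no derivative of `V` or `K` under an integral.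

Since `K` may change sign, the comparison with primitives costs an error
`|b(u(t x)) - b(u(x))| |v(t x) - v(x)|`, where `b` is one of the two nonlinearities. The quotient
`(v(t x) - v(x)) / (t - 1)` is bounded in `L^p` on balls (`IsD1p.eLpNorm_radial_quotient_le`), so
the error is negligible once `b(u)` lies locally in `L^{p'}`, by continuity of dilations in
`L^{p'}`. For `k > α p*` this is what the local boundedness of `u` provides. For `k = α p*` the
nonlinearity has the critical growth `|v|^(p* - 1)`, and one Brezis–Kato–Moser step
(`IsD1p.memLp_abs_rpow_add_one`) gives `|v|^(p') ∈ L^{p*}`, which suffices.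
-/

namespace QuasilinearSchrodinger

noncomputable section

open Filter Topology Convolution ContinuousLinearMap

/-! ### Approximation in `L^q`: mollification and dilation -/

section Approximation

set_option linter.unusedSectionVars false

variable {E F : Type*} [NormedAddCommGroup E] [InnerProductSpace ℝ E] [FiniteDimensional ℝ E]
  [MeasurableSpace E] [BorelSpace E] [NormedAddCommGroup F] [NormedSpace ℝ F]

theorem tendsto_eLpNorm_sub_of_uniform {ι : Type*} {l : Filter ι} {q : ℝ≥0∞} (hq : q ≠ ⊤)
    {T : ι → E → F} {g : E → F} {K : Set E} (hK : IsCompact K)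
    (hT : ∀ᶠ i in l, Function.support (T i) ⊆ K) (hg : Function.support g ⊆ K)
    (hu : ∀ ε : ℝ, 0 < ε → ∀ᶠ i in l, ∀ x, dist (T i x) (g x) ≤ ε) :
    Tendsto (fun i => eLpNorm (T i - g) q volume) l (𝓝 0) := by
  rw [ENNReal.tendsto_nhds_zero]
  intro ε hε
  have hM : (volume K) ^ (1 / q.toReal) ≠ ⊤ :=
    ENNReal.rpow_ne_top_of_nonneg (by positivity) hK.measure_lt_top.ne
  have hlim : Tendsto (fun c : ℝ => ENNReal.ofReal c * (volume K) ^ (1 / q.toReal)) (𝓝[>] 0)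
      (𝓝 0) := by
    have h0 : Tendsto (fun c : ℝ => ENNReal.ofReal c) (𝓝[>] 0) (𝓝 0) := by
      have := (ENNReal.continuous_ofReal.tendsto 0).mono_left (nhdsWithin_le_nhds (s := Set.Ioi 0))
      simpa using this
    simpa using ENNReal.Tendsto.mul_const h0 (Or.inr hM)
  obtain ⟨c, hc, hc0⟩ := ((ENNReal.tendsto_nhds_zero.1 hlim ε hε).and self_mem_nhdsWithin).exists
  filter_upwards [hT, hu c hc0] with i h1 h2
  exact (eLpNorm_sub_le_of_dist_bdd volume hq hK.measurableSet (le_of_lt hc0) h2 h1 hg).trans hc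

/-- Additive operators which do not increase the `L^q` norm and converge to the identity on
continuous compactly supported functions converge to the identity on all of `L^q`. -/
theorem tendsto_eLpNorm_sub_of_contraction {ι : Type*} {l : Filter ι} {q : ℝ≥0∞} (hq : q ≠ ⊤)
    (hq1 : 1 ≤ q) (T : ι → (E → F) → E → F)
    (hmeas : ∀ᶠ i in l, ∀ f, MemLp f q volume → AEStronglyMeasurable (T i f) volume)
    (hsub : ∀ᶠ i in l, ∀ f g, MemLp f q volume → MemLp g q volume →
      T i (f - g) =ᵐ[volume] T i f - T i g)
    (hbd : ∀ᶠ i in l, ∀ f, MemLp f q volume → eLpNorm (T i f) q volume ≤ eLpNorm f q volume)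
    (hconv : ∀ g : E → F, Continuous g → HasCompactSupport g →
      Tendsto (fun i => eLpNorm (T i g - g) q volume) l (𝓝 0))
    {f : E → F} (hf : MemLp f q volume) :
    Tendsto (fun i => eLpNorm (T i f - f) q volume) l (𝓝 0) := by
  rw [ENNReal.tendsto_nhds_zero]
  intro ε hε
  have hε3 : ε / 3 ≠ 0 := by
    simp [ENNReal.div_eq_zero_iff, hε.ne']
  obtain ⟨g, hgc, hfg, hg, hgL⟩ := hf.exists_hasCompactSupport_eLpNorm_sub_le hq hε3
  filter_upwards [hmeas, hsub, hbd,
    ENNReal.tendsto_nhds_zero.1 (hconv g hg hgc) (ε / 3) (pos_iff_ne_zero.2 hε3)] with i h1 h2 h3 h4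
  have hfgL := hf.sub hgL
  have e1 : T i f - f =ᵐ[volume] (T i (f - g) + (T i g - g)) + (g - f) := by
    filter_upwards [h2 f g hf hgL] with x hx
    simp only [Pi.add_apply, Pi.sub_apply] at hx ⊢
    rw [hx]; abel
  rw [eLpNorm_congr_ae e1]
  have m1 := h1 _ hfgL
  have m2 := (h1 _ hgL).sub hgL.1
  calc eLpNorm ((T i (f - g) + (T i g - g)) + (g - f)) q volume
      ≤ (eLpNorm (T i (f - g)) q volume + eLpNorm (T i g - g) q volume)
        + eLpNorm (g - f) q volume :=
        (eLpNorm_add_le (m1.add m2) (hgL.1.sub hf.1) hq1).trans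
          (add_le_add (eLpNorm_add_le m1 m2 hq1) le_rfl)
    _ ≤ (ε / 3 + ε / 3) + ε / 3 := by
        refine add_le_add (add_le_add ((h3 _ hfgL).trans hfg) h4) ?_
        rwa [eLpNorm_sub_comm]
    _ = ε := ENNReal.add_thirds ε

/-! #### Dilation -/

theorem lintegral_comp_smul {t : ℝ} (ht : 0 < t) {f : E → ℝ≥0∞} :
    ∫⁻ x, f (t • x) = ENNReal.ofReal ((t ^ Module.finrank ℝ E)⁻¹) * ∫⁻ x, f x := by
  have he : MeasurableEmbedding (fun x : E => t • x) :=
    (Homeomorph.smulOfNeZero t ht.ne').measurableEmbedding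
  rw [← he.lintegral_map f, Measure.map_addHaar_smul _ ht.ne', lintegral_smul_measure,
    abs_of_pos (by positivity), smul_eq_mul]

theorem quasiMeasurePreserving_smul {t : ℝ} (ht : 0 < t) :
    Measure.QuasiMeasurePreserving (fun x : E => t • x) volume volume := by
  refine ⟨measurable_const_smul t, ?_⟩
  rw [Measure.map_addHaar_smul _ ht.ne']
  exact Measure.smul_absolutelyContinuous

theorem eLpNorm_comp_smul_le {t : ℝ} (ht : 1 ≤ t) (q : ℝ≥0∞) (f : E → F) :
    eLpNorm (fun x => f (t • x)) q volume ≤ eLpNorm f q volume := by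
  have ht0 : 0 < t := by linarith
  have he : MeasurableEmbedding (fun x : E => t • x) :=
    (Homeomorph.smulOfNeZero t ht0.ne').measurableEmbedding
  have h1 := he.eLpNorm_map_measure (μ := volume) (g := f) (p := q)
  rw [Function.comp_def] at h1
  rw [← h1]
  refine eLpNorm_mono_measure f ?_
  rw [Measure.map_addHaar_smul _ ht0.ne', abs_of_pos (by positivity)]
  have : ENNReal.ofReal ((t ^ Module.finrank ℝ E)⁻¹) ≤ 1 := by
    rw [ENNReal.ofReal_le_one]
    exact inv_le_one_of_one_le₀ (one_le_pow₀ ht)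
  calc ENNReal.ofReal ((t ^ Module.finrank ℝ E)⁻¹) • (volume : Measure E)
      ≤ (1 : ℝ≥0∞) • volume := by gcongr
    _ = volume := one_smul _ _

theorem memLp_comp_smul {t : ℝ} (ht : 1 ≤ t) {q : ℝ≥0∞} {f : E → F} (hf : MemLp f q volume) :
    MemLp (fun x => f (t • x)) q volume :=
  ⟨hf.1.comp_quasiMeasurePreserving (quasiMeasurePreserving_smul (by linarith)),
    (eLpNorm_comp_smul_le ht q f).trans_lt hf.2⟩

theorem tendsto_comp_smul {q : ℝ≥0∞} (hq : q ≠ ⊤) (hq1 : 1 ≤ q) {f : E → F}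
    (hf : MemLp f q volume) :
    Tendsto (fun t : ℝ => eLpNorm (fun x => f (t • x) - f x) q volume) (𝓝[>] 1) (𝓝 0) := by
  have hone : ∀ᶠ t : ℝ in 𝓝[>] 1, 1 < t := self_mem_nhdsWithin
  refine tendsto_eLpNorm_sub_of_contraction hq hq1 (fun (t : ℝ) f x => f (t • x))
    (hone.mono fun t ht f hf => (memLp_comp_smul ht.le hf).1)
    (Eventually.of_forall fun t f g _ _ => ae_eq_refl _)
    (hone.mono fun t ht f hf => eLpNorm_comp_smul_le ht.le q f) ?_ hf
  intro g hg hgc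
  obtain ⟨r, hr0, hr⟩ := hgc.isCompact.isBounded.subset_closedBall_lt 0 0
  refine tendsto_eLpNorm_sub_of_uniform (K := Metric.closedBall 0 r) hq
    (isCompact_closedBall _ _) ?_ ((subset_tsupport g).trans hr) ?_
  · filter_upwards [hone] with t ht x hx
    have h1 := hr (subset_tsupport g hx)
    rw [mem_closedBall_zero_iff, norm_smul, Real.norm_eq_abs, abs_of_pos (by linarith)] at h1
    rw [mem_closedBall_zero_iff]
    nlinarith [norm_nonneg x]
  · intro ε hε
    obtain ⟨δ, hδ, hgδ⟩ := Metric.uniformContinuous_iff.1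
      (hgc.uniformContinuous_of_continuous hg) ε hε
    have hlim : ∀ᶠ t : ℝ in 𝓝[>] 1, t < 1 + δ / (r + 1) :=
      (eventually_lt_nhds (by simp; positivity)).filter_mono nhdsWithin_le_nhds
    filter_upwards [hone, hlim] with t ht ht2 x
    by_cases hx : ‖x‖ ≤ r
    · refine (hgδ ?_).le
      rw [dist_eq_norm, show t • x - x = (t - 1) • x by rw [sub_smul, one_smul], norm_smul,
        Real.norm_eq_abs, abs_of_pos (by linarith)]
      have : t - 1 < δ / (r + 1) := by linarith
      rw [lt_div_iff₀ (by linarith)] at this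
      nlinarith [norm_nonneg x]
    · have hz : ∀ y : E, r < ‖y‖ → g y = 0 := by
        intro y hy
        by_contra h
        have := hr (subset_tsupport g h)
        rw [mem_closedBall_zero_iff] at this
        linarith
      rw [hz x (by linarith), hz (t • x) ?_, dist_self]
      · exact hε.le
      · rw [norm_smul, Real.norm_eq_abs, abs_of_pos (by linarith)]
        nlinarith [norm_nonneg x]

/-! #### Mollification -/

/-- The convolution of `f` with a smooth probability density supported in a small ball. -/
def mollify (ρ : ContDiffBump (0 : E)) (f : E → F) : E → F :=
  (ρ.normed volume) ⋆[lsmul ℝ ℝ, volume] f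

theorem mollify_apply (ρ : ContDiffBump (0 : E)) (f : E → F) (x : E) :
    mollify ρ f x = ∫ y, ρ.normed volume y • f (x - y) := by
  simp [mollify, convolution_def]

theorem mollify_congr (ρ : ContDiffBump (0 : E)) {f g : E → F} (h : f =ᵐ[volume] g) :
    mollify ρ f = mollify ρ g :=
  convolution_congr _ (ae_eq_refl _) h

theorem convolutionExistsAt_mollify (ρ : ContDiffBump (0 : E)) {f : E → F}
    (hf : LocallyIntegrable f volume) (x : E) :
    ConvolutionExistsAt (ρ.normed volume) f x (lsmul ℝ ℝ) volume :=
  ρ.hasCompactSupport_normed.convolutionExists_left _ ρ.continuous_normed hf x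

theorem contDiff_mollify [CompleteSpace F] (ρ : ContDiffBump (0 : E)) {f : E → F}
    (hf : LocallyIntegrable f volume) : ContDiff ℝ (⊤ : ℕ∞) (mollify ρ f) :=
  ρ.hasCompactSupport_normed.contDiff_convolution_left _ ρ.contDiff_normed hf

theorem mollify_sub (ρ : ContDiffBump (0 : E)) {f g : E → F}
    (hf : LocallyIntegrable f volume) (hg : LocallyIntegrable g volume) :
    mollify ρ (f - g) = mollify ρ f - mollify ρ g := by
  ext x
  simp only [mollify_apply, Pi.sub_apply, smul_sub]
  have h1 := (convolutionExistsAt_mollify ρ hf x).integrable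
  have h2 := (convolutionExistsAt_mollify ρ hg x).integrable
  exact integral_sub h1 h2

/-- Young's inequality for a probability density. -/
theorem eLpNorm_mollify_le (ρ : ContDiffBump (0 : E)) {q : ℝ≥0∞} (hq : q ≠ ⊤) (hq1 : 1 ≤ q)
    {f : E → F} (hf : MemLp f q volume) :
    eLpNorm (mollify ρ f) q volume ≤ eLpNorm f q volume := by
  obtain ⟨f', hf', hff'⟩ := hf.1
  rw [mollify_congr ρ hff', eLpNorm_congr_ae hff']
  have hr0 : 0 < q.toReal := ENNReal.toReal_pos (by positivity) hq
  set w : E → ℝ≥0∞ := fun y => ENNReal.ofReal (ρ.normed volume y) with hw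
  have hwm : Measurable w := ENNReal.measurable_ofReal.comp ρ.continuous_normed.measurable
  set ν : Measure E := volume.withDensity w with hν
  have hνp : IsProbabilityMeasure ν := by
    constructor
    rw [hν, withDensity_apply _ MeasurableSet.univ, Measure.restrict_univ, hw,
      ← ofReal_integral_eq_lintegral_ofReal ρ.integrable_normed
        (ae_of_all _ ρ.nonneg_normed), ρ.integral_normed, ENNReal.ofReal_one]
  have key : ∀ x, ‖mollify ρ f' x‖ₑ ^ q.toReal ≤ ∫⁻ y, ‖f' (x - y)‖ₑ ^ q.toReal ∂ν := by
    intro x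
    have hm : StronglyMeasurable (fun y => f' (x - y)) :=
      hf'.comp_measurable (measurable_const.sub measurable_id)
    have h1 : ‖mollify ρ f' x‖ₑ ≤ eLpNorm (fun y => f' (x - y)) 1 ν := by
      rw [mollify_apply, eLpNorm_one_eq_lintegral_enorm, hν,
        lintegral_withDensity_eq_lintegral_mul _ hwm hm.enorm]
      refine (enorm_integral_le_lintegral_enorm _).trans (le_of_eq ?_)
      refine lintegral_congr fun y => ?_
      rw [enorm_smul, Pi.mul_apply, hw, Real.enorm_of_nonneg (ρ.nonneg_normed y)]
    have h2 := h1.trans (eLpNorm_le_eLpNorm_of_exponent_le hq1 hm.aestronglyMeasurable)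
    rw [eLpNorm_eq_lintegral_rpow_enorm_toReal (by positivity) hq] at h2
    calc ‖mollify ρ f' x‖ₑ ^ q.toReal
        ≤ ((∫⁻ y, ‖f' (x - y)‖ₑ ^ q.toReal ∂ν) ^ (1 / q.toReal)) ^ q.toReal := by gcongr
      _ = _ := by rw [← ENNReal.rpow_mul, one_div_mul_cancel hr0.ne', ENNReal.rpow_one]
  rw [eLpNorm_eq_lintegral_rpow_enorm_toReal (by positivity) hq,
    eLpNorm_eq_lintegral_rpow_enorm_toReal (by positivity) hq]
  refine ENNReal.rpow_le_rpow ?_ (by positivity)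
  calc ∫⁻ x, ‖mollify ρ f' x‖ₑ ^ q.toReal
      ≤ ∫⁻ x, ∫⁻ y, ‖f' (x - y)‖ₑ ^ q.toReal ∂ν := lintegral_mono key
    _ = ∫⁻ y, (∫⁻ x, ‖f' (x - y)‖ₑ ^ q.toReal) ∂ν := by
        refine lintegral_lintegral_swap ?_
        have : StronglyMeasurable (fun z : E × E => f' (z.1 - z.2)) :=
          hf'.comp_measurable (measurable_fst.sub measurable_snd)
        exact (this.enorm.pow_const _).aemeasurable
    _ = ∫⁻ x, ‖f' x‖ₑ ^ q.toReal := by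
        simp_rw [lintegral_sub_right_eq_self (fun x => ‖f' x‖ₑ ^ q.toReal)]
        simp

theorem support_mollify_subset (ρ : ContDiffBump (0 : E)) {f : E → F} {K : Set E} {r : ℝ}
    (hf : Function.support f ⊆ K) (hρ : ρ.rOut ≤ r) :
    Function.support (mollify ρ f) ⊆ Metric.cthickening r K := by
  intro x hx
  have h := support_convolution_subset _ hx
  rw [ρ.support_normed_eq] at h
  obtain ⟨y, hy, z, hz, rfl⟩ := h
  refine Metric.mem_cthickening_of_dist_le _ z _ _ (hf hz) ?_
  rw [dist_eq_norm, add_sub_cancel_right]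
  exact ((mem_ball_zero_iff.1 hy).le).trans hρ

theorem tendsto_mollify [CompleteSpace F] {ι : Type*} {l : Filter ι} {q : ℝ≥0∞} (hq : q ≠ ⊤)
    (hq1 : 1 ≤ q) (ρ : ι → ContDiffBump (0 : E)) (hρ : Tendsto (fun i => (ρ i).rOut) l (𝓝 0))
    {f : E → F} (hf : MemLp f q volume) :
    Tendsto (fun i => eLpNorm (mollify (ρ i) f - f) q volume) l (𝓝 0) := by
  refine tendsto_eLpNorm_sub_of_contraction hq hq1 (fun i f => mollify (ρ i) f)
    (Eventually.of_forall fun i f hf =>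
      (contDiff_mollify (ρ i) (hf.locallyIntegrable hq1)).continuous.aestronglyMeasurable)
    (Eventually.of_forall fun i f g hf hg => by
      rw [mollify_sub (ρ i) (hf.locallyIntegrable hq1) (hg.locallyIntegrable hq1)])
    (Eventually.of_forall fun i f hf => eLpNorm_mollify_le (ρ i) hq hq1 hf) ?_ hf
  intro g hg hgc
  refine tendsto_eLpNorm_sub_of_uniform (K := Metric.cthickening 1 (tsupport g)) hq
    hgc.isCompact.cthickening ?_ ((subset_tsupport g).trans (Metric.self_subset_cthickening _)) ?_
  · filter_upwards [hρ.eventually (eventually_le_nhds zero_lt_one)] with i hi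
    exact support_mollify_subset (ρ i) (subset_tsupport g) hi
  · intro ε hε
    obtain ⟨δ, hδ, hgδ⟩ := Metric.uniformContinuous_iff.1
      (hgc.uniformContinuous_of_continuous hg) ε hε
    filter_upwards [hρ.eventually (eventually_lt_nhds hδ)] with i hi x
    refine (ρ i).dist_normed_convolution_le hg.aestronglyMeasurable fun y hy => ?_
    exact (hgδ ((Metric.mem_ball.1 hy).trans hi)).le

end Approximation

/-! ### Cutoff functions -/

theorem tendsto_mul_cutoff {E F ι : Type*} [NormedAddCommGroup E] [InnerProductSpace ℝ E]
    [FiniteDimensional ℝ E] [MeasurableSpace E] [BorelSpace E] [NormedAddCommGroup F]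
    [NormedSpace ℝ F] {l : Filter ι} {q : ℝ≥0∞} (hq : q ≠ ⊤) (hq1 : 1 ≤ q) {m : ι → E → ℝ}
    {R : ι → ℝ} (hR : Tendsto R l atTop) (hm : ∀ᶠ i in l, AEStronglyMeasurable (m i) volume)
    (hm1 : ∀ᶠ i in l, ∀ x, |m i x| ≤ 1) (hmR : ∀ᶠ i in l, ∀ x, ‖x‖ ≤ R i → m i x = 1)
    {f : E → F} (hf : MemLp f q volume) :
    Tendsto (fun i => eLpNorm (fun x => m i x • f x - f x) q volume) l (𝓝 0) := by
  refine tendsto_eLpNorm_sub_of_contraction hq hq1 (fun i f x => m i x • f x)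
    (hm.mono fun i h f hf => h.smul hf.1)
    (Eventually.of_forall fun i f g _ _ => ae_of_all _ fun x => by simp [smul_sub])
    (hm1.mono fun i h f hf => ?_) ?_ hf
  · refine eLpNorm_mono fun x => ?_
    rw [norm_smul, Real.norm_eq_abs]
    exact mul_le_of_le_one_left (norm_nonneg _) (h x)
  · intro g hg hgc
    obtain ⟨r, hr⟩ := hgc.isCompact.isBounded.subset_closedBall 0
    refine tendsto_const_nhds.congr' ?_
    filter_upwards [hmR, hR.eventually_ge_atTop r] with i h1 h2
    have : (fun x => m i x • g x) - g = 0 := by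
      ext x
      by_cases hx : g x = 0
      · simp [hx]
      · have := hr (subset_tsupport g hx)
        rw [mem_closedBall_zero_iff] at this
        simp [h1 x (this.trans h2)]
    rw [this, eLpNorm_zero]

/-- Euclidean space of dimension `N`. -/
abbrev Space (N : ℕ) := EuclideanSpace ℝ (Fin N)

section Cutoff

variable {N : ℕ}

/-- The reference bump function, equal to `1` on the unit ball and supported in the ball of
radius `2`. -/
def unitBump (N : ℕ) : ContDiffBump (0 : Space N) where
  rIn := 1
  rOut := 2
  rIn_pos := one_pos
  rIn_lt_rOut := one_lt_two

/-- The smooth cutoff equal to `1` on the ball of radius `R` and vanishing off the ball of radius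
`2 R`. -/
def cutoff (N : ℕ) (R : ℝ) (x : Space N) : ℝ := unitBump N (R⁻¹ • x)

theorem cutoff_nonneg (R : ℝ) (x : Space N) : 0 ≤ cutoff N R x := (unitBump N).nonneg

theorem cutoff_le_one (R : ℝ) (x : Space N) : cutoff N R x ≤ 1 := (unitBump N).le_one

theorem abs_cutoff_le_one (R : ℝ) (x : Space N) : |cutoff N R x| ≤ 1 := by
  rw [abs_of_nonneg (cutoff_nonneg R x)]; exact cutoff_le_one R x

theorem cutoff_eq_one {R : ℝ} (hR : 0 < R) {x : Space N} (hx : ‖x‖ ≤ R) : cutoff N R x = 1 := by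
  refine (unitBump N).one_of_mem_closedBall ?_
  rw [mem_closedBall_zero_iff, norm_smul, norm_inv, Real.norm_eq_abs, abs_of_pos hR,
    inv_mul_le_iff₀ hR]
  simpa [unitBump] using hx

theorem cutoff_eq_zero {R : ℝ} (hR : 0 < R) {x : Space N} (hx : 2 * R ≤ ‖x‖) :
    cutoff N R x = 0 := by
  refine (unitBump N).zero_of_le_dist ?_
  rw [dist_zero_right, norm_smul, norm_inv, Real.norm_eq_abs, abs_of_pos hR, le_inv_mul_iff₀ hR]
  simp only [unitBump]
  linarith

theorem contDiff_cutoff (R : ℝ) : ContDiff ℝ (⊤ : ℕ∞) (cutoff N R) :=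
  (unitBump N).contDiff.comp (contDiff_const_smul _)

theorem tsupport_cutoff_subset {R : ℝ} (hR : 0 < R) :
    tsupport (cutoff N R) ⊆ Metric.closedBall 0 (2 * R) := by
  refine closure_minimal (fun x hx => ?_) Metric.isClosed_closedBall
  rw [mem_closedBall_zero_iff]
  by_contra h
  exact hx (cutoff_eq_zero hR (not_le.1 h).le)

theorem hasCompactSupport_cutoff {R : ℝ} (hR : 0 < R) : HasCompactSupport (cutoff N R) :=
  (isCompact_closedBall _ _).of_isClosed_subset (isClosed_tsupport _) (tsupport_cutoff_subset hR)

/-- A Lipschitz constant of the reference bump function. -/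
def bumpLip (N : ℕ) : NNReal :=
  (ContDiff.lipschitzWith_of_hasCompactSupport (unitBump N).hasCompactSupport
    ((unitBump N).contDiff (n := 1)) one_ne_zero).choose

theorem lipschitzWith_cutoff {R : ℝ} (hR : 0 < R) :
    LipschitzWith (bumpLip N * R⁻¹.toNNReal) (cutoff N R) := by
  have h1 : LipschitzWith (bumpLip N) (unitBump N) :=
    (ContDiff.lipschitzWith_of_hasCompactSupport (unitBump N).hasCompactSupport
      ((unitBump N).contDiff (n := 1)) one_ne_zero).choose_spec
  have h2 : LipschitzWith R⁻¹.toNNReal (fun x : Space N => R⁻¹ • x) := by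
    refine LipschitzWith.of_dist_le_mul fun x y => ?_
    rw [dist_smul₀, Real.coe_toNNReal _ (by positivity), Real.norm_eq_abs,
      abs_of_pos (by positivity)]
  exact h1.comp h2

theorem abs_cutoff_sub_le {R : ℝ} (hR : 0 < R) (x y : Space N) :
    |cutoff N R x - cutoff N R y| ≤ bumpLip N / R * ‖x - y‖ := by
  have := (lipschitzWith_cutoff (N := N) hR).dist_le_mul x y
  rwa [Real.dist_eq, dist_eq_norm, NNReal.coe_mul, Real.coe_toNNReal _ (by positivity),
    ← div_eq_mul_inv] at this

theorem norm_gradient (φ : Space N → ℝ) (x : Space N) : ‖∇ φ x‖ = ‖fderiv ℝ φ x‖ :=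
  LinearIsometryEquiv.norm_map _ _

theorem continuous_gradient {φ : Space N → ℝ} (hφ : ContDiff ℝ 1 φ) : Continuous (∇ φ) :=
  (LinearIsometryEquiv.continuous _).comp (hφ.continuous_fderiv one_ne_zero)

theorem hasCompactSupport_gradient {φ : Space N → ℝ} (hφ : HasCompactSupport φ) :
    HasCompactSupport (∇ φ) :=
  (hφ.fderiv ℝ).comp_left (map_zero _)

theorem norm_gradient_cutoff_le {R : ℝ} (hR : 0 < R) (x : Space N) :
    ‖∇ (cutoff N R) x‖ ≤ bumpLip N / R := by
  rw [norm_gradient]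
  refine (norm_fderiv_le_of_lipschitz ℝ (lipschitzWith_cutoff hR)).trans (le_of_eq ?_)
  rw [NNReal.coe_mul, Real.coe_toNNReal _ (by positivity), ← div_eq_mul_inv]

theorem gradient_cutoff_eq_zero_of_lt {R : ℝ} {x : Space N} (hx : ‖x‖ < R) :
    ∇ (cutoff N R) x = 0 := by
  have hR : 0 < R := (norm_nonneg x).trans_lt hx
  have : cutoff N R =ᶠ[𝓝 x] fun _ => 1 := by
    filter_upwards [continuous_norm.continuousAt.eventually_lt continuousAt_const hx] with y hy
    exact cutoff_eq_one hR hy.le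
  rw [← norm_eq_zero, norm_gradient, this.fderiv_eq]
  simp

theorem gradient_cutoff_eq_zero_of_gt {R : ℝ} (hR : 0 < R) {x : Space N} (hx : 2 * R < ‖x‖) :
    ∇ (cutoff N R) x = 0 := by
  have : cutoff N R =ᶠ[𝓝 x] fun _ => 0 := by
    filter_upwards [continuousAt_const.eventually_lt continuous_norm.continuousAt hx] with y hy
    exact cutoff_eq_zero hR hy.le
  rw [← norm_eq_zero, norm_gradient, this.fderiv_eq]
  simp

theorem norm_gradient_cutoff_mul_norm_le {R : ℝ} (hR : 0 < R) (x : Space N) :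
    ‖∇ (cutoff N R) x‖ * ‖x‖ ≤ 2 * bumpLip N := by
  by_cases hx : 2 * R < ‖x‖
  · rw [gradient_cutoff_eq_zero_of_gt hR hx, norm_zero, zero_mul]; positivity
  · calc ‖∇ (cutoff N R) x‖ * ‖x‖ ≤ (bumpLip N / R) * (2 * R) :=
          mul_le_mul (norm_gradient_cutoff_le hR x) (not_lt.1 hx) (norm_nonneg _) (by positivity)
      _ = 2 * bumpLip N := by field_simp

/-- Dilating the cutoff by a factor `t ∈ [1, 2]` changes it by at most `C (t - 1)`, and only outside
the ball of radius `R`. -/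
theorem abs_cutoff_dilate_sub_le {R t : ℝ} (hR : 0 < R) (ht : 1 ≤ t) (ht2 : t ≤ 2) (y : Space N) :
    |cutoff N R (t⁻¹ • y) - cutoff N R y|
      ≤ (t - 1) * (4 * bumpLip N) * Set.indicator {x : Space N | R ≤ ‖x‖} (fun _ => (1 : ℝ)) y := by
  have ht0 : 0 < t := by linarith
  have hti : t⁻¹ ≤ 1 := inv_le_one_of_one_le₀ ht
  have hn : ‖t⁻¹ • y‖ = t⁻¹ * ‖y‖ := by
    rw [norm_smul, Real.norm_eq_abs, abs_of_pos (by positivity)]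
  by_cases h1 : R ≤ ‖y‖
  · rw [Set.indicator_of_mem (by exact h1), mul_one]
    by_cases h2 : ‖y‖ ≤ 4 * R
    · refine (abs_cutoff_sub_le hR _ _).trans ?_
      have e : t⁻¹ • y - y = (t⁻¹ - 1) • y := by rw [sub_smul, one_smul]
      rw [e, norm_smul, Real.norm_eq_abs, abs_of_nonpos (by linarith)]
      have h3 : -(t⁻¹ - 1) ≤ t - 1 := by
        rw [show -(t⁻¹ - 1) = (t - 1) / t by field_simp; ring]
        exact div_le_self (by linarith) ht
      calc (bumpLip N : ℝ) / R * (-(t⁻¹ - 1) * ‖y‖) ≤ bumpLip N / R * ((t - 1) * (4 * R)) := by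
            gcongr
        _ = (t - 1) * (4 * bumpLip N) := by field_simp
    · rw [not_le] at h2
      rw [cutoff_eq_zero hR (x := y) (by linarith), cutoff_eq_zero hR (x := t⁻¹ • y)]
      · simp only [sub_self, abs_zero]
        have : (0 : ℝ) ≤ t - 1 := by linarith
        positivity
      · rw [hn, le_inv_mul_iff₀ ht0]; nlinarith
  · rw [Set.indicator_of_notMem (by exact h1), mul_zero]
    rw [not_le] at h1
    rw [cutoff_eq_one hR h1.le, cutoff_eq_one hR, sub_self, abs_zero]
    rw [hn]
    nlinarith [norm_nonneg y]

/-- The scale-invariant norm of the gradient of the cutoff is bounded. -/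
theorem eLpNorm_gradient_cutoff_le (hN : 0 < N) {R : ℝ} (hR : 0 < R) :
    eLpNorm (∇ (cutoff N R)) N volume
      ≤ ENNReal.ofReal (2 * bumpLip N)
        * (volume (Metric.closedBall (0 : Space N) 1)) ^ (1 / (N : ℝ)) := by
  have hN0 : (0 : ℝ) < N := by exact_mod_cast hN
  have hsupp : ∀ x, ‖∇ (cutoff N R) x‖
      ≤ ‖(Metric.closedBall (0 : Space N) (2 * R)).indicator (fun _ => (bumpLip N / R : ℝ)) x‖ := by
    intro x
    by_cases hx : x ∈ Metric.closedBall (0 : Space N) (2 * R)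
    · rw [Set.indicator_of_mem hx, Real.norm_of_nonneg (by positivity)]
      exact norm_gradient_cutoff_le hR x
    · rw [mem_closedBall_zero_iff, not_le] at hx
      rw [gradient_cutoff_eq_zero_of_gt hR hx, norm_zero]
      exact norm_nonneg _
  refine (eLpNorm_mono hsupp).trans ?_
  rw [eLpNorm_indicator_const Metric.isClosed_closedBall.measurableSet (by simpa using hN.ne')
    (ENNReal.natCast_ne_top N), Measure.addHaar_closedBall' _ _ (by positivity),
    ENNReal.mul_rpow_of_nonneg _ _ (by positivity), ← mul_assoc]
  refine mul_le_mul' (le_of_eq ?_) (by simp)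
  simp only [finrank_euclideanSpace, Fintype.card_fin, ENNReal.toReal_natCast]
  rw [ENNReal.ofReal_rpow_of_nonneg (by positivity) (by positivity), ← Real.rpow_natCast,
    ← Real.rpow_mul (by positivity), mul_one_div_cancel hN0.ne', Real.rpow_one,
    Real.enorm_of_nonneg (by positivity), ← ENNReal.ofReal_mul (by positivity)]
  congr 1
  field_simp

end Cutoff

/-! ### The space `D^{1,p}` -/

section Exponents

variable {N : ℕ} {p : ℝ}

theorem lt_sobolevExp (hp : 1 < p) (hpN : p < N) : p < sobolevExp N p := by
  rw [sobolevExp, lt_div_iff₀ (by linarith)]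
  nlinarith

theorem one_lt_sobolevExp (hp : 1 < p) (hpN : p < N) : 1 < sobolevExp N p :=
  hp.trans (lt_sobolevExp hp hpN)

theorem one_le_ofReal_sobolevExp (hp : 1 < p) (hpN : p < N) :
    1 ≤ ENNReal.ofReal (sobolevExp N p) := by
  rw [ENNReal.one_le_ofReal]; exact (one_lt_sobolevExp hp hpN).le

theorem one_le_ofReal_of_one_lt (hp : 1 < p) : 1 ≤ ENNReal.ofReal p := by
  rw [ENNReal.one_le_ofReal]; exact hp.le

theorem inv_sobolevExp (hp : 1 < p) (hpN : p < N) :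
    (sobolevExp N p)⁻¹ = p⁻¹ - (N : ℝ)⁻¹ := by
  have : (N : ℝ) - p ≠ 0 := by linarith
  have h2 : (N : ℝ) ≠ 0 := by linarith
  have h3 : p ≠ 0 := by linarith
  rw [sobolevExp]
  field_simp

theorem holderTriple_sobolev (hp : 1 < p) (hpN : p < N) :
    ENNReal.HolderTriple (N : ℝ≥0∞) (ENNReal.ofReal (sobolevExp N p)) (ENNReal.ofReal p) := by
  have hN : (0 : ℝ) < N := by linarith
  have hs := one_lt_sobolevExp hp hpN
  constructor
  rw [← ENNReal.ofReal_natCast, ← ENNReal.ofReal_inv_of_pos hN,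
    ← ENNReal.ofReal_inv_of_pos (by linarith), ← ENNReal.ofReal_inv_of_pos (by linarith),
    ← ENNReal.ofReal_add (by positivity) (by positivity), inv_sobolevExp hp hpN]
  congr 1
  ring

end Exponents

section Pairing

variable {E F : Type*} [MeasurableSpace E] {μ : Measure E} [NormedAddCommGroup F]

theorem tendsto_integral_mul_of_tendsto_eLpNorm {ι : Type*} {l : Filter ι} {q : ℝ≥0∞}
    (hq1 : 1 ≤ q) {f : ι → E → ℝ} {f₀ g : E → ℝ} (hf : ∀ i, MemLp (f i) q μ) (hf₀ : MemLp f₀ q μ)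
    (hg : MemLp g q.conjExponent μ)
    (hlim : Tendsto (fun i => eLpNorm (f i - f₀) q μ) l (𝓝 0)) :
    Tendsto (fun i => ∫ x, g x * f i x ∂μ) l (𝓝 (∫ x, g x * f₀ x ∂μ)) := by
  have hH : ENNReal.HolderConjugate q.conjExponent q :=
    (ENNReal.HolderConjugate.conjExponent hq1).symm
  refine tendsto_integral_of_L1 _ (hg.1.mul hf₀.1)
    (Eventually.of_forall fun i => hg.integrable_mul (p := q.conjExponent) (q := q) (hf i)) ?_
  have hlim' := ENNReal.Tendsto.const_mul hlim (a := eLpNorm g q.conjExponent μ)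
    (Or.inr hg.2.ne)
  rw [mul_zero] at hlim'
  refine tendsto_of_tendsto_of_tendsto_of_le_of_le tendsto_const_nhds hlim'
    (fun _ => zero_le) fun i => ?_
  have := eLpNorm_smul_le_mul_eLpNorm (p := q.conjExponent) (q := q) (r := 1) ((hf i).sub hf₀).1 hg.1
  rw [eLpNorm_one_eq_lintegral_enorm] at this
  refine le_trans (le_of_eq (lintegral_congr fun x => ?_)) this
  simp [mul_sub]

end Pairing

section D1p

variable {N : ℕ} {p : ℝ}

theorem isD1p_of_memLp (hp : 1 < p) (hpN : p < N) {v : Space N → ℝ} {W : Space N → Space N}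
    (hv : MemLp v (ENNReal.ofReal (sobolevExp N p)) volume)
    (hW : MemLp W (ENNReal.ofReal p) volume)
    (h : ∀ φ : Space N → ℝ, ContDiff ℝ (⊤ : ℕ∞) φ → HasCompactSupport φ → ∀ e : Space N,
      ∫ x, v x * fderiv ℝ φ x e = - ∫ x, φ x * inner ℝ (W x) e) : IsD1p p v W :=
  ⟨hv, hW, hv.locallyIntegrable (one_le_ofReal_sobolevExp hp hpN),
    hW.locallyIntegrable (one_le_ofReal_of_one_lt hp), h⟩

theorem memLp_fderiv_apply {φ : Space N → ℝ} (hφ : ContDiff ℝ 1 φ) (hφc : HasCompactSupport φ)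
    (e : Space N) (q : ℝ≥0∞) : MemLp (fun x => fderiv ℝ φ x e) q volume := by
  refine Continuous.memLp_of_hasCompactSupport ?_ (hφc.fderiv_apply ℝ e)
  exact (hφ.continuous_fderiv one_ne_zero).clm_apply continuous_const

theorem memLp_inner_const {W : Space N → Space N} {q : ℝ≥0∞} (hW : MemLp W q volume)
    (e : Space N) : MemLp (fun x => inner ℝ (W x) e) q volume :=
  hW.inner_const e

theorem isD1p_of_contDiff (hp : 1 < p) (hpN : p < N) {φ : Space N → ℝ} (hφ : ContDiff ℝ 1 φ)
    (hφc : HasCompactSupport φ) : IsD1p p φ (∇ φ) := by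
  refine isD1p_of_memLp hp hpN (hφ.continuous.memLp_of_hasCompactSupport hφc)
    ((continuous_gradient hφ).memLp_of_hasCompactSupport (hasCompactSupport_gradient hφc))
    fun χ hχ hχc e => ?_
  have hχ1 : ContDiff ℝ 1 χ := hχ.of_le (by exact_mod_cast le_top)
  have cφ : Continuous fun x => fderiv ℝ φ x e :=
    (hφ.continuous_fderiv one_ne_zero).clm_apply continuous_const
  have cχ : Continuous fun x => fderiv ℝ χ x e :=
    (hχ1.continuous_fderiv one_ne_zero).clm_apply continuous_const
  rw [integral_mul_fderiv_eq_neg_fderiv_mul_of_integrable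
    ((cφ.mul hχ.continuous).integrable_of_hasCompactSupport hχc.mul_left)
    ((hφ.continuous.mul cχ).integrable_of_hasCompactSupport hφc.mul_right)
    ((hφ.continuous.mul hχ.continuous).integrable_of_hasCompactSupport hχc.mul_left)
    (fun x _ => hφ.differentiable one_ne_zero x) (fun x _ => hχ1.differentiable one_ne_zero x)]
  congr 1
  refine integral_congr_ae (ae_of_all _ fun x => ?_)
  simp only [inner_gradient_left]
  ring

theorem IsD1p.integrable_mul_fderiv (hp : 1 < p) (hpN : p < N) {v : Space N → ℝ}
    {W : Space N → Space N} (h : IsD1p p v W)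
    {φ : Space N → ℝ} (hφ : ContDiff ℝ 1 φ) (hφc : HasCompactSupport φ) (e : Space N) :
    Integrable (fun x => v x * fderiv ℝ φ x e) volume := by
  have hH : ENNReal.HolderConjugate (ENNReal.ofReal (sobolevExp N p))
      (ENNReal.ofReal (sobolevExp N p)).conjExponent :=
    ENNReal.HolderConjugate.conjExponent (one_le_ofReal_sobolevExp hp hpN)
  exact h.memLp.integrable_mul (q := (ENNReal.ofReal (sobolevExp N p)).conjExponent)
    (memLp_fderiv_apply hφ hφc e _)

theorem IsD1p.integrable_mul_inner (hp : 1 < p) {v : Space N → ℝ}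
    {W : Space N → Space N} (h : IsD1p p v W)
    {φ : Space N → ℝ} (hφ : Continuous φ) (hφc : HasCompactSupport φ) (e : Space N) :
    Integrable (fun x => φ x * inner ℝ (W x) e) volume := by
  have hH : ENNReal.HolderConjugate (ENNReal.ofReal p) (ENNReal.ofReal p).conjExponent :=
    ENNReal.HolderConjugate.conjExponent (one_le_ofReal_of_one_lt hp)
  have hH' := hH.symm
  exact (hφ.memLp_of_hasCompactSupport hφc).integrable_mul
    (p := (ENNReal.ofReal p).conjExponent) (memLp_inner_const h.memLp_grad e)

theorem IsD1p.sub (hp : 1 < p) (hpN : p < N) {v v' : Space N → ℝ} {W W' : Space N → Space N}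
    (h : IsD1p p v W) (h' : IsD1p p v' W') :
    IsD1p p (fun x => v x - v' x) (fun x => W x - W' x) := by
  refine isD1p_of_memLp hp hpN (h.memLp.sub h'.memLp) (h.memLp_grad.sub h'.memLp_grad)
    fun φ hφ hφc e => ?_
  have hφ1 : ContDiff ℝ 1 φ := hφ.of_le (by exact_mod_cast le_top)
  simp only [sub_mul, inner_sub_left, mul_sub]
  rw [integral_sub (h.integrable_mul_fderiv hp hpN hφ1 hφc e)
      (h'.integrable_mul_fderiv hp hpN hφ1 hφc e),
    integral_sub (h.integrable_mul_inner hp hφ.continuous hφc e)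
      (h'.integrable_mul_inner hp hφ.continuous hφc e),
    h.hasWeakGradient.integral_eq φ hφ hφc e, h'.hasWeakGradient.integral_eq φ hφ hφc e]
  ring

/-- Dilation acts on `D^{1,p}`, multiplying the gradient by the dilation factor. -/
theorem IsD1p.comp_smul (hp : 1 < p) (hpN : p < N) {v : Space N → ℝ} {W : Space N → Space N}
    (h : IsD1p p v W) {t : ℝ} (ht : 1 ≤ t) :
    IsD1p p (fun x => v (t • x)) (fun x => t • W (t • x)) := by
  have ht0 : 0 < t := by linarith
  refine isD1p_of_memLp hp hpN (memLp_comp_smul ht h.memLp)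
    ((memLp_comp_smul ht h.memLp_grad).const_smul t) fun φ hφ hφc e => ?_
  have hφ1 : ContDiff ℝ 1 φ := hφ.of_le (by exact_mod_cast le_top)
  -- the test function is dilated by the inverse factor
  have hψ : ContDiff ℝ (⊤ : ℕ∞) (fun x => φ (t⁻¹ • x)) := hφ.comp (contDiff_const_smul _)
  have hψc : HasCompactSupport (fun x => φ (t⁻¹ • x)) :=
    hφc.comp_homeomorph (Homeomorph.smulOfNeZero t⁻¹ (by positivity))
  have key := h.hasWeakGradient.integral_eq _ hψ hψc e
  have hd : ∀ x, fderiv ℝ (fun x => φ (t⁻¹ • x)) x e = t⁻¹ * fderiv ℝ φ (t⁻¹ • x) e := by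
    intro x
    rw [fderiv_comp_smul]
    simp
  have e1 := Measure.integral_comp_smul volume
    (fun x => v x * fderiv ℝ (fun x => φ (t⁻¹ • x)) x e) t
  have e2 := Measure.integral_comp_smul volume
    (fun x => φ (t⁻¹ • x) * inner ℝ (W x) e) t
  rw [key, smul_neg, ← e2] at e1
  simp only [hd, inv_smul_smul₀ ht0.ne'] at e1
  have e3 : ∫ x, v (t • x) * fderiv ℝ φ x e
      = t * ∫ x, v (t • x) * (t⁻¹ * fderiv ℝ φ x e) := by
    rw [← integral_const_mul]
    refine integral_congr_ae (ae_of_all _ fun x => ?_)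
    simp only
    field_simp
  rw [e3, e1, mul_neg, ← integral_const_mul]
  congr 1
  refine integral_congr_ae (ae_of_all _ fun x => ?_)
  simp only [inner_smul_left, conj_trivial]
  ring

theorem IsD1p.memLp_smul_gradient (hp : 1 < p) (hpN : p < N) {v : Space N → ℝ}
    {W : Space N → Space N} (h : IsD1p p v W) {η : Space N → ℝ} (hη : ContDiff ℝ (⊤ : ℕ∞) η)
    (hηc : HasCompactSupport η) : MemLp (fun x => v x • ∇ η x) (ENNReal.ofReal p) volume := by
  have hη1 : ContDiff ℝ 1 η := hη.of_le (by exact_mod_cast le_top)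
  have hH := (holderTriple_sobolev hp hpN).symm
  exact ((continuous_gradient hη1).memLp_of_hasCompactSupport
    (hasCompactSupport_gradient hηc) (p := N)).smul h.memLp

/-- The product rule in `D^{1,p}`; the term `v Dη` lies in `L^p` because `1/p = 1/p* + 1/N`. -/
theorem IsD1p.contDiff_mul (hp : 1 < p) (hpN : p < N) {v : Space N → ℝ} {W : Space N → Space N}
    (h : IsD1p p v W) {η : Space N → ℝ} (hη : ContDiff ℝ (⊤ : ℕ∞) η) (hηc : HasCompactSupport η) :
    IsD1p p (fun x => η x * v x) (fun x => η x • W x + v x • ∇ η x) := by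
  have hη1 : ContDiff ℝ 1 η := hη.of_le (by exact_mod_cast le_top)
  have hηb : MemLp η ⊤ volume := hη.continuous.memLp_of_hasCompactSupport hηc
  refine isD1p_of_memLp hp hpN (h.memLp.mul hηb)
    ((h.memLp_grad.smul hηb).add (h.memLp_smul_gradient hp hpN hη hηc)) fun φ hφ hφc e => ?_
  have hφ1 : ContDiff ℝ 1 φ := hφ.of_le (by exact_mod_cast le_top)
  have hηφ : ContDiff ℝ (⊤ : ℕ∞) (η * φ) := hη.mul hφ
  have hηφc : HasCompactSupport (η * φ) := hφc.mul_left
  have key := h.hasWeakGradient.integral_eq _ hηφ hηφc e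
  have hd : ∀ x, fderiv ℝ (η * φ) x e = η x * fderiv ℝ φ x e + φ x * fderiv ℝ η x e := by
    intro x
    rw [fderiv_mul (hη1.differentiable one_ne_zero x) (hφ1.differentiable one_ne_zero x)]
    simp
  -- the two integrals produced by the product rule
  have i1 : Integrable (fun x => v x * fderiv ℝ (η * φ) x e) volume :=
    h.integrable_mul_fderiv hp hpN (hηφ.of_le (by exact_mod_cast le_top)) hηφc e
  have i2 : Integrable (fun x => φ x * (v x * inner ℝ (∇ η x) e)) volume := by
    have hH : ENNReal.HolderConjugate (ENNReal.ofReal p) (ENNReal.ofReal p).conjExponent :=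
      ENNReal.HolderConjugate.conjExponent (one_le_ofReal_of_one_lt hp)
    have hH' := hH.symm
    refine ((hφ.continuous.memLp_of_hasCompactSupport hφc).integrable_mul
      (p := (ENNReal.ofReal p).conjExponent)
      (memLp_inner_const (h.memLp_smul_gradient hp hpN hη hηc) e)).congr (ae_of_all _ fun x => ?_)
    simp [inner_smul_left]
  have i3 := h.integrable_mul_inner hp hηφ.continuous hηφc e
  calc ∫ x, η x * v x * fderiv ℝ φ x e
      = ∫ x, (v x * fderiv ℝ (η * φ) x e - φ x * (v x * inner ℝ (∇ η x) e)) := by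
        refine integral_congr_ae (ae_of_all _ fun x => ?_)
        simp only [hd, inner_gradient_left]; ring
    _ = - ∫ x, ((η * φ) x * inner ℝ (W x) e + φ x * (v x * inner ℝ (∇ η x) e)) := by
        rw [integral_sub i1 i2, key, integral_add i3 i2]; ring
    _ = - ∫ x, φ x * inner ℝ (η x • W x + v x • ∇ η x) e := by
        congr 1
        refine integral_congr_ae (ae_of_all _ fun x => ?_)
        simp only [inner_add_left, inner_smul_left, conj_trivial, Pi.mul_apply]; ring

theorem IsD1p.gradient_mollify {v : Space N → ℝ} {W : Space N → Space N} (h : IsD1p p v W)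
    (ρ : ContDiffBump (0 : Space N)) : ∇ (mollify ρ v) = mollify ρ W := by
  ext1 x
  refine ext_inner_right ℝ fun e => ?_
  have hρ1 : ContDiff ℝ (⊤ : ℕ∞) (ρ.normed volume) := ρ.contDiff_normed
  have hρ1' : ContDiff ℝ 1 (ρ.normed volume) := hρ1.of_le (by exact_mod_cast le_top)
  have hv := h.hasWeakGradient.locallyIntegrable
  have hd := ρ.hasCompactSupport_normed.hasFDerivAt_convolution_right
    (lsmul ℝ ℝ : ℝ →L[ℝ] ℝ →L[ℝ] ℝ).flip hv hρ1' x
  rw [convolution_flip] at hd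
  rw [inner_gradient_left, mollify, hd.fderiv, convolution_precompR_apply _ hv
    (ρ.hasCompactSupport_normed.fderiv ℝ) (hρ1'.continuous_fderiv one_ne_zero)]
  -- the reflected and translated mollifier serves as the test function
  have hψ : ContDiff ℝ (⊤ : ℕ∞) (fun y => ρ.normed volume (x - y)) :=
    hρ1.comp (contDiff_const.sub contDiff_id)
  have hψc : HasCompactSupport (fun y => ρ.normed volume (x - y)) :=
    ρ.hasCompactSupport_normed.comp_homeomorph (Homeomorph.subLeft x)
  have key := h.hasWeakGradient.integral_eq _ hψ hψc e
  have hdψ : ∀ y, fderiv ℝ (fun y => ρ.normed volume (x - y)) y e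
      = - fderiv ℝ (ρ.normed volume) (x - y) e := by
    intro y
    have := ((hρ1'.differentiable one_ne_zero (x - y)).hasFDerivAt.comp y
      ((hasFDerivAt_const x y).sub (hasFDerivAt_id y))).fderiv
    rw [Function.comp_def] at this
    rw [this]
    simp
  simp only [hdψ, mul_neg, integral_neg, neg_inj] at key
  have hint : Integrable (fun y => ρ.normed volume (x - y) • W y) volume :=
    h.hasWeakGradient.locallyIntegrable_grad.integrable_smul_left_of_hasCompactSupport
      hψ.continuous hψc
  rw [convolution_def, mollify, convolution_eq_swap]
  simp only [lsmul_apply, flip_apply, smul_eq_mul]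
  rw [real_inner_comm, ← integral_inner hint]
  calc _ = ∫ y, v y * fderiv ℝ (ρ.normed volume) (x - y) e :=
        integral_congr_ae (ae_of_all _ fun y => mul_comm _ _)
    _ = _ := by
        rw [key]
        refine integral_congr_ae (ae_of_all _ fun y => ?_)
        simp only [inner_smul_right, real_inner_comm]

end D1p

/-! ### Density of test functions and its consequences -/

section Density

variable {N : ℕ} {p : ℝ}

/-- Multiplication by large cutoffs converges to the identity in `D^{1,p}`. -/
theorem IsD1p.tendsto_mul_cutoff_grad (hp : 1 < p) (hpN : p < N) {v : Space N → ℝ}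
    {W : Space N → Space N} (h : IsD1p p v W) :
    Tendsto (fun R : ℝ => eLpNorm (fun x => cutoff N R x • W x + v x • ∇ (cutoff N R) x - W x)
      (ENNReal.ofReal p) volume) atTop (𝓝 0) := by
  have hp1 := one_le_ofReal_of_one_lt hp
  have hs1 := one_le_ofReal_sobolevExp hp hpN
  have hN : 0 < N := by
    have : (0 : ℝ) < N := by linarith
    exact_mod_cast this
  -- up to sign, `m R • v - v` is the part of `v` outside the open ball of radius `R`; only this
  -- part meets the gradient of the cutoff
  set m : ℝ → Space N → ℝ := fun R => Set.indicator {x | ‖x‖ < R} (fun _ => 1) with hm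
  have hmm : ∀ R, Measurable (m R) := fun R =>
    measurable_const.indicator (measurableSet_lt measurable_norm measurable_const)
  have htail := tendsto_mul_cutoff (l := atTop) (m := fun R : ℝ => m R) (R := fun R => R - 1)
    ENNReal.ofReal_ne_top hs1
    (tendsto_atTop_add_const_right _ _ tendsto_id)
    (Eventually.of_forall fun R => (hmm R).aestronglyMeasurable)
    (Eventually.of_forall fun R x => by
      simp only [hm, Set.indicator_apply]; split_ifs <;> simp)
    (Eventually.of_forall fun R x hx => by
      simp only [hm]; rw [Set.indicator_of_mem]; simp only [Set.mem_ofPred_eq]; linarith) h.memLp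
  have hcut := tendsto_mul_cutoff (l := atTop) (m := fun R : ℝ => cutoff N R) (R := fun R => R)
    ENNReal.ofReal_ne_top hp1 tendsto_id
    (Eventually.of_forall fun R => (contDiff_cutoff R).continuous.aestronglyMeasurable)
    (Eventually.of_forall fun R x => abs_cutoff_le_one R x)
    ((eventually_gt_atTop 0).mono fun R hR x hx => cutoff_eq_one hR hx) h.memLp_grad
  set C : ℝ≥0∞ := ENNReal.ofReal (2 * bumpLip N)
    * (volume (Metric.closedBall (0 : Space N) 1)) ^ (1 / (N : ℝ)) with hC
  have hCtop : C ≠ ⊤ := ENNReal.mul_ne_top ENNReal.ofReal_ne_top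
    (ENNReal.rpow_ne_top_of_nonneg (by positivity) measure_closedBall_lt_top.ne)
  have hlim := hcut.add (ENNReal.Tendsto.const_mul htail (a := C) (Or.inr hCtop))
  rw [mul_zero, add_zero] at hlim
  refine tendsto_of_tendsto_of_tendsto_of_le_of_le' tendsto_const_nhds hlim
    (Eventually.of_forall fun _ => zero_le) ?_
  filter_upwards [eventually_gt_atTop 0] with R hR
  have hg1 : ContDiff ℝ 1 (cutoff N R) := (contDiff_cutoff R).of_le (by exact_mod_cast le_top)
  have e : (fun x => cutoff N R x • W x + v x • ∇ (cutoff N R) x - W x)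
      = (fun x => cutoff N R x • W x - W x)
        + fun x => -((m R x • v x - v x) • ∇ (cutoff N R) x) := by
    ext1 x
    simp only [Pi.add_apply]
    by_cases hx : ‖x‖ < R
    · rw [gradient_cutoff_eq_zero_of_lt hx]; simp
    · have : m R x = 0 := Set.indicator_of_notMem (by simpa using hx) _
      rw [this]; simp; abel
  have hcm : AEStronglyMeasurable (fun x => cutoff N R x • W x - W x) volume :=
    ((contDiff_cutoff R).continuous.aestronglyMeasurable.smul h.memLp_grad.1).sub h.memLp_grad.1
  have hgm := (continuous_gradient hg1).aestronglyMeasurable (μ := (volume : Measure (Space N)))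
  have hvm : AEStronglyMeasurable (fun x => m R x • v x - v x) volume :=
    (((hmm R).aestronglyMeasurable).smul h.memLp.1).sub h.memLp.1
  rw [e]
  refine (eLpNorm_add_le hcm (hvm.smul hgm).neg hp1).trans (add_le_add le_rfl ?_)
  rw [eLpNorm_neg, mul_comm]
  have hH := (holderTriple_sobolev hp hpN).symm
  refine (eLpNorm_smul_le_mul_eLpNorm (p := ENNReal.ofReal (sobolevExp N p)) (q := N)
    hgm hvm).trans ?_
  gcongr
  exact eLpNorm_gradient_cutoff_le hN hR

theorem IsD1p.contDiff_hasCompactSupport_mollify {v : Space N → ℝ} {W : Space N → Space N}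
    (h : IsD1p p v W) (hvc : HasCompactSupport v) (ρ : ContDiffBump (0 : Space N)) :
    ContDiff ℝ (⊤ : ℕ∞) (mollify ρ v) ∧ HasCompactSupport (mollify ρ v) :=
  ⟨contDiff_mollify ρ h.hasWeakGradient.locallyIntegrable,
    hvc.isCompact.cthickening.of_isClosed_subset (isClosed_tsupport _)
      (closure_minimal (support_mollify_subset ρ (subset_tsupport v) le_rfl)
        Metric.isClosed_cthickening)⟩

theorem exists_contDiffBump_tendsto (N : ℕ) :
    ∃ ρ : ℕ → ContDiffBump (0 : Space N), Tendsto (fun n => (ρ n).rOut) atTop (𝓝 0) := by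
  refine ⟨fun n => ⟨1 / ((n : ℝ) + 1) / 2, 1 / ((n : ℝ) + 1), by positivity,
    half_lt_self (by positivity)⟩, ?_⟩
  exact tendsto_one_div_add_atTop_nhds_zero_nat

/-- Smooth compactly supported functions are dense in `D^{1,p}`. -/
theorem IsD1p.exists_approx (hp : 1 < p) (hpN : p < N) {v : Space N → ℝ} {W : Space N → Space N}
    (h : IsD1p p v W) : ∃ φ : ℕ → Space N → ℝ,
      (∀ n, ContDiff ℝ (⊤ : ℕ∞) (φ n)) ∧ (∀ n, HasCompactSupport (φ n)) ∧
      Tendsto (fun n => eLpNorm (φ n - v) (ENNReal.ofReal (sobolevExp N p)) volume)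
        atTop (𝓝 0) ∧
      Tendsto (fun n => eLpNorm (∇ (φ n) - W) (ENNReal.ofReal p) volume) atTop (𝓝 0) := by
  have hp1 := one_le_ofReal_of_one_lt hp
  have hs1 := one_le_ofReal_sobolevExp hp hpN
  have key : ∀ ε : ℝ≥0∞, 0 < ε → ∃ φ : Space N → ℝ, ContDiff ℝ (⊤ : ℕ∞) φ ∧
      HasCompactSupport φ ∧ eLpNorm (φ - v) (ENNReal.ofReal (sobolevExp N p)) volume ≤ ε ∧
      eLpNorm (∇ φ - W) (ENNReal.ofReal p) volume ≤ ε := by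
    intro ε hε
    have hε2 : 0 < ε / 2 := ENNReal.half_pos hε.ne'
    have hcut := tendsto_mul_cutoff (l := atTop) (m := fun R : ℝ => cutoff N R) (R := fun R => R)
      ENNReal.ofReal_ne_top hs1 tendsto_id
      (Eventually.of_forall fun R => (contDiff_cutoff R).continuous.aestronglyMeasurable)
      (Eventually.of_forall fun R x => abs_cutoff_le_one R x)
      ((eventually_gt_atTop 0).mono fun R hR x hx => cutoff_eq_one hR hx) h.memLp
    obtain ⟨R, hR1, hR2, hR⟩ := ((ENNReal.tendsto_nhds_zero.1 hcut _ hε2).and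
      ((ENNReal.tendsto_nhds_zero.1 (h.tendsto_mul_cutoff_grad hp hpN) _ hε2).and
        (eventually_gt_atTop 0))).exists
    have h' := h.contDiff_mul hp hpN (contDiff_cutoff R) (hasCompactSupport_cutoff hR)
    have hc' : HasCompactSupport (fun x => cutoff N R x * v x) :=
      (hasCompactSupport_cutoff hR).mul_right
    obtain ⟨ρ, hρ⟩ := exists_contDiffBump_tendsto N
    obtain ⟨n, hn1, hn2⟩ := ((ENNReal.tendsto_nhds_zero.1
      (tendsto_mollify ENNReal.ofReal_ne_top hs1 ρ hρ h'.memLp) _ hε2).and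
      (ENNReal.tendsto_nhds_zero.1
      (tendsto_mollify ENNReal.ofReal_ne_top hp1 ρ hρ h'.memLp_grad) _ hε2)).exists
    have hm := h'.contDiff_hasCompactSupport_mollify hc' (ρ n)
    refine ⟨_, hm.1, hm.2, ?_, ?_⟩
    · rw [← sub_add_sub_cancel _ (fun x => cutoff N R x * v x) v]
      refine (eLpNorm_add_le (hm.1.continuous.aestronglyMeasurable.sub h'.memLp.1)
        (h'.memLp.1.sub h.memLp.1) hs1).trans ?_
      exact (add_le_add hn1 hR1).trans (ENNReal.add_halves ε).le
    · rw [h'.gradient_mollify, ← sub_add_sub_cancel _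
        (fun x => cutoff N R x • W x + v x • ∇ (cutoff N R) x) W]
      have hmm := (contDiff_mollify (ρ n) h'.hasWeakGradient.locallyIntegrable_grad)
      refine (eLpNorm_add_le (hmm.continuous.aestronglyMeasurable.sub h'.memLp_grad.1)
        (h'.memLp_grad.1.sub h.memLp_grad.1) hp1).trans ?_
      exact (add_le_add hn2 hR2).trans (ENNReal.add_halves ε).le
  have hpos : ∀ n : ℕ, (0 : ℝ≥0∞) < ((n : ℝ≥0∞) + 1)⁻¹ := fun n =>
    ENNReal.inv_pos.2 (by simp)
  choose φ h1 h2 h3 h4 using fun n : ℕ => key _ (hpos n)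
  have hlim : Tendsto (fun n : ℕ => ((n : ℝ≥0∞) + 1)⁻¹) atTop (𝓝 0) := by
    have := ENNReal.tendsto_inv_nat_nhds_zero.comp (tendsto_add_atTop_nat 1)
    simpa [Function.comp_def] using this
  exact ⟨φ, h1, h2,
    tendsto_of_tendsto_of_tendsto_of_le_of_le tendsto_const_nhds hlim (fun _ => zero_le) h3,
    tendsto_of_tendsto_of_tendsto_of_le_of_le tendsto_const_nhds hlim (fun _ => zero_le) h4⟩

theorem eLpNorm_le_add_eLpNorm_sub {E F : Type*} [MeasurableSpace E] {μ : Measure E}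
    [NormedAddCommGroup F] {q : ℝ≥0∞} (hq : 1 ≤ q) {f f₀ : E → F}
    (hf : AEStronglyMeasurable f μ) (hf₀ : AEStronglyMeasurable f₀ μ) :
    eLpNorm f q μ ≤ eLpNorm f₀ q μ + eLpNorm (f - f₀) q μ := by
  calc eLpNorm f q μ = eLpNorm (f₀ + (f - f₀)) q μ := by rw [add_sub_cancel]
    _ ≤ _ := eLpNorm_add_le hf₀ (hf.sub hf₀) hq

/-- The Gagliardo–Nirenberg–Sobolev inequality in `D^{1,p}`. -/
theorem exists_sobolev_const (hp : 1 < p) (hpN : p < N) : ∃ C : NNReal,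
    ∀ (v : Space N → ℝ) (W : Space N → Space N), IsD1p p v W →
      eLpNorm v (ENNReal.ofReal (sobolevExp N p)) volume
        ≤ C * eLpNorm W (ENNReal.ofReal p) volume := by
  refine ⟨SNormLESNormFDerivOfEqConst ℝ (volume : Measure (Space N)) p.toNNReal,
    fun v W h => ?_⟩
  set C := SNormLESNormFDerivOfEqConst ℝ (volume : Measure (Space N)) p.toNNReal
  have hp1 := one_le_ofReal_of_one_lt hp
  have hs1 := one_le_ofReal_sobolevExp hp hpN
  obtain ⟨φ, hφ, hφc, hv, hW⟩ := h.exists_approx hp hpN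
  have hlim := hv.add (ENNReal.Tendsto.const_mul
    ((tendsto_const_nhds (x := eLpNorm W (ENNReal.ofReal p) volume)).add hW)
    (a := (C : ℝ≥0∞)) (Or.inr ENNReal.coe_ne_top))
  rw [add_zero, zero_add] at hlim
  refine ge_of_tendsto' hlim fun n => ?_
  have hφ1 : ContDiff ℝ 1 (φ n) := (hφ n).of_le (by exact_mod_cast le_top)
  have hφm := (hφ n).continuous.aestronglyMeasurable (μ := (volume : Measure (Space N)))
  have hS : eLpNorm (φ n) (ENNReal.ofReal (sobolevExp N p)) volume
      ≤ C * eLpNorm (∇ (φ n)) (ENNReal.ofReal p) volume := by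
    have := eLpNorm_le_eLpNorm_fderiv_of_eq (volume : Measure (Space N)) hφ1 (hφc n)
      (p := p.toNNReal) (p' := (sobolevExp N p).toNNReal)
      (by rw [← Real.toNNReal_one]; exact Real.toNNReal_le_toNNReal hp.le)
      (by rw [finrank_euclideanSpace_fin]
          have : (0 : ℝ) < N := by linarith
          exact_mod_cast this)
      (by rw [finrank_euclideanSpace_fin, NNReal.coe_inv,
            Real.coe_toNNReal _ (zero_le_one.trans (one_lt_sobolevExp hp hpN).le),
            Real.coe_toNNReal _ (zero_le_one.trans hp.le)]
          exact inv_sobolevExp hp hpN)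
    refine this.trans (mul_le_mul' le_rfl (le_of_eq ?_))
    exact eLpNorm_congr_norm_ae (ae_of_all _ fun x => (norm_gradient _ x).symm)
  calc eLpNorm v (ENNReal.ofReal (sobolevExp N p)) volume
      = eLpNorm (-(φ n - v) + φ n) (ENNReal.ofReal (sobolevExp N p)) volume := by
        congr 1; abel
    _ ≤ eLpNorm (φ n - v) (ENNReal.ofReal (sobolevExp N p)) volume
        + eLpNorm (φ n) (ENNReal.ofReal (sobolevExp N p)) volume := by
        refine (eLpNorm_add_le (hφm.sub h.memLp.1).neg hφm hs1).trans ?_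
        rw [eLpNorm_neg]
    _ ≤ _ := by
        gcongr
        refine hS.trans ?_
        gcongr
        exact eLpNorm_le_add_eLpNorm_sub hp1 (continuous_gradient hφ1).aestronglyMeasurable
          h.memLp_grad.1

/-- The chain rule in `D^{1,p}` for continuously differentiable functions with bounded
derivative. -/
theorem IsD1p.comp (hp : 1 < p) (hpN : p < N) {v : Space N → ℝ} {W : Space N → Space N}
    (h : IsD1p p v W) {H H' : ℝ → ℝ} (hH : ∀ s, HasDerivAt H (H' s) s) (hH' : Continuous H')
    (hH0 : H 0 = 0) {C : ℝ} (hC : ∀ s, |H' s| ≤ C) :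
    IsD1p p (fun x => H (v x)) (fun x => H' (v x) • W x) := by
  have hp1 := one_le_ofReal_of_one_lt hp
  have hs1 := one_le_ofReal_sobolevExp hp hpN
  have hHc : Continuous H := continuous_iff_continuousAt.2 fun s => (hH s).continuousAt
  have hC0 : 0 ≤ C := (abs_nonneg _).trans (hC 0)
  have hLip : ∀ s t, |H s - H t| ≤ C * |s - t| := fun s t =>
    Convex.norm_image_sub_le_of_norm_hasDerivWithin_le (f := H) (s := Set.univ)
      (fun x _ => (hH x).hasDerivWithinAt) (fun x _ => hC x) convex_univ
      (Set.mem_univ t) (Set.mem_univ s)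
  have hHC1 : ContDiff ℝ 1 H := by
    refine contDiff_one_iff_deriv.2 ⟨fun s => (hH s).differentiableAt, ?_⟩
    rwa [show deriv H = H' from funext fun s => (hH s).deriv]
  obtain ⟨φ', hφ', hφc', hv', hW'⟩ := h.exists_approx hp hpN
  -- pass to a subsequence converging almost everywhere
  obtain ⟨ns, hns, hae⟩ := (tendstoInMeasure_of_tendsto_eLpNorm (by positivity)
    (fun n => (hφ' n).continuous.aestronglyMeasurable) h.memLp.1 hv').exists_seq_tendsto_ae
  set φ : ℕ → Space N → ℝ := fun n => φ' (ns n) with hφdef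
  have hφ : ∀ n, ContDiff ℝ 1 (φ n) := fun n => (hφ' _).of_le (by exact_mod_cast le_top)
  have hφc : ∀ n, HasCompactSupport (φ n) := fun n => hφc' _
  have hv := hv'.comp hns.tendsto_atTop
  have hW := hW'.comp hns.tendsto_atTop
  have hHv : MemLp (fun x => H (v x)) (ENNReal.ofReal (sobolevExp N p)) volume :=
    h.memLp.of_le_mul (hHc.comp_aestronglyMeasurable h.memLp.1) (c := C)
      (ae_of_all _ fun x => by simpa [hH0] using hLip (v x) 0)
  have hHW : MemLp (fun x => H' (v x) • W x) (ENNReal.ofReal p) volume := by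
    refine h.memLp_grad.of_le_mul ((hH'.comp_aestronglyMeasurable h.memLp.1).smul h.memLp_grad.1)
      (c := C) (ae_of_all _ fun x => ?_)
    rw [norm_smul]
    exact mul_le_mul_of_nonneg_right (hC _) (norm_nonneg _)
  refine isD1p_of_memLp hp hpN hHv hHW fun χ hχ hχc e => ?_
  have hχ1 : ContDiff ℝ 1 χ := hχ.of_le (by exact_mod_cast le_top)
  have hHφ : ∀ n, ContDiff ℝ 1 (fun x => H (φ n x)) := fun n => hHC1.comp (hφ n)
  have hHφc : ∀ n, HasCompactSupport (fun x => H (φ n x)) := fun n => (hφc n).comp_left hH0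
  have hgrad : ∀ n x, inner ℝ (∇ (fun x => H (φ n x)) x) e
      = H' (φ n x) * inner ℝ (∇ (φ n) x) e := by
    intro n x
    rw [inner_gradient_left, inner_gradient_left]
    have := ((hH (φ n x)).comp_hasFDerivAt x
      ((hφ n).differentiable one_ne_zero x).hasFDerivAt).fderiv
    rw [Function.comp_def] at this
    rw [this]
    simp
  have h1 : Tendsto (fun n => ∫ x, fderiv ℝ χ x e * H (φ n x)) atTop
      (𝓝 (∫ x, fderiv ℝ χ x e * H (v x))) := by
    refine tendsto_integral_mul_of_tendsto_eLpNorm hs1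
      (fun n => ((hHφ n).continuous.memLp_of_hasCompactSupport (hHφc n))) hHv
      (memLp_fderiv_apply hχ1 hχc e _) ?_
    refine tendsto_of_tendsto_of_tendsto_of_le_of_le tendsto_const_nhds
      (h := fun n => ENNReal.ofReal C * eLpNorm (φ n - v) (ENNReal.ofReal (sobolevExp N p)) volume)
      ?_ (fun _ => zero_le) fun n => ?_
    · simpa using ENNReal.Tendsto.const_mul (a := ENNReal.ofReal C) hv
        (Or.inr ENNReal.ofReal_ne_top)
    · exact eLpNorm_le_mul_eLpNorm_of_ae_le_mul (ae_of_all _ fun x => hLip _ _) _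
  have hχL : MemLp χ (ENNReal.ofReal p).conjExponent volume :=
    hχ.continuous.memLp_of_hasCompactSupport hχc
  have hconj : ENNReal.HolderConjugate (ENNReal.ofReal p) (ENNReal.ofReal p).conjExponent :=
    ENNReal.HolderConjugate.conjExponent hp1
  have hconj' := hconj.symm
  have mφ : ∀ n, AEStronglyMeasurable (fun x => H' (φ n x)) volume := fun n =>
    (hH'.comp (hφ n).continuous).aestronglyMeasurable
  have mg : ∀ n, MemLp (∇ (φ n)) (ENNReal.ofReal p) volume := fun n =>
    (continuous_gradient (hφ n)).memLp_of_hasCompactSupport (hasCompactSupport_gradient (hφc n))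
  -- the gradients converge in `L^p`, uniformly multiplied by the bounded factor `H' (φ n)`
  have h2 : Tendsto (fun n => ∫ x, χ x * (H' (φ n x) * inner ℝ (∇ (φ n) x - W x) e)) atTop
      (𝓝 0) := by
    have := tendsto_integral_mul_of_tendsto_eLpNorm (f₀ := fun _ => (0 : ℝ)) hp1 (l := atTop)
      (f := fun n x => H' (φ n x) * inner ℝ (∇ (φ n) x - W x) e) (g := χ) (μ := volume)
      (fun n => ?_) MemLp.zero hχL ?_
    · simpa using this
    · refine (memLp_inner_const ((mg n).sub h.memLp_grad) e).of_le_mul (c := C)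
        ((mφ n).mul (memLp_inner_const ((mg n).sub h.memLp_grad) e).1) (ae_of_all _ fun x => ?_)
      rw [norm_mul]
      exact mul_le_mul_of_nonneg_right (hC _) (norm_nonneg _)
    · refine tendsto_of_tendsto_of_tendsto_of_le_of_le tendsto_const_nhds
        (h := fun n => ENNReal.ofReal (C * ‖e‖) * eLpNorm (∇ (φ n) - W) (ENNReal.ofReal p) volume)
        ?_ (fun _ => zero_le) fun n => ?_
      · have := ENNReal.Tendsto.const_mul (a := ENNReal.ofReal (C * ‖e‖)) hW
          (Or.inr ENNReal.ofReal_ne_top)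
        rwa [mul_zero] at this
      · refine eLpNorm_le_mul_eLpNorm_of_ae_le_mul (ae_of_all _ fun x => ?_) _
        simp only [Pi.sub_apply, sub_zero]
        rw [norm_mul, mul_assoc]
        refine mul_le_mul (hC _) ?_ (norm_nonneg _) hC0
        rw [mul_comm]
        exact norm_inner_le_norm _ _
  have iW : Integrable (fun x => χ x * inner ℝ (W x) e) volume :=
    h.integrable_mul_inner hp hχ.continuous hχc e
  have h3 : Tendsto (fun n => ∫ x, H' (φ n x) * (χ x * inner ℝ (W x) e)) atTop
      (𝓝 (∫ x, H' (v x) * (χ x * inner ℝ (W x) e))) := by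
    refine tendsto_integral_of_dominated_convergence (fun x => C * ‖χ x * inner ℝ (W x) e‖)
      (fun n => (mφ n).mul iW.1) (iW.norm.const_mul C) (fun n => ae_of_all _ fun x => ?_) ?_
    · rw [norm_mul]
      exact mul_le_mul_of_nonneg_right (hC _) (norm_nonneg _)
    · filter_upwards [hae] with x hx
      exact ((hH'.tendsto _).comp hx).mul_const _
  have h4 : ∀ n, ∫ x, fderiv ℝ χ x e * H (φ n x)
      = -((∫ x, χ x * (H' (φ n x) * inner ℝ (∇ (φ n) x - W x) e))
        + ∫ x, H' (φ n x) * (χ x * inner ℝ (W x) e)) := by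
    intro n
    have key := (isD1p_of_contDiff hp hpN (hHφ n) (hHφc n)).hasWeakGradient.integral_eq χ hχ hχc e
    have i3 : Integrable (fun x => H' (φ n x) * (χ x * inner ℝ (W x) e)) volume :=
      iW.bdd_mul (mφ n) (ae_of_all _ fun x => hC _)
    have i2 : Integrable (fun x => χ x * (H' (φ n x) * inner ℝ (∇ (φ n) x - W x) e)) volume := by
      have : Integrable (fun x => χ x * inner ℝ (∇ (φ n) x - W x) e) volume :=
        hχL.integrable_mul (p := (ENNReal.ofReal p).conjExponent)
          (memLp_inner_const ((mg n).sub h.memLp_grad) e)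
      refine (this.bdd_mul (mφ n) (ae_of_all _ fun x => hC _)).congr (ae_of_all _ fun x => ?_)
      simp only; ring
    calc ∫ x, fderiv ℝ χ x e * H (φ n x) = ∫ x, H (φ n x) * fderiv ℝ χ x e :=
          integral_congr_ae (ae_of_all _ fun x => mul_comm _ _)
      _ = _ := by
          rw [key, ← integral_add i2 i3]
          congr 1
          refine integral_congr_ae (ae_of_all _ fun x => ?_)
          simp only [hgrad, inner_sub_left]
          ring
  have h5 := tendsto_nhds_unique (h1.congr h4) ((h2.add h3).neg)
  calc ∫ x, H (v x) * fderiv ℝ χ x e = ∫ x, fderiv ℝ χ x e * H (v x) :=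
        integral_congr_ae (ae_of_all _ fun x => mul_comm _ _)
    _ = _ := by
        rw [h5, zero_add]
        congr 1
        refine integral_congr_ae (ae_of_all _ fun x => ?_)
        simp only [inner_smul_left, conj_trivial]
        ring

end Density

/-! ### Radial difference quotients -/

section DifferenceQuotient

variable {N : ℕ} {p : ℝ}

theorem lintegral_comp_smul_le {t : ℝ} (ht : 1 ≤ t) (f : Space N → ℝ≥0∞) :
    ∫⁻ x, f (t • x) ≤ ∫⁻ x, f x := by
  rw [lintegral_comp_smul (by linarith)]
  refine mul_le_of_le_one_left zero_le ?_
  rw [ENNReal.ofReal_le_one]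
  exact inv_le_one_of_one_le₀ (one_le_pow₀ ht)

theorem enorm_radial_quotient_le {φ : Space N → ℝ} (hφ : ContDiff ℝ 1 φ) {t : ℝ} (ht : 1 ≤ t)
    (x : Space N) :
    ‖‖x‖⁻¹ * (φ (t • x) - φ x)‖ₑ ≤ ∫⁻ s in Set.Ioc 1 t, ‖∇ φ (s • x)‖ₑ := by
  have hd : ∀ s : ℝ, HasDerivAt (fun s : ℝ => φ (s • x)) (inner ℝ (∇ φ (s • x)) x) s := by
    intro s
    rw [inner_gradient_left]
    have h1 : HasDerivAt (fun s : ℝ => s • x) ((1 : ℝ) • x) s := (hasDerivAt_id s).smul_const x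
    rw [one_smul] at h1
    exact (hφ.differentiable one_ne_zero (s • x)).hasFDerivAt.comp_hasDerivAt s h1
  have hgc : Continuous fun s : ℝ => ∇ φ (s • x) :=
    (continuous_gradient hφ).comp (continuous_id.smul continuous_const)
  have hc : Continuous fun s : ℝ => inner ℝ (∇ φ (s • x)) x := hgc.inner continuous_const
  have hFTC := intervalIntegral.integral_eq_sub_of_hasDerivAt (fun s _ => hd s)
    (hc.intervalIntegrable 1 t)
  rw [one_smul, intervalIntegral.integral_of_le ht] at hFTC
  rw [← hFTC, ← integral_const_mul]
  refine (enorm_integral_le_lintegral_enorm _).trans (lintegral_mono fun s => ?_)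
  rw [← ofReal_norm, ← ofReal_norm]
  refine ENNReal.ofReal_le_ofReal ?_
  rw [norm_mul, norm_inv, norm_norm]
  calc ‖x‖⁻¹ * ‖inner ℝ (∇ φ (s • x)) x‖ ≤ ‖x‖⁻¹ * (‖∇ φ (s • x)‖ * ‖x‖) := by
        gcongr; exact norm_inner_le_norm _ _
    _ = ‖∇ φ (s • x)‖ * (‖x‖⁻¹ * ‖x‖) := by ring
    _ ≤ ‖∇ φ (s • x)‖ * 1 := by
        gcongr
        exact inv_mul_le_one
    _ = _ := mul_one _

theorem eLpNorm_radial_quotient_le_of_contDiff (hp : 1 < p) {φ : Space N → ℝ}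
    (hφ : ContDiff ℝ 1 φ) {t : ℝ} (ht : 1 ≤ t) :
    eLpNorm (fun x => ‖x‖⁻¹ * (φ (t • x) - φ x)) (ENNReal.ofReal p) volume
      ≤ ENNReal.ofReal (t - 1) * eLpNorm (∇ φ) (ENNReal.ofReal p) volume := by
  have hp0 : 0 < p := by linarith
  have hp1 := one_le_ofReal_of_one_lt hp
  have hpr : (ENNReal.ofReal p).toReal = p := ENNReal.toReal_ofReal hp0.le
  have hgc := continuous_gradient hφ
  set ν : Measure ℝ := volume.restrict (Set.Ioc 1 t) with hν
  have hν1 : ν Set.univ = ENNReal.ofReal (t - 1) := by simp [hν]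
  have key : ∀ x : Space N, ‖‖x‖⁻¹ * (φ (t • x) - φ x)‖ₑ ^ p
      ≤ ENNReal.ofReal (t - 1) ^ (p - 1) * ∫⁻ s, ‖∇ φ (s • x)‖ₑ ^ p ∂ν := by
    intro x
    have hm : Continuous fun s : ℝ => ∇ φ (s • x) :=
      hgc.comp (continuous_id.smul continuous_const)
    have h1 := enorm_radial_quotient_le hφ ht x
    have h2 := eLpNorm_le_eLpNorm_mul_rpow_measure_univ hp1 (hm.aestronglyMeasurable (μ := ν))
    rw [eLpNorm_one_eq_lintegral_enorm, eLpNorm_eq_lintegral_rpow_enorm_toReal (by positivity)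
      ENNReal.ofReal_ne_top, hν1, hpr] at h2
    calc ‖‖x‖⁻¹ * (φ (t • x) - φ x)‖ₑ ^ p
        ≤ ((∫⁻ s, ‖∇ φ (s • x)‖ₑ ^ p ∂ν) ^ (1 / p)
            * ENNReal.ofReal (t - 1) ^ (1 / (1 : ℝ≥0∞).toReal - 1 / p)) ^ p := by
          gcongr; exact h1.trans h2
      _ = _ := by
          rw [ENNReal.mul_rpow_of_nonneg _ _ hp0.le, ← ENNReal.rpow_mul, ← ENNReal.rpow_mul,
            one_div_mul_cancel hp0.ne', ENNReal.rpow_one, mul_comm]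
          congr 2
          rw [ENNReal.toReal_one]
          field_simp
  rw [eLpNorm_eq_lintegral_rpow_enorm_toReal (by positivity) ENNReal.ofReal_ne_top,
    eLpNorm_eq_lintegral_rpow_enorm_toReal (by positivity) ENNReal.ofReal_ne_top, hpr]
  have hmain : ∫⁻ x : Space N, ‖‖x‖⁻¹ * (φ (t • x) - φ x)‖ₑ ^ p
      ≤ ENNReal.ofReal (t - 1) ^ p * ∫⁻ x, ‖∇ φ x‖ₑ ^ p := by
    calc ∫⁻ x : Space N, ‖‖x‖⁻¹ * (φ (t • x) - φ x)‖ₑ ^ p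
        ≤ ∫⁻ x : Space N, ENNReal.ofReal (t - 1) ^ (p - 1) * ∫⁻ s, ‖∇ φ (s • x)‖ₑ ^ p ∂ν :=
          lintegral_mono key
      _ = ENNReal.ofReal (t - 1) ^ (p - 1)
            * ∫⁻ x : Space N, ∫⁻ s, ‖∇ φ (s • x)‖ₑ ^ p ∂ν := by
          rw [lintegral_const_mul' _ _
            (ENNReal.rpow_ne_top_of_nonneg (by linarith) ENNReal.ofReal_ne_top)]
      _ = ENNReal.ofReal (t - 1) ^ (p - 1)
            * ∫⁻ s, (∫⁻ x : Space N, ‖∇ φ (s • x)‖ₑ ^ p) ∂ν := by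
          rw [lintegral_lintegral_swap]
          have : Continuous fun z : Space N × ℝ => ∇ φ (z.2 • z.1) :=
            hgc.comp (continuous_snd.smul continuous_fst)
          exact (this.measurable.enorm.pow_const _).aemeasurable
      _ ≤ ENNReal.ofReal (t - 1) ^ (p - 1) * ∫⁻ s, (∫⁻ x : Space N, ‖∇ φ x‖ₑ ^ p) ∂ν := by
          refine mul_le_mul' le_rfl (lintegral_mono_ae ?_)
          filter_upwards [ae_restrict_mem measurableSet_Ioc] with s hs
          exact lintegral_comp_smul_le hs.1.le fun x => ‖∇ φ x‖ₑ ^ p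
      _ = ENNReal.ofReal (t - 1) ^ p * ∫⁻ x, ‖∇ φ x‖ₑ ^ p := by
          rw [lintegral_const, hν1, mul_comm (∫⁻ x, _), ← mul_assoc]
          congr 1
          rcases eq_or_lt_of_le ht with rfl | ht'
          · simp [ENNReal.zero_rpow_of_pos hp0]
          · nth_rewrite 2 [← ENNReal.rpow_one (ENNReal.ofReal (t - 1))]
            rw [← ENNReal.rpow_add _ _ (by simpa using ht') ENNReal.ofReal_ne_top,
              sub_add_cancel]
  calc (∫⁻ x : Space N, ‖‖x‖⁻¹ * (φ (t • x) - φ x)‖ₑ ^ p) ^ (1 / p)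
      ≤ (ENNReal.ofReal (t - 1) ^ p * ∫⁻ x, ‖∇ φ x‖ₑ ^ p) ^ (1 / p) := by gcongr
    _ = _ := by
        rw [ENNReal.mul_rpow_of_nonneg _ _ (by positivity), ← ENNReal.rpow_mul,
          mul_one_div_cancel hp0.ne', ENNReal.rpow_one]

/-- The radial difference quotients of `v`, weighted by `1 / |x|`, are bounded in `L^p` by the
gradient. -/
theorem IsD1p.eLpNorm_radial_quotient_le (hp : 1 < p) (hpN : p < N) {v : Space N → ℝ}
    {W : Space N → Space N} (h : IsD1p p v W) {t : ℝ} (ht : 1 ≤ t) :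
    eLpNorm (fun x => ‖x‖⁻¹ * (v (t • x) - v x)) (ENNReal.ofReal p) volume
      ≤ ENNReal.ofReal (t - 1) * eLpNorm W (ENNReal.ofReal p) volume := by
  have hp1 := one_le_ofReal_of_one_lt hp
  have hs1 := one_le_ofReal_sobolevExp hp hpN
  obtain ⟨φ', hφ', -, hv', hW'⟩ := h.exists_approx hp hpN
  obtain ⟨ns, hns, hae⟩ := (tendstoInMeasure_of_tendsto_eLpNorm (by positivity)
    (fun n => (hφ' n).continuous.aestronglyMeasurable) h.memLp.1 hv').exists_seq_tendsto_ae
  have hW := hW'.comp hns.tendsto_atTop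
  have hφ : ∀ n, ContDiff ℝ 1 (φ' (ns n)) := fun n => (hφ' _).of_le (by exact_mod_cast le_top)
  have hm : ∀ n, AEStronglyMeasurable
      (fun x => ‖x‖⁻¹ * (φ' (ns n) (t • x) - φ' (ns n) x)) (volume : Measure (Space N)) := by
    intro n
    refine (measurable_norm.inv.aestronglyMeasurable).mul (Continuous.aestronglyMeasurable ?_)
    exact ((hφ n).continuous.comp (continuous_const_smul t)).sub (hφ n).continuous
  have hae' := (quasiMeasurePreserving_smul (E := Space N) (by linarith : 0 < t)).ae hae
  refine (Lp.eLpNorm_lim_le_liminf_eLpNorm hm _ ?_).trans ?_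
  · filter_upwards [hae, hae'] with x h1 h2
    exact (h2.sub h1).const_mul _
  · have hlim : Tendsto (fun n => ENNReal.ofReal (t - 1) * (eLpNorm W (ENNReal.ofReal p) volume
        + eLpNorm (∇ (φ' (ns n)) - W) (ENNReal.ofReal p) volume)) atTop
        (𝓝 (ENNReal.ofReal (t - 1) * (eLpNorm W (ENNReal.ofReal p) volume + 0))) :=
      ENNReal.Tendsto.const_mul (tendsto_const_nhds.add hW) (Or.inr ENNReal.ofReal_ne_top)
    rw [add_zero] at hlim
    rw [← hlim.liminf_eq]
    refine liminf_le_liminf (Eventually.of_forall fun n => ?_)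
    refine (eLpNorm_radial_quotient_le_of_contDiff hp (hφ n) ht).trans ?_
    gcongr
    exact eLpNorm_le_add_eLpNorm_sub hp1 (continuous_gradient (hφ n)).aestronglyMeasurable
      h.memLp_grad.1

end DifferenceQuotient

/-! ### The flux `|W|^(p-2) W` -/

section Flux

set_option linter.unusedSectionVars false

variable {E : Type*} [NormedAddCommGroup E] [InnerProductSpace ℝ E]
  {X : Type*} [MeasurableSpace X] {μ : Measure X} {p q : ℝ}

theorem norm_rpow_mul_norm (hp : 1 < p) (a : E) : ‖a‖ ^ (p - 2) * ‖a‖ = ‖a‖ ^ (p - 1) := by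
  rcases eq_or_ne a 0 with rfl | ha
  · rw [norm_zero, mul_zero, Real.zero_rpow (by linarith)]
  · rw [← Real.rpow_add_one (norm_ne_zero_iff.2 ha)]
    congr 1; ring

theorem norm_rpow_mul_inner_self (hp : 1 < p) (a : E) :
    ‖a‖ ^ (p - 2) * inner ℝ a a = ‖a‖ ^ p := by
  rw [real_inner_self_eq_norm_mul_norm, ← mul_assoc, norm_rpow_mul_norm hp]
  rcases eq_or_ne a 0 with rfl | ha
  · rw [norm_zero, mul_zero, Real.zero_rpow (by linarith)]
  · rw [← Real.rpow_add_one (norm_ne_zero_iff.2 ha)]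
    congr 1; ring

theorem abs_norm_rpow_mul_inner_le (hp : 1 < p) (a b : E) :
    |‖a‖ ^ (p - 2) * inner ℝ a b| ≤ ‖a‖ ^ (p - 1) * ‖b‖ := by
  rw [abs_mul, abs_of_nonneg (by positivity), ← norm_rpow_mul_norm hp, mul_assoc]
  gcongr
  exact abs_real_inner_le_norm a b

theorem norm_rpow_mul_inner_sub_le (hpq : p.HolderConjugate q) (a b : E) :
    ‖a‖ ^ (p - 2) * inner ℝ a (b - a) ≤ 1 / p * (‖b‖ ^ p - ‖a‖ ^ p) := by
  have hp : 1 < p := hpq.lt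
  have hy := Real.young_inequality_of_nonneg (Real.rpow_nonneg (norm_nonneg a) (p - 1))
    (norm_nonneg b) hpq.symm
  rw [← Real.rpow_mul (norm_nonneg a), hpq.sub_one_mul_conj] at hy
  have h1 := (le_abs_self _).trans (abs_norm_rpow_mul_inner_le hp a b)
  have h2 : ‖a‖ ^ p / q = ‖a‖ ^ p - ‖a‖ ^ p / p := by
    rw [div_eq_mul_inv, ← hpq.one_sub_inv]; ring
  rw [inner_sub_right, mul_sub, norm_rpow_mul_inner_self hp]
  have h3 : 1 / p * (‖b‖ ^ p - ‖a‖ ^ p) = ‖b‖ ^ p / p - ‖a‖ ^ p / p := by ring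
  linarith

theorem memLp_norm_rpow_sub_one (hpq : p.HolderConjugate q) {W : X → E}
    (hW : MemLp W (ENNReal.ofReal p) μ) :
    MemLp (fun x => ‖W x‖ ^ (p - 1)) (ENNReal.ofReal q) μ := by
  have h := hW.norm_rpow_div (ENNReal.ofReal (p - 1))
  rw [ENNReal.toReal_ofReal hpq.sub_one_pos.le, ← ENNReal.ofReal_div_of_pos hpq.sub_one_pos,
    ← hpq.conjugate_eq] at h
  exact h

theorem integrable_norm_rpow (hp : 1 < p) {W : X → E} (hW : MemLp W (ENNReal.ofReal p) μ) :
    Integrable (fun x => ‖W x‖ ^ p) μ := by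
  have h := hW.integrable_norm_rpow (by simp; linarith) ENNReal.ofReal_ne_top
  rwa [ENNReal.toReal_ofReal (by linarith)] at h

theorem integrable_mul_of_memLp (hpq : p.HolderConjugate q) {f g : X → ℝ}
    (hf : MemLp f (ENNReal.ofReal q) μ) (hg : MemLp g (ENNReal.ofReal p) μ) :
    Integrable (fun x => f x * g x) μ := by
  have := hpq.symm.ennrealOfReal
  exact hf.integrable_mul (p := ENNReal.ofReal q) (q := ENNReal.ofReal p) hg

theorem integral_mul_le_of_memLp (hpq : p.HolderConjugate q) {f g : X → ℝ}
    (hf : MemLp f (ENNReal.ofReal q) μ) (hg : MemLp g (ENNReal.ofReal p) μ) :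
    ∫ x, f x * g x ∂μ
      ≤ (eLpNorm f (ENNReal.ofReal q) μ).toReal * (eLpNorm g (ENNReal.ofReal p) μ).toReal := by
  have := hpq.symm.ennrealOfReal
  have h := eLpNorm_smul_le_mul_eLpNorm (p := ENNReal.ofReal q) (q := ENNReal.ofReal p) (r := 1)
    hg.1 hf.1
  rw [← ENNReal.toReal_mul]
  refine (le_abs_self _).trans ?_
  rw [← Real.norm_eq_abs]
  refine (norm_integral_le_integral_norm _).trans ?_
  rw [integral_norm_eq_lintegral_enorm (f := fun x => f x * g x) (hf.1.mul hg.1)]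
  refine ENNReal.toReal_mono (ENNReal.mul_ne_top hf.2.ne hg.2.ne) ?_
  rw [eLpNorm_one_eq_lintegral_enorm] at h
  exact h

theorem integrable_flux_inner (hpq : p.HolderConjugate q) {W Z : X → E}
    (hW : MemLp W (ENNReal.ofReal p) μ) (hZ : MemLp Z (ENNReal.ofReal p) μ) :
    Integrable (fun x => ‖W x‖ ^ (p - 2) * inner ℝ (W x) (Z x)) μ := by
  refine (integrable_mul_of_memLp hpq (memLp_norm_rpow_sub_one hpq hW) hZ.norm).mono'
    ((hW.1.norm.aemeasurable.pow_const _).aestronglyMeasurable.mul (hW.1.inner hZ.1))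
    (ae_of_all _ fun x => abs_norm_rpow_mul_inner_le hpq.lt _ _)

end Flux

/-! ### The Pohozaev inequality -/

section Pohozaev

variable {N : ℕ} {p q : ℝ}

theorem measurableSet_exterior (R : ℝ) : MeasurableSet {x : Space N | R ≤ ‖x‖} :=
  measurableSet_le measurable_const measurable_norm

theorem tendsto_integral_exterior {f : Space N → ℝ} (hf : Integrable f volume) :
    Tendsto (fun R : ℝ => ∫ x, Set.indicator {x : Space N | R ≤ ‖x‖} (fun _ => (1 : ℝ)) x * |f x|)
      atTop (𝓝 0) := by
  have h := tendsto_integral_filter_of_dominated_convergence (μ := (volume : Measure (Space N)))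
    (l := (atTop : Filter ℝ))
    (F := fun R x => Set.indicator {x : Space N | R ≤ ‖x‖} (fun _ => (1 : ℝ)) x * |f x|)
    (f := fun _ => (0 : ℝ)) (fun x => |f x|)
    (Eventually.of_forall fun R =>
      ((measurable_const.indicator (measurableSet_exterior R)).aestronglyMeasurable).mul hf.1.norm)
    (Eventually.of_forall fun R => ae_of_all _ fun x => ?_) hf.norm (ae_of_all _ fun x => ?_)
  · simpa using h
  · rw [Set.indicator_apply]; split_ifs <;> simp
  · refine tendsto_const_nhds.congr' ?_
    filter_upwards [eventually_gt_atTop ‖x‖] with R hR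
    rw [Set.indicator_of_notMem (by simpa using hR), zero_mul]

theorem tendsto_integral_cutoff_mul {f : Space N → ℝ} (hf : Integrable f volume) :
    Tendsto (fun R : ℝ => ∫ x, cutoff N R x * f x) atTop (𝓝 (∫ x, f x)) := by
  refine tendsto_integral_filter_of_dominated_convergence (fun x => |f x|)
    (Eventually.of_forall fun R => (contDiff_cutoff R).continuous.aestronglyMeasurable.mul hf.1)
    (Eventually.of_forall fun R => ae_of_all _ fun x => ?_) hf.norm (ae_of_all _ fun x => ?_)
  · rw [norm_mul]
    exact mul_le_of_le_one_left (norm_nonneg _) (abs_cutoff_le_one R x)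
  · refine tendsto_const_nhds.congr' ?_
    filter_upwards [eventually_ge_atTop ‖x‖, eventually_gt_atTop 0] with R hR hR0
    rw [cutoff_eq_one hR0 hR, one_mul]

theorem tendsto_eLpNorm_exterior {r : ℝ≥0∞} (hr : r ≠ ⊤) (hr1 : 1 ≤ r) {f : Space N → ℝ}
    (hf : MemLp f r volume) :
    Tendsto (fun R : ℝ => (eLpNorm
      (fun x => Set.indicator {x : Space N | R ≤ ‖x‖} (fun _ => (1 : ℝ)) x * f x) r volume).toReal)
      atTop (𝓝 0) := by
  have h := tendsto_mul_cutoff (l := atTop)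
    (m := fun (R : ℝ) (x : Space N) =>
      1 - Set.indicator {x : Space N | R ≤ ‖x‖} (fun _ => (1 : ℝ)) x) (R := fun R => R - 1)
    hr hr1 (tendsto_atTop_add_const_right _ _ tendsto_id)
    (Eventually.of_forall fun R => (measurable_const.sub
      (measurable_const.indicator (measurableSet_exterior R))).aestronglyMeasurable)
    (Eventually.of_forall fun R x => by
      simp only [Set.indicator_apply]; split_ifs <;> simp)
    (Eventually.of_forall fun R x hx => by
      rw [Set.indicator_of_notMem, sub_zero]; simp; linarith) hf
  have h2 := (ENNReal.tendsto_toReal ENNReal.zero_ne_top).comp h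
  refine h2.congr fun R => ?_
  simp only [Function.comp_def]
  congr 1
  refine eLpNorm_congr_norm_ae (ae_of_all _ fun x => ?_)
  rw [← norm_neg]
  congr 1
  simp only [smul_eq_mul]
  ring

theorem tendsto_one_sub_rpow_div (a : ℝ) :
    Tendsto (fun t : ℝ => (1 - t ^ a) / (t - 1)) (𝓝[>] 1) (𝓝 (-a)) := by
  have h := (hasDerivAt_iff_tendsto_slope.1
    (Real.hasDerivAt_rpow_const (x := 1) (p := a) (Or.inl one_ne_zero))).neg
  rw [Real.one_rpow, mul_one] at h
  refine (h.mono_left (nhdsWithin_mono _ fun _ hx => ne_of_gt hx)).congr fun t => ?_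
  rw [slope_def_field, Real.one_rpow]
  ring

/-- Dilating an integral against the cutoff. -/
theorem integral_cutoff_mul_comp_smul {t : ℝ} (ht : 0 < t) (R : ℝ) (f : Space N → ℝ) :
    ∫ x, cutoff N R x * f (t • x) = t ^ (-(N : ℝ)) * ∫ y, cutoff N R (t⁻¹ • y) * f y := by
  have h := Measure.integral_comp_smul (volume : Measure (Space N))
    (fun y => cutoff N R (t⁻¹ • y) * f y) t
  simp only [inv_smul_smul₀ ht.ne', finrank_euclideanSpace_fin] at h
  rw [h, abs_of_pos (by positivity), smul_eq_mul, Real.rpow_neg ht.le, Real.rpow_natCast]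

theorem integrable_cutoff_mul {f : Space N → ℝ} (hf : Integrable f volume) (R c : ℝ) :
    Integrable (fun y => cutoff N R (c • y) * f y) volume := by
  have hc : Continuous fun y : Space N => cutoff N R (c • y) :=
    (contDiff_cutoff R).continuous.comp (continuous_const_smul c)
  exact hf.bdd_mul (c := 1) hc.aestronglyMeasurable (ae_of_all _ fun x => abs_cutoff_le_one R _)

theorem integrable_exterior_mul {f : Space N → ℝ} (hf : Integrable f volume) (R : ℝ) :
    Integrable (fun x => Set.indicator {x : Space N | R ≤ ‖x‖} (fun _ => (1 : ℝ)) x * |f x|)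
      volume :=
  hf.norm.bdd_mul (c := 1)
    (measurable_const.indicator (measurableSet_exterior R)).aestronglyMeasurable
    (ae_of_all _ fun x => by rw [Set.indicator_apply]; split_ifs <;> simp)

theorem abs_integral_cutoff_dilate_sub_le {R t : ℝ} (hR : 0 < R) (ht : 1 ≤ t) (ht2 : t ≤ 2)
    {f : Space N → ℝ} (hf : Integrable f volume) :
    |(∫ y, cutoff N R (t⁻¹ • y) * f y) - ∫ y, cutoff N R y * f y|
      ≤ (t - 1) * (4 * bumpLip N)
        * ∫ x, Set.indicator {x : Space N | R ≤ ‖x‖} (fun _ => (1 : ℝ)) x * |f x| := by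
  have i2 : Integrable (fun y => cutoff N R y * f y) volume := by
    simpa using integrable_cutoff_mul hf R 1
  rw [← integral_sub (integrable_cutoff_mul hf R t⁻¹) i2, ← integral_const_mul, ← Real.norm_eq_abs]
  refine norm_integral_le_of_norm_le ((integrable_exterior_mul hf R).const_mul _)
    (ae_of_all _ fun x => ?_)
  rw [← sub_mul, norm_mul, ← mul_assoc]
  exact mul_le_mul_of_nonneg_right (abs_cutoff_dilate_sub_le hR ht ht2 x) (norm_nonneg _)

/-- The test function `η (v(t ·) - v)` and its gradient. -/
theorem IsD1p.cutoff_mul_dilate_sub (hp : 1 < p) (hpN : p < N) {v : Space N → ℝ}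
    {W : Space N → Space N} (h : IsD1p p v W) {R t : ℝ} (hR : 0 < R) (ht : 1 ≤ t) :
    IsD1p p (fun x => cutoff N R x * (v (t • x) - v x))
      (fun x => cutoff N R x • (t • W (t • x) - W x) + (v (t • x) - v x) • ∇ (cutoff N R) x) :=
  ((h.comp_smul hp hpN ht).sub hp hpN h).contDiff_mul hp hpN (contDiff_cutoff R)
    (hasCompactSupport_cutoff hR)

theorem IsD1p.memLp_radial_quotient (hp : 1 < p) (hpN : p < N) {v : Space N → ℝ}
    {W : Space N → Space N} (h : IsD1p p v W) {t : ℝ} (ht : 1 ≤ t) :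
    MemLp (fun x => ‖x‖⁻¹ * |v (t • x) - v x|) (ENNReal.ofReal p) volume ∧
    (eLpNorm (fun x => ‖x‖⁻¹ * |v (t • x) - v x|) (ENNReal.ofReal p) volume).toReal
      ≤ (t - 1) * (eLpNorm W (ENNReal.ofReal p) volume).toReal := by
  have hle := h.eLpNorm_radial_quotient_le hp hpN ht
  have he : eLpNorm (fun x => ‖x‖⁻¹ * |v (t • x) - v x|) (ENNReal.ofReal p) volume
      = eLpNorm (fun x => ‖x‖⁻¹ * (v (t • x) - v x)) (ENNReal.ofReal p) volume := by
    refine eLpNorm_congr_norm_ae (ae_of_all _ fun x => ?_)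
    rw [norm_mul, norm_mul, Real.norm_eq_abs, Real.norm_eq_abs, Real.norm_eq_abs, abs_abs]
  rw [← he] at hle
  have hm : AEStronglyMeasurable (fun x => ‖x‖⁻¹ * |v (t • x) - v x|)
      (volume : Measure (Space N)) :=
    (measurable_norm.inv.aestronglyMeasurable).mul
      (((h.comp_smul hp hpN ht).sub hp hpN h).memLp.1.norm)
  have hfin := ENNReal.mul_ne_top (ENNReal.ofReal_ne_top (r := t - 1)) h.memLp_grad.2.ne
  refine ⟨⟨hm, hle.trans_lt hfin.lt_top⟩, ?_⟩
  have := ENNReal.toReal_mono hfin hle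
  rwa [ENNReal.toReal_mul, ENNReal.toReal_ofReal (by linarith)] at this

/-- Upper bound for the flux tested with `η (v(t ·) - v)`: Young's inequality compares the
`p`-energies of `v(t ·)` and `v`, and the gradient of the cutoff contributes only near infinity. -/
theorem IsD1p.flux_dilate_le (hpq : p.HolderConjugate q) (hpN : p < N) {v : Space N → ℝ}
    {W : Space N → Space N} (h : IsD1p p v W) {R t : ℝ} (hR : 0 < R) (ht : 1 ≤ t) (ht2 : t ≤ 2) :
    ∫ x, ‖W x‖ ^ (p - 2) * inner ℝ (W x) (cutoff N R x • (t • W (t • x) - W x)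
        + (v (t • x) - v x) • ∇ (cutoff N R) x)
      ≤ -((1 - t ^ (p - N)) / p * ∫ x, cutoff N R x * ‖W x‖ ^ p)
        + (t - 1) * (4 * bumpLip N / p
            * (∫ x, Set.indicator {x : Space N | R ≤ ‖x‖} (fun _ => (1 : ℝ)) x * |‖W x‖ ^ p|)
          + 2 * bumpLip N * (eLpNorm (fun x =>
              Set.indicator {x : Space N | R ≤ ‖x‖} (fun _ => (1 : ℝ)) x * ‖W x‖ ^ (p - 1))
              (ENNReal.ofReal q) volume).toReal
            * (eLpNorm W (ENNReal.ofReal p) volume).toReal) := by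
  have hp : 1 < p := hpq.lt
  have hp0 : 0 < p := by linarith
  have ht0 : 0 < t := by linarith
  set w : Space N → ℝ := fun x => ‖W x‖ ^ p with hw
  set S : Space N → ℝ := Set.indicator {x : Space N | R ≤ ‖x‖} (fun _ => (1 : ℝ)) with hS
  set D : Space N → ℝ := fun x => ‖x‖⁻¹ * |v (t • x) - v x| with hD
  have hwi : Integrable w volume := integrable_norm_rpow hp h.memLp_grad
  have hψ := h.cutoff_mul_dilate_sub hp hpN hR ht
  obtain ⟨hDL, hDle⟩ := h.memLp_radial_quotient hp hpN ht
  have hSm : AEStronglyMeasurable S volume :=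
    (measurable_const.indicator (measurableSet_exterior R)).aestronglyMeasurable
  have hSb : ∀ x, ‖S x‖ ≤ 1 := fun x => by
    simp only [hS]; rw [Set.indicator_apply]; split_ifs <;> simp
  have hSL : MemLp (fun x => S x * ‖W x‖ ^ (p - 1)) (ENNReal.ofReal q) volume := by
    have hfl := memLp_norm_rpow_sub_one hpq h.memLp_grad
    refine hfl.of_le_mul (c := 1) (hSm.mul hfl.1) (ae_of_all _ fun x => ?_)
    rw [norm_mul]
    exact mul_le_mul_of_nonneg_right (hSb x) (norm_nonneg _)
  have hpt : ∀ x, ‖W x‖ ^ (p - 2) * inner ℝ (W x) (cutoff N R x • (t • W (t • x) - W x)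
        + (v (t • x) - v x) • ∇ (cutoff N R) x)
      ≤ 1 / p * (t ^ p * (cutoff N R x * w (t • x)) - cutoff N R x * w x)
        + 2 * bumpLip N * ((S x * ‖W x‖ ^ (p - 1)) * D x) := by
    intro x
    rw [inner_add_right, inner_smul_right, mul_add]
    refine add_le_add ?_ ?_
    · have h1 := norm_rpow_mul_inner_sub_le hpq (W x) (t • W (t • x))
      rw [norm_smul, Real.norm_eq_abs, abs_of_pos ht0,
        Real.mul_rpow ht0.le (norm_nonneg _)] at h1
      calc _ = cutoff N R x * (‖W x‖ ^ (p - 2) * inner ℝ (W x) (t • W (t • x) - W x)) := by ring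
        _ ≤ cutoff N R x * (1 / p * (t ^ p * ‖W (t • x)‖ ^ p - ‖W x‖ ^ p)) :=
            mul_le_mul_of_nonneg_left h1 (cutoff_nonneg R x)
        _ = _ := by simp only [hw]; ring
    · refine (le_abs_self _).trans ((abs_norm_rpow_mul_inner_le hp _ _).trans ?_)
      rw [norm_smul]
      by_cases hx : R ≤ ‖x‖
      · have hx0 : 0 < ‖x‖ := hR.trans_le hx
        have hS1 : S x = 1 := Set.indicator_of_mem (by exact hx) _
        rw [hS1, one_mul]
        simp only [hD]
        calc ‖W x‖ ^ (p - 1) * (‖v (t • x) - v x‖ * ‖∇ (cutoff N R) x‖)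
            = ‖W x‖ ^ (p - 1) * ((‖x‖⁻¹ * |v (t • x) - v x|)
                * (‖∇ (cutoff N R) x‖ * ‖x‖)) := by
              rw [Real.norm_eq_abs]; field_simp
          _ ≤ ‖W x‖ ^ (p - 1) * ((‖x‖⁻¹ * |v (t • x) - v x|) * (2 * bumpLip N)) := by
              exact mul_le_mul_of_nonneg_left (mul_le_mul_of_nonneg_left
                (norm_gradient_cutoff_mul_norm_le hR x) (by positivity)) (by positivity)
          _ = _ := by ring
      · rw [gradient_cutoff_eq_zero_of_lt (not_le.1 hx), norm_zero, mul_zero, mul_zero]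
        have : S x = 0 := Set.indicator_of_notMem (by exact hx) _
        rw [this]
        simp
  have i1 : Integrable (fun x => cutoff N R x * w (t • x)) volume := by
    simpa using integrable_cutoff_mul (hwi.comp_smul ht0.ne') R 1
  have i2 : Integrable (fun x => cutoff N R x * w x) volume := by
    simpa using integrable_cutoff_mul hwi R 1
  have i3 := integrable_mul_of_memLp hpq hSL hDL
  have hint := integral_mono (integrable_flux_inner hpq h.memLp_grad hψ.memLp_grad)
    ((((i1.const_mul (t ^ p)).sub i2).const_mul (1 / p)).add (i3.const_mul (2 * bumpLip N))) hpt
  rw [integral_add' (((i1.const_mul (t ^ p)).sub i2).const_mul (1 / p))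
      (i3.const_mul (2 * bumpLip N)),
    integral_const_mul, integral_const_mul, integral_sub' (i1.const_mul (t ^ p)) i2,
    integral_const_mul, integral_cutoff_mul_comp_smul ht0] at hint
  refine hint.trans ?_
  have hH := (integral_mul_le_of_memLp hpq hSL hDL).trans
    (mul_le_mul_of_nonneg_left hDle ENNReal.toReal_nonneg)
  have hcut := abs_integral_cutoff_dilate_sub_le hR ht ht2 hwi
  have hpow : t ^ p * t ^ (-(N : ℝ)) = t ^ (p - N) := by
    rw [← Real.rpow_add ht0]; rfl
  have hpow1 : t ^ (p - N) ≤ 1 := Real.rpow_le_one_of_one_le_of_nonpos ht (by linarith)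
  have hpow0 : 0 ≤ t ^ (p - N) := by positivity
  set A := ∫ y, cutoff N R (t⁻¹ • y) * w y
  set B := ∫ y, cutoff N R y * w y
  set T := ∫ x, S x * |w x|
  have hT : 0 ≤ (t - 1) * (4 * bumpLip N) * T := (abs_nonneg _).trans hcut
  have hA : t ^ (p - N) * A ≤ t ^ (p - N) * B + (t - 1) * (4 * bumpLip N) * T := by
    have h1 : A ≤ B + (t - 1) * (4 * bumpLip N) * T := by linarith [(abs_le.1 hcut).2]
    calc t ^ (p - N) * A ≤ t ^ (p - N) * (B + (t - 1) * (4 * bumpLip N) * T) := by gcongr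
      _ = t ^ (p - N) * B + t ^ (p - N) * ((t - 1) * (4 * bumpLip N) * T) := by ring
      _ ≤ _ := add_le_add le_rfl (mul_le_of_le_one_left hT hpow1)
  rw [← mul_assoc (t ^ p), hpow]
  have h5 : 1 / p * (t ^ (p - N) * A - B)
      ≤ 1 / p * (t ^ (p - N) * B + (t - 1) * (4 * bumpLip N) * T - B) := by gcongr
  refine (add_le_add h5 (mul_le_mul_of_nonneg_left hH (by positivity))).trans (le_of_eq ?_)
  ring

/-- **Pohozaev inequality.** Let `v ∈ D^{1,p}` solve `-Δ_p v = f` weakly, and let `F` be an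
integrable function which dominates the increments of a primitive along dilations in the sense of
`hpt`, up to an error that is negligible as the dilation factor tends to `1`. Then
`(N - p) / p ∫ |W|^p ≤ N ∫ F`. No regularity of `v` is required. -/
theorem pohozaev_le (hpq : p.HolderConjugate q) (hpN : p < N) {v : Space N → ℝ}
    {W : Space N → Space N} (h : IsD1p p v W) {f F : Space N → ℝ} {e : ℝ → Space N → ℝ}
    (hF : Integrable F volume)
    (hfi : ∀ ψ Z, IsD1p p ψ Z → Integrable (fun x => f x * ψ x) volume)
    (hweak : ∀ ψ Z, IsD1p p ψ Z →
      ∫ x, ‖W x‖ ^ (p - 2) * inner ℝ (W x) (Z x) = ∫ x, f x * ψ x)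
    (hpt : ∀ t : ℝ, 1 < t → ∀ x,
      F (t • x) - F x - e t x * |v (t • x) - v x| ≤ f x * (v (t • x) - v x))
    (hem : ∀ t : ℝ, 1 < t → ∀ r : ℝ,
      MemLp (e t) (ENNReal.ofReal q) (volume.restrict (Metric.closedBall 0 r)))
    (he0 : ∀ t x, 0 ≤ e t x)
    (he : ∀ r : ℝ, Tendsto (fun t => eLpNorm (e t) (ENNReal.ofReal q)
      (volume.restrict (Metric.closedBall 0 r))) (𝓝[>] 1) (𝓝 0)) :
    (N - p) / p * ∫ x, ‖W x‖ ^ p ≤ N * ∫ x, F x := by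
  have hp : 1 < p := hpq.lt
  have hp0 : 0 < p := by linarith
  set w : Space N → ℝ := fun x => ‖W x‖ ^ p with hw
  set S : ℝ → Space N → ℝ := fun R => Set.indicator {x : Space N | R ≤ ‖x‖} (fun _ => (1 : ℝ))
    with hS
  set n : ℝ := (eLpNorm W (ENNReal.ofReal p) volume).toReal with hn
  have hwi : Integrable w volume := integrable_norm_rpow hp h.memLp_grad
  set err : ℝ → ℝ := fun R => 4 * bumpLip N / p * (∫ x, S R x * |w x|)
    + 2 * bumpLip N * (eLpNorm (fun x => S R x * ‖W x‖ ^ (p - 1)) (ENNReal.ofReal q)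
      volume).toReal * n + 4 * bumpLip N * ∫ x, S R x * |F x| with herr
  have herr0 : Tendsto err atTop (𝓝 0) := by
    have hq1 : 1 ≤ ENNReal.ofReal q := one_le_ofReal_of_one_lt hpq.symm.lt
    have h1 := (tendsto_integral_exterior hwi).const_mul (4 * bumpLip N / p)
    have h2 := ((tendsto_eLpNorm_exterior ENNReal.ofReal_ne_top hq1
      (memLp_norm_rpow_sub_one hpq h.memLp_grad)).const_mul (2 * (bumpLip N : ℝ))).mul_const n
    have h3 := (tendsto_integral_exterior hF).const_mul (4 * (bumpLip N : ℝ))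
    simpa using (h1.add h2).add h3
  -- the inequality localized to the ball of radius `2 R`, for a fixed dilation factor
  have hloc : ∀ R : ℝ, 0 < R → ∀ t : ℝ, 1 < t → t ≤ 2 →
      (1 - t ^ (p - N)) / (t - 1) / p * (∫ x, cutoff N R x * w x)
        - (1 - t ^ (-(N : ℝ))) / (t - 1) * ∫ x, cutoff N R x * F x
      ≤ err R + 2 * R * n * (eLpNorm (e t) (ENNReal.ofReal q)
        (volume.restrict (Metric.closedBall 0 (2 * R)))).toReal := by
    intro R hR t ht ht2
    have ht0 : 0 < t := by linarith
    have hψ := h.cutoff_mul_dilate_sub hp hpN hR ht.le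
    have hup := h.flux_dilate_le hpq hpN hR ht.le ht2
    rw [hweak _ _ hψ] at hup
    obtain ⟨hDL, hDle⟩ := h.memLp_radial_quotient hp hpN ht.le
    set D : Space N → ℝ := fun x => ‖x‖⁻¹ * |v (t • x) - v x| with hD
    set B := Metric.closedBall (0 : Space N) (2 * R) with hB
    have hBm : MeasurableSet B := Metric.isClosed_closedBall.measurableSet
    have heL : MemLp (B.indicator (e t)) (ENNReal.ofReal q) volume :=
      (memLp_indicator_iff_restrict hBm).2 (hem t ht _)
    have i1 : Integrable (fun x => cutoff N R x * F (t • x)) volume := by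
      simpa using integrable_cutoff_mul (hF.comp_smul ht0.ne') R 1
    have i2 : Integrable (fun x => cutoff N R x * F x) volume := by
      simpa using integrable_cutoff_mul hF R 1
    have i3 := integrable_mul_of_memLp hpq heL hDL
    have hlow : ∀ x, cutoff N R x * F (t • x) - cutoff N R x * F x
        - 2 * R * (B.indicator (e t) x * D x) ≤ f x * (cutoff N R x * (v (t • x) - v x)) := by
      intro x
      have h1 := mul_le_mul_of_nonneg_left (hpt t ht x) (cutoff_nonneg R x)
      have h2 : cutoff N R x * (e t x * |v (t • x) - v x|)
          ≤ 2 * R * (B.indicator (e t) x * D x) := by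
        by_cases hx : x ∈ B
        · rw [Set.indicator_of_mem hx]
          have hxn : ‖x‖ ≤ 2 * R := by simpa [hB] using hx
          have h3 : |v (t • x) - v x| = ‖x‖ * D x := by
            rcases eq_or_ne x 0 with rfl | hx0
            · simp
            · simp only [hD]
              have := norm_ne_zero_iff.2 hx0
              field_simp
          have hD0 : 0 ≤ D x := by simp only [hD]; positivity
          calc cutoff N R x * (e t x * |v (t • x) - v x|)
              ≤ 1 * (e t x * |v (t • x) - v x|) :=
                mul_le_mul_of_nonneg_right (cutoff_le_one R x)
                  (mul_nonneg (he0 t x) (abs_nonneg _))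
            _ = e t x * (‖x‖ * D x) := by rw [h3, one_mul]
            _ ≤ e t x * (2 * R * D x) :=
                mul_le_mul_of_nonneg_left (mul_le_mul_of_nonneg_right hxn hD0) (he0 t x)
            _ = _ := by ring
        · rw [Set.indicator_of_notMem hx, cutoff_eq_zero hR]
          · simp
          · rw [hB, mem_closedBall_zero_iff, not_le] at hx; exact hx.le
      calc _ ≤ cutoff N R x * (F (t • x) - F x - e t x * |v (t • x) - v x|) := by linarith
        _ ≤ cutoff N R x * (f x * (v (t • x) - v x)) := h1
        _ = _ := by ring
    have hlow' := integral_mono ((i1.sub i2).sub (i3.const_mul (2 * R))) (hfi _ _ hψ) hlow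
    rw [integral_sub' (i1.sub i2) (i3.const_mul (2 * R)), integral_sub' i1 i2, integral_const_mul,
      integral_cutoff_mul_comp_smul ht0] at hlow'
    have hH := (integral_mul_le_of_memLp hpq heL hDL).trans
      (mul_le_mul_of_nonneg_left hDle ENNReal.toReal_nonneg)
    rw [eLpNorm_indicator_eq_eLpNorm_restrict hBm] at hH
    set δ := (eLpNorm (e t) (ENNReal.ofReal q) (volume.restrict B)).toReal
    have hcut := abs_integral_cutoff_dilate_sub_le hR ht.le ht2 hF
    have hpow1 : t ^ (-(N : ℝ)) ≤ 1 :=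
      Real.rpow_le_one_of_one_le_of_nonpos ht.le (by linarith [(Nat.cast_nonneg N : (0 : ℝ) ≤ N)])
    have hpow0 : 0 ≤ t ^ (-(N : ℝ)) := by positivity
    set A := ∫ y, cutoff N R (t⁻¹ • y) * F y
    set A' := ∫ y, cutoff N R y * F y
    set T := ∫ x, Set.indicator {x : Space N | R ≤ ‖x‖} (fun _ => (1 : ℝ)) x * |F x|
    have hT : 0 ≤ (t - 1) * (4 * bumpLip N) * T := (abs_nonneg _).trans hcut
    have hA : t ^ (-(N : ℝ)) * A' - (t - 1) * (4 * bumpLip N) * T ≤ t ^ (-(N : ℝ)) * A := by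
      have h1 : A' - (t - 1) * (4 * bumpLip N) * T ≤ A := by linarith [(abs_le.1 hcut).1]
      calc _ ≤ t ^ (-(N : ℝ)) * A' - t ^ (-(N : ℝ)) * ((t - 1) * (4 * bumpLip N) * T) :=
            sub_le_sub_left (mul_le_of_le_one_left hT hpow1) _
        _ = t ^ (-(N : ℝ)) * (A' - (t - 1) * (4 * bumpLip N) * T) := by ring
        _ ≤ _ := by gcongr
    have ht1 : 0 < t - 1 := by linarith
    have hH2 : 2 * R * (∫ x, B.indicator (e t) x * D x) ≤ 2 * R * (δ * ((t - 1) * n)) := by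
      gcongr
    have hfin : (1 - t ^ (p - N)) / p * (∫ x, cutoff N R x * w x) - (1 - t ^ (-(N : ℝ))) * A'
        ≤ (t - 1) * (err R + 2 * R * n * δ) := by
      have e1 : (t - 1) * (err R + 2 * R * n * δ) = (t - 1) * (4 * bumpLip N / p
            * (∫ x, S R x * |w x|) + 2 * bumpLip N * (eLpNorm (fun x => S R x * ‖W x‖ ^ (p - 1))
              (ENNReal.ofReal q) volume).toReal * n) + (t - 1) * (4 * bumpLip N) * T
            + 2 * R * (δ * ((t - 1) * n)) := by
        simp only [herr]; ring
      rw [e1]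
      linarith
    have e2 : (1 - t ^ (p - N)) / (t - 1) / p * (∫ x, cutoff N R x * w x)
        - (1 - t ^ (-(N : ℝ))) / (t - 1) * A'
        = ((1 - t ^ (p - N)) / p * (∫ x, cutoff N R x * w x) - (1 - t ^ (-(N : ℝ))) * A')
          / (t - 1) := by
      field_simp
    rw [e2, div_le_iff₀ ht1, mul_comm (err R + _)]
    exact hfin
  -- let the dilation factor tend to `1`
  have hR : ∀ R : ℝ, 0 < R →
      (N - p) / p * (∫ x, cutoff N R x * w x) - N * (∫ x, cutoff N R x * F x) ≤ err R := by
    intro R hR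
    have l1 := (((tendsto_one_sub_rpow_div (p - N)).div_const p).mul_const
      (∫ x, cutoff N R x * w x)).sub
      ((tendsto_one_sub_rpow_div (-(N : ℝ))).mul_const (∫ x, cutoff N R x * F x))
    have l2 := (((ENNReal.tendsto_toReal ENNReal.zero_ne_top).comp
      (he (2 * R))).const_mul (2 * R * n)).const_add (err R)
    rw [ENNReal.toReal_zero, mul_zero, add_zero] at l2
    rw [neg_neg, neg_sub] at l1
    refine le_of_tendsto_of_tendsto l1 l2 ?_
    have h2 : ∀ᶠ t : ℝ in 𝓝[>] 1, t ≤ 2 :=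
      (eventually_le_nhds one_lt_two).filter_mono nhdsWithin_le_nhds
    filter_upwards [self_mem_nhdsWithin, h2] with t ht ht2
    exact hloc R hR t ht ht2
  -- let the radius of the cutoff tend to infinity
  have l3 := ((tendsto_integral_cutoff_mul hwi).const_mul ((N - p) / p)).sub
    ((tendsto_integral_cutoff_mul hF).const_mul (N : ℝ))
  have := le_of_tendsto_of_tendsto l3 herr0 ((eventually_gt_atTop 0).mono hR)
  linarith

end Pohozaev

/-! ### The change of variable -/

section ChangeOfVariable

variable {p α k : ℝ}

theorem g_base_pos (hα : 1 < α) (t : ℝ) : 0 < 1 + α ^ p / 2 * |t| ^ (p * (α - 1)) := by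
  positivity

theorem g_pos (hα : 1 < α) (t : ℝ) : 0 < g p α t := Real.rpow_pos_of_pos (g_base_pos hα t) _

theorem one_le_g (hp : 1 < p) (hα : 1 < α) (t : ℝ) : 1 ≤ g p α t := by
  refine Real.one_le_rpow ?_ (by positivity)
  have : 0 ≤ α ^ p / 2 * |t| ^ (p * (α - 1)) := by positivity
  linarith

theorem g_neg (t : ℝ) : g p α (-t) = g p α t := by
  rw [g, g, abs_neg]

theorem continuous_g (hp : 1 < p) (hα : 1 < α) : Continuous (g p α) := by
  have h1 : 0 ≤ p * (α - 1) := mul_nonneg (by linarith) (by linarith)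
  exact (continuous_const.add (continuous_const.mul
    (continuous_abs.rpow_const fun _ => Or.inr h1))).rpow_const
      fun t => Or.inl (g_base_pos hα t).ne'

theorem hasDerivAt_G (hp : 1 < p) (hα : 1 < α) (t : ℝ) : HasDerivAt (G p α) (g p α t) t :=
  ((continuous_g hp hα).integral_hasStrictDerivAt 0 t).hasDerivAt

theorem G_zero : G p α 0 = 0 := intervalIntegral.integral_same

theorem G_neg (t : ℝ) : G p α (-t) = -G p α t := by
  have h := intervalIntegral.integral_comp_neg (g p α) (a := 0) (b := t)
  simp only [g_neg, neg_zero] at h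
  rw [G, G, h, intervalIntegral.integral_symm]

theorem strictMono_G (hp : 1 < p) (hα : 1 < α) : StrictMono (G p α) :=
  strictMono_of_deriv_pos fun t => by
    rw [(hasDerivAt_G hp hα t).deriv]; exact g_pos hα t

theorem continuous_G (hp : 1 < p) (hα : 1 < α) : Continuous (G p α) :=
  continuous_iff_continuousAt.2 fun t => (hasDerivAt_G hp hα t).continuousAt

/-- The logarithmic derivative `t g'(t) / g(t)`. -/
def logDerivG (p α t : ℝ) : ℝ :=
  (α - 1) * (α ^ p / 2 * |t| ^ (p * (α - 1)) / (1 + α ^ p / 2 * |t| ^ (p * (α - 1))))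

theorem logDerivG_nonneg (hα : 1 < α) (t : ℝ) : 0 ≤ logDerivG p α t := by
  have := g_base_pos (p := p) hα t
  have h1 : 0 < α - 1 := by linarith
  rw [logDerivG]
  positivity

theorem logDerivG_lt (hα : 1 < α) (t : ℝ) : logDerivG p α t < α - 1 := by
  have h0 := g_base_pos (p := p) hα t
  rw [logDerivG]
  refine mul_lt_of_lt_one_right (by linarith) ?_
  rw [div_lt_one h0]
  linarith

theorem continuous_logDerivG (hp : 1 < p) (hα : 1 < α) : Continuous (logDerivG p α) := by
  have h1 : 0 ≤ p * (α - 1) := mul_nonneg (by linarith) (by linarith)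
  have hc : Continuous fun t : ℝ => α ^ p / 2 * |t| ^ (p * (α - 1)) :=
    continuous_const.mul (continuous_abs.rpow_const fun _ => Or.inr h1)
  exact continuous_const.mul (hc.div (continuous_const.add hc) fun t => (g_base_pos hα t).ne')

theorem hasDerivAt_g (hp : 1 < p) (hα : 1 < α) {t : ℝ} (ht : t ≠ 0) :
    HasDerivAt (g p α) (g p α t * logDerivG p α t / t) t := by
  have hp0 : p ≠ 0 := by linarith
  have hb := g_base_pos (p := p) hα t
  have h1 : HasDerivAt (fun t : ℝ => |t| ^ (p * (α - 1)))
      ((p * (α - 1)) * |t| ^ (p * (α - 1)) / t) t := by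
    have h := (hasDerivAt_abs ht).rpow_const (p := p * (α - 1)) (Or.inl (abs_ne_zero.2 ht))
    refine h.congr_deriv ?_
    rw [Real.rpow_sub_one (abs_ne_zero.2 ht)]
    rcases lt_or_gt_of_ne ht with h0 | h0
    · rw [sign_neg h0, abs_of_neg h0]
      simp only [SignType.coe_neg_one]
      field_simp
    · rw [sign_pos h0, abs_of_pos h0]
      simp only [SignType.coe_one]
      field_simp
  have h2 := ((h1.const_mul (α ^ p / 2)).const_add 1).rpow_const (p := 1 / p) (Or.inl hb.ne')
  refine h2.congr_deriv ?_
  rw [Real.rpow_sub_one hb.ne', g, logDerivG]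
  field_simp

theorem hasDerivAt_mul_g (hp : 1 < p) (hα : 1 < α) (t : ℝ) :
    HasDerivAt (fun t => t * g p α t) (g p α t * (1 + logDerivG p α t)) t := by
  have hne : ∀ y : ℝ, y ≠ 0 →
      HasDerivAt (fun t => t * g p α t) (g p α y * (1 + logDerivG p α y)) y := by
    intro y hy
    refine ((hasDerivAt_id y).mul (hasDerivAt_g hp hα hy)).congr_deriv ?_
    simp only [id]
    field_simp
  rcases eq_or_ne t 0 with rfl | ht
  · -- at the origin `g` itself need not be differentiable
    exact hasDerivAt_of_hasDerivAt_of_ne (g := fun y => g p α y * (1 + logDerivG p α y)) hne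
      (continuous_id.mul (continuous_g hp hα)).continuousAt
      ((continuous_g hp hα).mul (continuous_const.add
        (continuous_logDerivG hp hα))).continuousAt
  · exact hne t ht

theorem mul_g_le (hp : 1 < p) (hα : 1 < α) {t : ℝ} (ht : 0 ≤ t) :
    t * g p α t ≤ α * G p α t := by
  have hd : ∀ s, HasDerivAt (fun s => α * G p α s - s * g p α s)
      (α * g p α s - g p α s * (1 + logDerivG p α s)) s := fun s =>
    ((hasDerivAt_G hp hα s).const_mul α).sub (hasDerivAt_mul_g hp hα s)
  have hmono : Monotone (fun s => α * G p α s - s * g p α s) :=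
    monotone_of_deriv_nonneg (fun s => (hd s).differentiableAt) fun s => by
      rw [(hd s).deriv]
      nlinarith [g_pos (p := p) hα s, logDerivG_lt (p := p) hα s]
  have := hmono ht
  simp only [G_zero, mul_zero, zero_mul, sub_zero] at this
  linarith

theorem abs_mul_g_le (hp : 1 < p) (hα : 1 < α) (t : ℝ) :
    |t| * g p α t ≤ α * |G p α t| := by
  have hG0 : ∀ s : ℝ, 0 ≤ s → 0 ≤ G p α s := fun s hs => by
    rw [← G_zero (p := p) (α := α)]; exact (strictMono_G hp hα).monotone hs
  rcases le_total 0 t with h | h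
  · rw [abs_of_nonneg h, abs_of_nonneg (hG0 t h)]
    exact mul_g_le hp hα h
  · have h' : 0 ≤ -t := by linarith
    have h1 := mul_g_le hp hα h'
    rw [g_neg] at h1
    have h2 := hG0 _ h'
    rw [G_neg] at h1 h2
    rw [abs_of_nonpos h, abs_of_nonpos (by linarith)]
    exact h1

theorem surjective_G (hp : 1 < p) (hα : 1 < α) : Function.Surjective (G p α) := by
  have hlow : ∀ t : ℝ, 0 ≤ t → t / α ≤ G p α t := fun t ht => by
    rw [div_le_iff₀ (by linarith)]
    nlinarith [mul_g_le hp hα ht, one_le_g hp hα t]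
  have htop : Tendsto (G p α) atTop atTop :=
    tendsto_atTop_mono' _ ((eventually_ge_atTop 0).mono hlow)
      (tendsto_id.atTop_div_const (by linarith))
  refine (continuous_G hp hα).surjective htop ?_
  have h := tendsto_neg_atTop_atBot.comp (htop.comp tendsto_neg_atBot_atTop)
  refine h.congr fun t => ?_
  simp [G_neg]

/-- `G` as an order isomorphism of `ℝ`. -/
def orderIsoG (hp : 1 < p) (hα : 1 < α) : ℝ ≃o ℝ :=
  (strictMono_G hp hα).orderIsoOfSurjective _ (surjective_G hp hα)

/-- The inverse of `G`. -/
def invG (hp : 1 < p) (hα : 1 < α) : ℝ → ℝ := (orderIsoG hp hα).symm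

theorem invG_G (hp : 1 < p) (hα : 1 < α) (t : ℝ) : invG hp hα (G p α t) = t :=
  (orderIsoG hp hα).symm_apply_apply t

theorem G_invG (hp : 1 < p) (hα : 1 < α) (s : ℝ) : G p α (invG hp hα s) = s :=
  (orderIsoG hp hα).apply_symm_apply s

theorem continuous_invG (hp : 1 < p) (hα : 1 < α) : Continuous (invG hp hα) :=
  (orderIsoG hp hα).symm.continuous

theorem hasDerivAt_invG (hp : 1 < p) (hα : 1 < α) (s : ℝ) :
    HasDerivAt (invG hp hα) (g p α (invG hp hα s))⁻¹ s :=
  HasDerivAt.of_local_left_inverse (continuous_invG hp hα).continuousAt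
    (hasDerivAt_G hp hα _) (g_pos hα _).ne' (Eventually.of_forall (G_invG hp hα))

/-- As a function of `v = G(u)`, the quantity `u g(u)` is continuously differentiable with
derivative `1 + u g'(u) / g(u)`. -/
theorem hasDerivAt_mul_g_invG (hp : 1 < p) (hα : 1 < α) (s : ℝ) :
    HasDerivAt (fun s => invG hp hα s * g p α (invG hp hα s))
      (1 + logDerivG p α (invG hp hα s)) s := by
  have h := (hasDerivAt_mul_g hp hα (invG hp hα s)).comp s (hasDerivAt_invG hp hα s)
  refine h.congr_deriv ?_
  have := (g_pos (p := p) hα (invG hp hα s)).ne'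
  field_simp

/-! ### The nonlinearity -/

/-- The right-hand side `|u|^(k-2) u / g(u)` of the transformed equation. -/
def nonlinearity (p α k t : ℝ) : ℝ := |t| ^ (k - 2) * t / g p α t

theorem nonlinearity_neg (t : ℝ) : nonlinearity p α k (-t) = -nonlinearity p α k t := by
  rw [nonlinearity, nonlinearity, g_neg, abs_neg]
  ring

theorem nonlinearity_zero : nonlinearity p α k 0 = 0 := by simp [nonlinearity]

theorem nonlinearity_of_pos {t : ℝ} (ht : 0 < t) :
    nonlinearity p α k t = t ^ (k - 1) / g p α t := by
  rw [nonlinearity, abs_of_pos ht, ← Real.rpow_add_one ht.ne']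
  congr 2
  ring

theorem measurable_nonlinearity (hp : 1 < p) (hα : 1 < α) : Measurable (nonlinearity p α k) :=
  ((measurable_norm.pow_const _).mul measurable_id).div (continuous_g hp hα).measurable

theorem nonlinearity_mul_mul_g (hα : 1 < α) (hk : 1 < k) (t : ℝ) :
    nonlinearity p α k t * (t * g p α t) = |t| ^ k := by
  have hg := (g_pos (p := p) hα t).ne'
  rcases eq_or_ne t 0 with rfl | ht
  · rw [abs_zero, Real.zero_rpow (by linarith)]; simp
  · rw [nonlinearity]
    have h2 : t * t = |t| ^ (2 : ℝ) := by
      rw [← abs_mul_abs_self, Real.rpow_two, sq]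
    calc |t| ^ (k - 2) * t / g p α t * (t * g p α t) = |t| ^ (k - 2) * (t * t) := by
          field_simp
      _ = |t| ^ k := by
          rw [h2, ← Real.rpow_add (abs_pos.2 ht)]; congr 1; ring

/-- For `k ≥ α` the nonlinearity is increasing in `u`. -/
theorem monotone_nonlinearity (hp : 1 < p) (hα : 1 < α) (hk : α ≤ k) :
    Monotone (nonlinearity p α k) := by
  have hp0 : 0 < p := by linarith
  have hk1 : 0 < k - 1 := by linarith
  -- on the positive half-line the `p`-th power of the quotient is `t^(p(k-1)) / (1 + c t^γ)`
  have hpos : ∀ s t : ℝ, 0 < s → s ≤ t → nonlinearity p α k s ≤ nonlinearity p α k t := by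
    intro s t hs hst
    have ht : 0 < t := hs.trans_le hst
    rw [nonlinearity_of_pos hs, nonlinearity_of_pos ht, div_le_div_iff₀ (g_pos hα s) (g_pos hα t)]
    have e : ∀ a b : ℝ, 0 < a → 0 < b → (a ^ (k - 1) * g p α b)
        = ((a ^ (k - 1)) ^ p * (1 + α ^ p / 2 * b ^ (p * (α - 1)))) ^ (1 / p) := by
      intro a b ha hb
      have hb' := g_base_pos (p := p) hα b
      rw [abs_of_pos hb] at hb'
      rw [Real.mul_rpow (by positivity) hb'.le, ← Real.rpow_mul (by positivity),
        mul_one_div_cancel hp0.ne', Real.rpow_one, g, abs_of_pos hb]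
    rw [e s t hs ht, e t s ht hs]
    refine Real.rpow_le_rpow (by positivity) ?_ (by positivity)
    have h1 : (s ^ (k - 1)) ^ p ≤ (t ^ (k - 1)) ^ p := by gcongr
    have h2 : (s ^ (k - 1)) ^ p * t ^ (p * (α - 1)) ≤ (t ^ (k - 1)) ^ p * s ^ (p * (α - 1)) := by
      have e2 : ∀ a : ℝ, 0 < a → (a ^ (k - 1)) ^ p = a ^ (p * (k - α)) * a ^ (p * (α - 1)) := by
        intro a ha
        rw [← Real.rpow_mul ha.le, ← Real.rpow_add ha]
        congr 1; ring
      rw [e2 s hs, e2 t ht]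
      have h3 : s ^ (p * (k - α)) ≤ t ^ (p * (k - α)) :=
        Real.rpow_le_rpow hs.le hst (mul_nonneg hp0.le (by linarith))
      have h4 : 0 ≤ s ^ (p * (α - 1)) * t ^ (p * (α - 1)) := by positivity
      nlinarith
    have h5 : 0 ≤ α ^ p / 2 := by positivity
    nlinarith [mul_le_mul_of_nonneg_left h2 h5]
  have hnn : ∀ t : ℝ, 0 ≤ t → 0 ≤ nonlinearity p α k t := fun t ht => by
    rw [nonlinearity]
    have := (g_pos (p := p) hα t).le
    positivity
  have hpos' : ∀ s t : ℝ, 0 ≤ s → s ≤ t → nonlinearity p α k s ≤ nonlinearity p α k t := by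
    intro s t hs hst
    rcases hs.eq_or_lt with rfl | hs'
    · rw [nonlinearity_zero]; exact hnn t hst
    · exact hpos s t hs' hst
  intro s t hst
  rcases le_total 0 s with h | h
  · exact hpos' s t h hst
  · rcases le_total 0 t with h' | h'
    · have := hnn (-s) (by linarith)
      rw [nonlinearity_neg] at this
      linarith [hnn t h']
    · have := hpos' (-t) (-s) (by linarith) (by linarith)
      rw [nonlinearity_neg, nonlinearity_neg] at this
      linarith

/-- As a function of `v = G(u)`, the primitive `|u|^k / k` of the nonlinearity is convex. -/
theorem nonlinearity_mul_sub_le (hp : 1 < p) (hα : 1 < α) (hk : α ≤ k) (s t : ℝ) :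
    nonlinearity p α k s * (G p α t - G p α s) ≤ |t| ^ k / k - |s| ^ k / k := by
  have hk1 : 1 < k := by linarith
  have hmono := monotone_nonlinearity hp hα hk
  have hA : ∀ t : ℝ, HasDerivAt (fun t : ℝ => |t| ^ k / k) (nonlinearity p α k t * g p α t) t := by
    intro t
    refine ((hasDerivAt_abs_rpow t hk1).div_const k).congr_deriv ?_
    have := (g_pos (p := p) hα t).ne'
    rw [nonlinearity]
    field_simp
  have hAc : Continuous fun t : ℝ => |t| ^ k / k :=
    continuous_iff_continuousAt.2 fun t => (hA t).continuousAt
  -- by Cauchy's mean value theorem the increment is controlled by an intermediate value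
  have hmvt : ∀ a b : ℝ, a < b → ∃ c ∈ Set.Ioo a b,
      |b| ^ k / k - |a| ^ k / k = nonlinearity p α k c * (G p α b - G p α a) := by
    intro a b hab
    obtain ⟨c, hc, h⟩ := exists_ratio_hasDerivAt_eq_ratio_slope _ _ hab hAc.continuousOn
      (fun x _ => hA x) (G p α) (g p α) (continuous_G hp hα).continuousOn
      (fun x _ => hasDerivAt_G hp hα x)
    refine ⟨c, hc, ?_⟩
    have hg := g_pos (p := p) hα c
    have : (|b| ^ k / k - |a| ^ k / k) * g p α c
        = (nonlinearity p α k c * (G p α b - G p α a)) * g p α c := by rw [← h]; ring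
    exact mul_right_cancel₀ hg.ne' this
  rcases lt_trichotomy s t with h | rfl | h
  · obtain ⟨c, hc, e⟩ := hmvt s t h
    rw [e]
    exact mul_le_mul_of_nonneg_right (hmono hc.1.le)
      (sub_nonneg.2 ((strictMono_G hp hα).monotone h.le))
  · simp
  · obtain ⟨c, hc, e⟩ := hmvt t s h
    have h1 := mul_le_mul_of_nonneg_right (hmono hc.2.le)
      (sub_nonneg.2 ((strictMono_G hp hα).monotone h.le))
    linarith

/-- The error in linearizing the primitive in `v = G(u)`. It is needed where the coefficient is
negative and convexity points the wrong way. -/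
theorem abs_rpow_sub_sub_nonlinearity_mul_le (hp : 1 < p) (hα : 1 < α) (hk : α ≤ k) (s t : ℝ) :
    |(|t| ^ k / k - |s| ^ k / k) - nonlinearity p α k s * (G p α t - G p α s)|
      ≤ |nonlinearity p α k t - nonlinearity p α k s| * |G p α t - G p α s| := by
  have h1 := nonlinearity_mul_sub_le hp hα hk s t
  have h2 := nonlinearity_mul_sub_le hp hα hk t s
  rw [← abs_mul, abs_of_nonneg (by linarith)]
  refine le_trans ?_ (le_abs_self _)
  linarith

theorem rpow_le_g (hp : 1 < p) (hα : 1 < α) (t : ℝ) :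
    (α ^ p / 2) ^ (1 / p) * |t| ^ (α - 1) ≤ g p α t := by
  have hp0 : p ≠ 0 := by linarith
  have e : (α ^ p / 2) ^ (1 / p) * |t| ^ (α - 1)
      = (α ^ p / 2 * |t| ^ (p * (α - 1))) ^ (1 / p) := by
    rw [Real.mul_rpow (by positivity) (by positivity), ← Real.rpow_mul (abs_nonneg t)]
    congr 2
    field_simp
  rw [e, g]
  exact Real.rpow_le_rpow (by positivity) (by linarith) (by positivity)

/-- At the exponent `k = α r` the nonlinearity grows at most like `|v|^(r-1)`. -/
theorem exists_abs_nonlinearity_le (hp : 1 < p) (hα : 1 < α) {r : ℝ} (hr : 1 < r) :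
    ∃ C : ℝ, 0 ≤ C ∧ ∀ t, |nonlinearity p α (α * r) t| ≤ C * |G p α t| ^ (r - 1) := by
  set c := (α ^ p / 2) ^ (1 / p) with hc
  have hc0 : 0 < c := by positivity
  have hα0 : 0 < α := by linarith
  refine ⟨c⁻¹ * (α / c) ^ (r - 1), by positivity, fun t => ?_⟩
  rcases eq_or_ne t 0 with rfl | ht
  · rw [nonlinearity_zero, abs_zero]; positivity
  have ht0 : 0 < |t| := abs_pos.2 ht
  have hg := g_pos (p := p) hα t
  have h1 : |t| ^ α ≤ α / c * |G p α t| := by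
    have h2 := abs_mul_g_le hp hα t
    have h3 := mul_le_mul_of_nonneg_left (rpow_le_g hp hα t) ht0.le
    have h4 : |t| ^ α = |t| * |t| ^ (α - 1) := by
      rw [mul_comm, ← Real.rpow_add_one ht0.ne']; congr 1; ring
    rw [h4, div_mul_eq_mul_div, le_div_iff₀ hc0]
    calc |t| * |t| ^ (α - 1) * c = |t| * (c * |t| ^ (α - 1)) := by ring
      _ ≤ _ := h3.trans h2
  have h5 : |nonlinearity p α (α * r) t| = |t| ^ (α * r - 1) / g p α t := by
    rw [nonlinearity, abs_div, abs_of_pos hg, abs_mul, abs_of_nonneg (by positivity),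
      ← Real.rpow_add_one ht0.ne']
    congr 2
    ring
  have h6 : |t| ^ (α * r - 1) = |t| ^ (α - 1) * (|t| ^ α) ^ (r - 1) := by
    rw [← Real.rpow_mul ht0.le, ← Real.rpow_add ht0]
    congr 1; ring
  rw [h5, h6, div_le_iff₀ hg]
  have h7 : (|t| ^ α) ^ (r - 1) ≤ (α / c) ^ (r - 1) * |G p α t| ^ (r - 1) := by
    rw [← Real.mul_rpow (by positivity) (abs_nonneg _)]
    exact Real.rpow_le_rpow (by positivity) h1 (by linarith)
  have h8 : |t| ^ (α - 1) ≤ c⁻¹ * g p α t := by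
    rw [le_inv_mul_iff₀ hc0]; exact rpow_le_g hp hα t
  calc |t| ^ (α - 1) * (|t| ^ α) ^ (r - 1)
      ≤ (c⁻¹ * g p α t) * ((α / c) ^ (r - 1) * |G p α t| ^ (r - 1)) :=
        mul_le_mul h8 h7 (by positivity) (by positivity)
    _ = _ := by ring

theorem abs_nonlinearity_le_of_abs_le (hp : 1 < p) (hα : 1 < α) (hk : 1 < k) {t C : ℝ}
    (ht : |t| ≤ C) : |nonlinearity p α k t| ≤ C ^ (k - 1) := by
  have hg := one_le_g hp hα t
  have hC : 0 ≤ C := (abs_nonneg t).trans ht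
  rcases eq_or_ne t 0 with rfl | ht0
  · rw [nonlinearity_zero, abs_zero]; positivity
  · rw [nonlinearity, abs_div, abs_of_pos (g_pos hα t), abs_mul, abs_of_nonneg (by positivity),
      ← Real.rpow_add_one (abs_ne_zero.2 ht0)]
    refine (div_le_self (by positivity) hg).trans ?_
    rw [show k - 2 + 1 = k - 1 by ring]
    exact Real.rpow_le_rpow (abs_nonneg t) ht (by linarith)

end ChangeOfVariable

/-! ### Higher integrability at the critical growth -/

section Moser

variable {a M : ℝ}

/-- The truncated power `min(|z|, M)^a`. -/
def truncPow (a M z : ℝ) : ℝ := min |z| M ^ a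

theorem truncPow_nonneg (hM : 0 ≤ M) (z : ℝ) : 0 ≤ truncPow a M z :=
  Real.rpow_nonneg (le_min (abs_nonneg z) hM) a

theorem continuous_truncPow (ha : 0 ≤ a) : Continuous (truncPow a M) :=
  (continuous_abs.min continuous_const).rpow_const fun _ => Or.inr ha

theorem truncPow_neg (z : ℝ) : truncPow a M (-z) = truncPow a M z := by
  rw [truncPow, truncPow, abs_neg]

theorem truncPow_mono (ha : 0 ≤ a) (hM : 0 ≤ M) {y z : ℝ} (h : |y| ≤ |z|) :
    truncPow a M y ≤ truncPow a M z :=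
  Real.rpow_le_rpow (le_min (abs_nonneg y) hM) (min_le_min_right M h) ha

theorem truncPow_le (ha : 0 ≤ a) (hM : 0 ≤ M) (z : ℝ) : truncPow a M z ≤ M ^ a :=
  Real.rpow_le_rpow (le_min (abs_nonneg z) hM) (min_le_right _ _) ha

theorem truncPow_le_of_abs_le (ha : 0 ≤ a) (hM : 0 ≤ M) {z L : ℝ} (hz : |z| ≤ L) :
    truncPow a M z ≤ L ^ a :=
  Real.rpow_le_rpow (le_min (abs_nonneg z) hM) ((min_le_left _ _).trans hz) ha

theorem truncPow_rpow (hM : 0 ≤ M) (p z : ℝ) : truncPow a M z ^ p = truncPow (a * p) M z :=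
  (Real.rpow_mul (le_min (abs_nonneg z) hM) a p).symm

/-- The odd primitive of the truncated power. -/
def truncPrim (a M z : ℝ) : ℝ := ∫ y in (0 : ℝ)..z, truncPow a M y

theorem hasDerivAt_truncPrim (ha : 0 ≤ a) (z : ℝ) :
    HasDerivAt (truncPrim a M) (truncPow a M z) z :=
  ((continuous_truncPow ha).integral_hasStrictDerivAt 0 z).hasDerivAt

theorem truncPrim_zero : truncPrim a M 0 = 0 := intervalIntegral.integral_same

theorem truncPrim_neg (z : ℝ) : truncPrim a M (-z) = -truncPrim a M z := by
  have h := intervalIntegral.integral_comp_neg (truncPow a M) (a := 0) (b := z)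
  simp only [truncPow_neg, neg_zero] at h
  rw [truncPrim, truncPrim, h, intervalIntegral.integral_symm]

theorem abs_truncPrim_le (ha : 0 ≤ a) (hM : 0 ≤ M) (z : ℝ) :
    |truncPrim a M z| ≤ |z| * truncPow a M z := by
  have h := intervalIntegral.norm_integral_le_of_norm_le_const (a := 0) (b := z)
    (f := truncPow a M) (C := truncPow a M z) fun x hx => by
      rw [Real.norm_eq_abs, abs_of_nonneg (truncPow_nonneg hM x)]
      refine truncPow_mono ha hM ?_
      have := Set.abs_sub_left_of_mem_uIcc (Set.uIoc_subset_uIcc hx)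
      simpa using this
  rw [sub_zero, mul_comm] at h
  exact h

/-- The primitive is comparable to `|z| min(|z|, M)^a`, because
`min(y, M) ≥ (y / z) min(z, M)` for `0 ≤ y ≤ z`. -/
theorem mul_truncPow_le (ha : 0 ≤ a) (hM : 0 ≤ M) (z : ℝ) :
    |z| * truncPow a M z ≤ (a + 1) * |truncPrim a M z| := by
  have hpos : ∀ z : ℝ, 0 < z → z * truncPow a M z ≤ (a + 1) * truncPrim a M z := by
    intro z hz
    have hm : 0 ≤ min |z| M := le_min (abs_nonneg z) hM
    have h1 : ∫ y in (0 : ℝ)..z, y ^ a * (truncPow a M z / z ^ a) ≤ truncPrim a M z := by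
      refine intervalIntegral.integral_mono_on hz.le
        (((Real.continuous_rpow_const ha).mul continuous_const).intervalIntegrable _ _)
        ((continuous_truncPow ha).intervalIntegrable _ _) fun y hy => ?_
      have e : y ^ a * (truncPow a M z / z ^ a) = (y / z * min |z| M) ^ a := by
        rw [Real.mul_rpow (div_nonneg hy.1 hz.le) hm, Real.div_rpow hy.1 hz.le, truncPow]
        ring
      rw [e]
      refine Real.rpow_le_rpow (mul_nonneg (div_nonneg hy.1 hz.le) hm) ?_ ha
      rw [abs_of_pos hz, abs_of_nonneg hy.1]
      have h2 : y / z ≤ 1 := (div_le_one hz).2 hy.2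
      have h3 : 0 ≤ y / z := div_nonneg hy.1 hz.le
      refine le_min ?_ ?_
      · calc y / z * min z M ≤ y / z * z := mul_le_mul_of_nonneg_left (min_le_left _ _) h3
          _ = y := by field_simp
      · exact (mul_le_mul_of_nonneg_left (min_le_right _ _) h3).trans
          (mul_le_of_le_one_left hM h2)
    rw [intervalIntegral.integral_mul_const, integral_rpow (Or.inl (by linarith)),
      Real.zero_rpow (by linarith), sub_zero, Real.rpow_add_one hz.ne'] at h1
    have hza : 0 < z ^ a := Real.rpow_pos_of_pos hz a
    have h4 : z ^ a * z / (a + 1) * (truncPow a M z / z ^ a) = z * truncPow a M z / (a + 1) := by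
      field_simp
    rw [h4, div_le_iff₀ (by linarith)] at h1
    linarith
  have ha1 : 0 < a + 1 := by linarith
  rcases lt_trichotomy z 0 with h | rfl | h
  · have h1 := hpos (-z) (by linarith)
    rw [truncPow_neg, truncPrim_neg] at h1
    rw [abs_of_neg h]
    exact h1.trans (mul_le_mul_of_nonneg_left (neg_le_abs _) ha1.le)
  · simp [truncPrim_zero]
  · rw [abs_of_pos h]
    exact (hpos z h).trans (mul_le_mul_of_nonneg_left (le_abs_self _) ha1.le)

theorem eLpNorm_ofReal_rpow {X E : Type*} [MeasurableSpace X] {μ : Measure X}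
    [NormedAddCommGroup E] {r : ℝ} (hr : 0 < r) (f : X → E) :
    eLpNorm f (ENNReal.ofReal r) μ ^ r = ∫⁻ x, ‖f x‖ₑ ^ r ∂μ := by
  rw [eLpNorm_eq_lintegral_rpow_enorm_toReal (by simpa using hr) ENNReal.ofReal_ne_top,
    ENNReal.toReal_ofReal hr.le, one_div, ENNReal.rpow_inv_rpow hr.ne']

theorem lintegral_rpow_mul_rpow_le {X : Type*} [MeasurableSpace X] {μ : Measure X} {p r : ℝ}
    (hp : 0 < p) (hpr : p < r) {w h : X → ℝ} (hw : AEStronglyMeasurable w μ)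
    (hh : AEStronglyMeasurable h μ) :
    ∫⁻ x, ‖w x‖ₑ ^ (r - p) * ‖h x‖ₑ ^ p ∂μ
      ≤ eLpNorm w (ENNReal.ofReal r) μ ^ (r - p) * eLpNorm h (ENNReal.ofReal r) μ ^ p := by
  have hr : 0 < r := hp.trans hpr
  have hd : 0 < r - p := sub_pos.2 hpr
  have hc : (r / (r - p)).HolderConjugate (r / p) := by
    rw [Real.holderConjugate_iff]
    refine ⟨(one_lt_div hd).2 (by linarith), ?_⟩
    field_simp
    ring
  have h1 := ENNReal.lintegral_mul_le_Lp_mul_Lq μ hc (f := fun x => ‖w x‖ₑ ^ (r - p))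
    (g := fun x => ‖h x‖ₑ ^ p) (hw.enorm.pow_const _) (hh.enorm.pow_const _)
  refine h1.trans (le_of_eq ?_)
  simp only [← ENNReal.rpow_mul]
  rw [mul_div_cancel₀ _ hd.ne', mul_div_cancel₀ _ hp.ne', ← eLpNorm_ofReal_rpow hr,
    ← eLpNorm_ofReal_rpow hr, ← ENNReal.rpow_mul, ← ENNReal.rpow_mul]
  congr 2 <;> field_simp

variable {N : ℕ} {p : ℝ}

/-- The energy estimate behind the Moser step: testing with the primitive of `min(|v|, M)^(a p)`
and splitting the domain at the level `|v| = L`, the part of the right-hand side where `|v|` is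
large carries a factor measured by the tail of `v` in `L^{p*}`. -/
theorem IsD1p.energy_truncPrim_le (hp : 1 < p) (hpN : p < N) {v : Space N → ℝ}
    {W : Space N → Space N} (h : IsD1p p v W) {f : Space N → ℝ} {C : ℝ} (hC : 0 ≤ C)
    (hf : ∀ x, |f x| ≤ C * |v x| ^ (sobolevExp N p - 1))
    (hweak : ∀ ψ Z, IsD1p p ψ Z →
      ∫ x, ‖W x‖ ^ (p - 2) * inner ℝ (W x) (Z x) = ∫ x, f x * ψ x)
    (ha : 0 ≤ a) (hM : 0 ≤ M) {L : ℝ} (hL : 0 ≤ L) :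
    eLpNorm (fun x => truncPow a M (v x) • W x) (ENNReal.ofReal p) volume ^ p
      ≤ ENNReal.ofReal (C * (a + 1) ^ p) *
        (ENNReal.ofReal (L ^ (a * p)) *
            eLpNorm v (ENNReal.ofReal (sobolevExp N p)) volume ^ sobolevExp N p
          + eLpNorm ({x | L ≤ ‖v x‖₊}.indicator v) (ENNReal.ofReal (sobolevExp N p)) volume
              ^ (sobolevExp N p - p)
            * eLpNorm (fun x => truncPrim a M (v x)) (ENNReal.ofReal (sobolevExp N p)) volume
              ^ p) := by
  set P := sobolevExp N p with hP
  have hpP : p < P := lt_sobolevExp hp hpN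
  have hp0 : 0 < p := by linarith
  have hap : 0 ≤ a * p := mul_nonneg ha hp0.le
  have hH := h.comp hp hpN (hasDerivAt_truncPrim (M := M) ha) (continuous_truncPow ha)
    truncPrim_zero (C := M ^ a)
    fun s => by rw [abs_of_nonneg (truncPow_nonneg hM s)]; exact truncPow_le ha hM s
  have hφ := h.comp hp hpN (hasDerivAt_truncPrim (M := M) hap) (continuous_truncPow hap)
    truncPrim_zero (C := M ^ (a * p))
    fun s => by rw [abs_of_nonneg (truncPow_nonneg hM s)]; exact truncPow_le hap hM s
  -- the test function turns the left-hand side into the energy of `truncPrim a M (v x)`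
  have e1 : eLpNorm (fun x => truncPow a M (v x) • W x) (ENNReal.ofReal p) volume ^ p
      = ENNReal.ofReal (∫ x, f x * truncPrim (a * p) M (v x)) := by
    rw [← hweak _ _ hφ, eLpNorm_ofReal_rpow hp0]
    have e : ∀ x, ‖W x‖ ^ (p - 2) * inner ℝ (W x) (truncPow (a * p) M (v x) • W x)
        = ‖truncPow a M (v x) • W x‖ ^ p := by
      intro x
      rw [inner_smul_right, mul_left_comm, norm_rpow_mul_inner_self hp, norm_smul,
        Real.norm_of_nonneg (truncPow_nonneg hM _),
        Real.mul_rpow (truncPow_nonneg hM _) (norm_nonneg _), truncPow_rpow hM]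
    simp only [e]
    rw [ofReal_integral_eq_lintegral_ofReal (integrable_norm_rpow hp hH.memLp_grad)
      (ae_of_all _ fun x => by positivity)]
    refine lintegral_congr fun x => ?_
    rw [← ofReal_norm, ENNReal.ofReal_rpow_of_nonneg (norm_nonneg _) hp0.le]
  have hpt : ∀ x, |f x * truncPrim (a * p) M (v x)| ≤ C * (a + 1) ^ p *
      (L ^ (a * p) * |v x| ^ P
        + |{x | L ≤ ‖v x‖₊}.indicator v x| ^ (P - p) * |truncPrim a M (v x)| ^ p) := by
    intro x
    set z := v x
    have hT := truncPow_nonneg (a := a) hM z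
    have hz := abs_nonneg z
    have h0 : |z| ^ (P - 1) * |z| = |z| ^ P := by
      rcases hz.eq_or_lt with hz0 | hz0
      · rw [← hz0, mul_zero, Real.zero_rpow (by linarith)]
      · rw [← Real.rpow_add_one hz0.ne']; congr 1; ring
    have h0' : |z| ^ (P - p) * |z| ^ p = |z| ^ P := by
      rcases hz.eq_or_lt with hz0 | hz0
      · rw [← hz0, Real.zero_rpow hp0.ne', mul_zero, Real.zero_rpow (by linarith)]
      · rw [← Real.rpow_add hz0]; congr 1; ring
    have h1 : |f x * truncPrim (a * p) M z| ≤ C * (|z| ^ P * truncPow a M z ^ p) := by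
      rw [abs_mul]
      calc |f x| * |truncPrim (a * p) M z|
          ≤ (C * |z| ^ (P - 1)) * (|z| * truncPow (a * p) M z) :=
            mul_le_mul (hf x) (abs_truncPrim_le hap hM z) (abs_nonneg _) (by positivity)
        _ = C * ((|z| ^ (P - 1) * |z|) * truncPow a M z ^ p) := by
            rw [truncPow_rpow hM]; ring
        _ = _ := by rw [h0]
    refine h1.trans ?_
    rw [mul_assoc C]
    refine mul_le_mul_of_nonneg_left ?_ hC
    have hs1 : 1 ≤ (a + 1) ^ p := Real.one_le_rpow (by linarith) hp0.le
    have hLp : 0 ≤ L ^ (a * p) * |z| ^ P := by positivity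
    by_cases hx : L ≤ ‖v x‖₊
    · have hx' : x ∈ {x | L ≤ ‖v x‖₊} := hx
      rw [Set.indicator_of_mem hx']
      have h2 : (|z| * truncPow a M z) ^ p ≤ ((a + 1) * |truncPrim a M z|) ^ p :=
        Real.rpow_le_rpow (mul_nonneg hz hT) (mul_truncPow_le ha hM z) hp0.le
      rw [Real.mul_rpow hz hT, Real.mul_rpow (by linarith) (abs_nonneg _)] at h2
      calc |z| ^ P * truncPow a M z ^ p = |z| ^ (P - p) * (|z| ^ p * truncPow a M z ^ p) := by
            rw [← h0']; ring
        _ ≤ |z| ^ (P - p) * ((a + 1) ^ p * |truncPrim a M z| ^ p) := by gcongr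
        _ = (a + 1) ^ p * (|z| ^ (P - p) * |truncPrim a M z| ^ p) := by ring
        _ ≤ _ := by
            refine mul_le_mul_of_nonneg_left ?_ (by positivity)
            exact le_add_of_nonneg_left hLp
    · have hzL : |z| ≤ L := by
        rw [not_le] at hx
        exact hx.le
      have h3 : truncPow a M z ^ p ≤ L ^ (a * p) := by
        rw [Real.rpow_mul hL]
        exact Real.rpow_le_rpow hT (truncPow_le_of_abs_le ha hM hzL) hp0.le
      calc |z| ^ P * truncPow a M z ^ p ≤ |z| ^ P * L ^ (a * p) := by gcongr
        _ = 1 * (L ^ (a * p) * |z| ^ P) := by ring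
        _ ≤ _ := by
            refine mul_le_mul hs1 (le_add_of_nonneg_right (by positivity)) hLp (by positivity)
  have hind : AEStronglyMeasurable ({x | L ≤ ‖v x‖₊}.indicator v) volume := by
    refine h.memLp.1.indicator₀ ?_
    exact nullMeasurableSet_le aemeasurable_const h.memLp.1.norm.aemeasurable
  rw [e1]
  calc ENNReal.ofReal (∫ x, f x * truncPrim (a * p) M (v x))
      ≤ ‖∫ x, f x * truncPrim (a * p) M (v x)‖ₑ := by
        rw [← ofReal_norm]
        exact ENNReal.ofReal_le_ofReal (le_abs_self _)
    _ ≤ ∫⁻ x, ‖f x * truncPrim (a * p) M (v x)‖ₑ := enorm_integral_le_lintegral_enorm _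
    _ ≤ ∫⁻ x, ENNReal.ofReal (C * (a + 1) ^ p) * (ENNReal.ofReal (L ^ (a * p)) * ‖v x‖ₑ ^ P
          + ‖{x | L ≤ ‖v x‖₊}.indicator v x‖ₑ ^ (P - p) * ‖truncPrim a M (v x)‖ₑ ^ p) := by
        refine lintegral_mono fun x => ?_
        simp only [← ofReal_norm, Real.norm_eq_abs]
        rw [ENNReal.ofReal_rpow_of_nonneg (abs_nonneg _) (by linarith),
          ENNReal.ofReal_rpow_of_nonneg (abs_nonneg _) (by linarith),
          ENNReal.ofReal_rpow_of_nonneg (abs_nonneg _) (by linarith),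
          ← ENNReal.ofReal_mul (by positivity), ← ENNReal.ofReal_mul (by positivity),
          ← ENNReal.ofReal_add (by positivity) (by positivity),
          ← ENNReal.ofReal_mul (by positivity)]
        exact ENNReal.ofReal_le_ofReal (hpt x)
    _ = ENNReal.ofReal (C * (a + 1) ^ p) * (ENNReal.ofReal (L ^ (a * p)) * (∫⁻ x, ‖v x‖ₑ ^ P)
          + ∫⁻ x, ‖{x | L ≤ ‖v x‖₊}.indicator v x‖ₑ ^ (P - p) * ‖truncPrim a M (v x)‖ₑ ^ p) := by
        rw [lintegral_const_mul' _ _ ENNReal.ofReal_ne_top, lintegral_add_left',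
          lintegral_const_mul' _ _ ENNReal.ofReal_ne_top]
        exact (h.memLp.1.enorm.pow_const _).const_mul _
    _ ≤ _ := by
        rw [eLpNorm_ofReal_rpow (by linarith) v]
        gcongr
        exact lintegral_rpow_mul_rpow_le hp0 hpP hind hH.memLp.1

/-- The Brezis–Kato–Moser step: if the right-hand side is at most of the critical growth
`|v|^(p*-1)`, then `|v|^s ∈ L^{p*}` for every `s = a + 1 ≥ 1`. -/
theorem IsD1p.memLp_abs_rpow_add_one (hp : 1 < p) (hpN : p < N) {v : Space N → ℝ}
    {W : Space N → Space N} (h : IsD1p p v W) {f : Space N → ℝ} {C : ℝ} (hC : 0 ≤ C)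
    (hf : ∀ x, |f x| ≤ C * |v x| ^ (sobolevExp N p - 1))
    (hweak : ∀ ψ Z, IsD1p p ψ Z →
      ∫ x, ‖W x‖ ^ (p - 2) * inner ℝ (W x) (Z x) = ∫ x, f x * ψ x)
    (ha : 0 ≤ a) :
    MemLp (fun x => |v x| * |v x| ^ a) (ENNReal.ofReal (sobolevExp N p)) volume := by
  set P := sobolevExp N p with hP
  have hpP : p < P := lt_sobolevExp hp hpN
  have hp0 : 0 < p := by linarith
  obtain ⟨S, hS⟩ := exists_sobolev_const (N := N) hp hpN
  set D : ℝ := (S : ℝ) ^ p * (C * (a + 1) ^ p) with hD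
  have hD0 : 0 ≤ D := by positivity
  -- the level `L` makes the tail of `v` so small that it can be absorbed on the left
  set ε : ℝ := (2 * (D + 1))⁻¹ ^ (P - p)⁻¹ with hε
  have hε0 : 0 < ε := by positivity
  obtain ⟨L, hL0, hL⟩ : ∃ L : ℝ, 0 < L ∧
      eLpNorm ({x | L ≤ ‖v x‖₊}.indicator v) (ENNReal.ofReal P) volume ≤ ENNReal.ofReal ε := by
    obtain ⟨L, hL0, hL⟩ := (h.memLp.ae_eq h.memLp.1.ae_eq_mk).eLpNorm_indicator_norm_ge_pos_le
      h.memLp.1.stronglyMeasurable_mk hε0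
    refine ⟨L, hL0, (eLpNorm_congr_ae ?_).trans_le hL⟩
    filter_upwards [h.memLp.1.ae_eq_mk] with x hx
    simp only [Set.indicator, Set.mem_ofPred_eq, hx]
  set B := ENNReal.ofReal D * (ENNReal.ofReal (L ^ (a * p)) *
    eLpNorm v (ENNReal.ofReal P) volume ^ P) with hB
  have hBtop : B ≠ ⊤ := ENNReal.mul_ne_top ENNReal.ofReal_ne_top
    (ENNReal.mul_ne_top ENNReal.ofReal_ne_top
      (ENNReal.rpow_ne_top_of_nonneg (by linarith) h.memLp.2.ne))
  have hbound : ∀ M : ℝ, 0 ≤ M →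
      eLpNorm (fun x => truncPrim a M (v x)) (ENNReal.ofReal P) volume ^ p ≤ 2 * B := by
    intro M hM
    have hH := h.comp hp hpN (hasDerivAt_truncPrim (M := M) ha) (continuous_truncPow ha)
      truncPrim_zero (C := M ^ a)
      fun s => by rw [abs_of_nonneg (truncPow_nonneg hM s)]; exact truncPow_le ha hM s
    set y := eLpNorm (fun x => truncPrim a M (v x)) (ENNReal.ofReal P) volume ^ p with hy
    have hytop : y ≠ ⊤ := ENNReal.rpow_ne_top_of_nonneg hp0.le hH.memLp.2.ne
    have h1 : y ≤ B + y / 2 := by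
      have hSp : (S : ℝ≥0∞) ^ p = ENNReal.ofReal ((S : ℝ) ^ p) := by
        rw [← ENNReal.ofReal_rpow_of_nonneg (x := (S : ℝ)) S.2 hp0.le, ENNReal.ofReal_coe_nnreal]
      have hsmall : ENNReal.ofReal D *
          eLpNorm ({x | L ≤ ‖v x‖₊}.indicator v) (ENNReal.ofReal P) volume ^ (P - p) ≤ 2⁻¹ := by
        calc _ ≤ ENNReal.ofReal D * ENNReal.ofReal ε ^ (P - p) := by gcongr
          _ = ENNReal.ofReal (D * (2 * (D + 1))⁻¹) := by
              rw [ENNReal.ofReal_rpow_of_nonneg hε0.le (by linarith), hε,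
                Real.rpow_inv_rpow (by positivity) (by linarith), ← ENNReal.ofReal_mul hD0]
          _ ≤ ENNReal.ofReal 2⁻¹ := by
              refine ENNReal.ofReal_le_ofReal ?_
              rw [← div_eq_mul_inv, div_le_iff₀ (by positivity)]
              linarith
          _ = 2⁻¹ := by rw [ENNReal.ofReal_inv_of_pos two_pos, ENNReal.ofReal_ofNat]
      calc y ≤ (S * eLpNorm (fun x => truncPow a M (v x) • W x) (ENNReal.ofReal p) volume) ^ p :=
            ENNReal.rpow_le_rpow (hS _ _ hH) hp0.le
        _ = ENNReal.ofReal ((S : ℝ) ^ p)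
            * eLpNorm (fun x => truncPow a M (v x) • W x) (ENNReal.ofReal p) volume ^ p := by
            rw [ENNReal.mul_rpow_of_nonneg _ _ hp0.le, hSp]
        _ ≤ ENNReal.ofReal ((S : ℝ) ^ p) * (ENNReal.ofReal (C * (a + 1) ^ p) *
              (ENNReal.ofReal (L ^ (a * p)) * eLpNorm v (ENNReal.ofReal P) volume ^ P
              + eLpNorm ({x | L ≤ ‖v x‖₊}.indicator v) (ENNReal.ofReal P) volume ^ (P - p)
                * y)) := by
            gcongr
            exact h.energy_truncPrim_le hp hpN hC hf hweak ha hM hL0.le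
        _ = B + (ENNReal.ofReal D *
              eLpNorm ({x | L ≤ ‖v x‖₊}.indicator v) (ENNReal.ofReal P) volume ^ (P - p)) * y := by
            rw [hB, hD, ENNReal.ofReal_mul (p := (S : ℝ) ^ p) (by positivity)]
            ring
        _ ≤ B + 2⁻¹ * y := by gcongr
        _ = B + y / 2 := by rw [mul_comm, ENNReal.div_eq_inv_mul, mul_comm]
    have h2 : y / 2 ≤ B := by
      refine ENNReal.le_of_add_le_add_right (a := y / 2) ?_ ?_
      · exact (ENNReal.div_lt_top hytop two_ne_zero).ne
      · rwa [ENNReal.add_halves]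
    rw [ENNReal.div_le_iff two_ne_zero ENNReal.ofNat_ne_top, mul_comm] at h2
    exact h2
  have hmeas : ∀ M : ℝ, AEStronglyMeasurable (fun x => |v x| * truncPow a M (v x)) volume :=
    fun M => (continuous_abs.comp_aestronglyMeasurable h.memLp.1).mul
      ((continuous_truncPow ha).comp_aestronglyMeasurable h.memLp.1)
  have hle : ∀ n : ℕ, eLpNorm (fun x => |v x| * truncPow a n (v x)) (ENNReal.ofReal P) volume
      ≤ ENNReal.ofReal (a + 1) * (2 * B) ^ p⁻¹ := by
    intro n
    have hn : (0 : ℝ) ≤ n := n.cast_nonneg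
    calc _ ≤ ENNReal.ofReal (a + 1)
          * eLpNorm (fun x => truncPrim a n (v x)) (ENNReal.ofReal P) volume := by
          refine eLpNorm_le_mul_eLpNorm_of_ae_le_mul (ae_of_all _ fun x => ?_) _
          rw [Real.norm_of_nonneg (mul_nonneg (abs_nonneg _) (truncPow_nonneg hn _))]
          exact mul_truncPow_le ha hn (v x)
      _ ≤ _ := by
          gcongr
          rw [ENNReal.le_rpow_inv_iff hp0]
          exact hbound n hn
  -- the truncation is removed by Fatou's lemma
  refine ⟨?_, ?_⟩
  · exact (continuous_abs.mul (continuous_abs.rpow_const fun _ => Or.inr ha)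
      ).comp_aestronglyMeasurable h.memLp.1
  · refine lt_of_le_of_lt (Lp.eLpNorm_lim_le_liminf_eLpNorm
      (f := fun (n : ℕ) x => |v x| * truncPow a n (v x)) (fun n => hmeas n) _
      (ae_of_all _ fun x => ?_)) ?_
    · refine tendsto_const_nhds.congr' ?_
      filter_upwards [eventually_ge_atTop ⌈|v x|⌉₊] with n hn
      rw [truncPow, min_eq_left ((Nat.le_ceil _).trans (by exact_mod_cast hn))]
    · refine lt_of_le_of_lt (liminf_le_of_frequently_le' (Frequently.of_forall hle)) ?_
      exact ENNReal.mul_lt_top ENNReal.ofReal_lt_top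
        (ENNReal.rpow_lt_top_of_nonneg (by positivity)
          (ENNReal.mul_ne_top ENNReal.ofNat_ne_top hBtop))

end Moser

/-! ### Dilations and local integrability -/

section Dilation

variable {N : ℕ}

theorem comp_smul_le_of_inner_gradient_nonpos {V : Space N → ℝ} (hV : Differentiable ℝ V)
    (h : ∀ x, inner ℝ x (∇ V x) ≤ 0) (x : Space N) {s t : ℝ} (hs : 0 ≤ s) (hst : s ≤ t) :
    V (t • x) ≤ V (s • x) := by
  have hd : ∀ τ : ℝ, HasDerivAt (fun τ : ℝ => V (τ • x)) (inner ℝ x (∇ V (τ • x))) τ := by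
    intro τ
    have h1 : HasDerivAt (fun τ : ℝ => τ • x) x τ := by
      simpa using (hasDerivAt_id τ).smul_const x
    refine ((hV (τ • x)).hasFDerivAt.comp_hasDerivAt τ h1).congr_deriv ?_
    rw [real_inner_comm, inner_gradient_left]
  refine antitoneOn_of_deriv_nonpos (convex_Ici 0)
    (fun τ _ => (hd τ).continuousAt.continuousWithinAt)
    (fun τ _ => (hd τ).differentiableAt.differentiableWithinAt) (fun τ hτ => ?_)
    hs (hs.trans hst) hst
  rw [interior_Ici, Set.mem_Ioi] at hτ
  rw [(hd τ).deriv]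
  have h2 := h (τ • x)
  rw [inner_smul_left, conj_trivial] at h2
  exact nonpos_of_mul_nonpos_right h2 hτ

theorem exists_abs_le_of_memLp_top {K : Space N → ℝ} (hK : MemLp K ⊤ volume)
    (hKc : Continuous K) : ∃ M : ℝ, ∀ x, |K x| ≤ M := by
  refine ⟨(eLpNorm K ⊤ volume).toReal, ?_⟩
  have hae : ∀ᵐ x, |K x| ≤ (eLpNorm K ⊤ volume).toReal := by
    filter_upwards [ae_le_eLpNormEssSup (f := K) (μ := volume)] with x hx
    rw [← eLpNorm_exponent_top] at hx
    have := ENNReal.toReal_mono hK.2.ne hx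
    simpa using this
  have hclosed : IsClosed {x | |K x| ≤ (eLpNorm K ⊤ volume).toReal} :=
    isClosed_le hKc.abs continuous_const
  have hd := Measure.dense_of_ae hae
  intro x
  exact hclosed.closure_subset (hd x)

/-- On a ball, moderate dilations of a locally `L^q` function agree with those of its truncation to
a larger ball. -/
theorem exists_memLp_comp_smul_sub_eq {q : ℝ≥0∞} {φ : Space N → ℝ}
    (hφ : ∀ r, MemLp φ q (volume.restrict (Metric.closedBall 0 r))) (r T : ℝ) :
    ∃ f : Space N → ℝ, MemLp f q volume ∧ ∀ t : ℝ, 1 ≤ t → t ≤ T →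
      ∀ x ∈ Metric.closedBall (0 : Space N) r, f (t • x) - f x = φ (t • x) - φ x := by
  refine ⟨(Metric.closedBall 0 (T * r)).indicator φ,
    (memLp_indicator_iff_restrict Metric.isClosed_closedBall.measurableSet).2 (hφ _), ?_⟩
  intro t ht htT x hx
  rw [mem_closedBall_zero_iff] at hx
  have hx0 := norm_nonneg x
  rw [Set.indicator_of_mem, Set.indicator_of_mem]
  · rw [mem_closedBall_zero_iff]
    nlinarith
  · rw [mem_closedBall_zero_iff, norm_smul, Real.norm_of_nonneg (by linarith)]
    exact mul_le_mul htT hx hx0 (by linarith)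

theorem memLp_restrict_comp_smul_sub {q : ℝ≥0∞} {φ : Space N → ℝ}
    (hφ : ∀ r, MemLp φ q (volume.restrict (Metric.closedBall 0 r))) (r : ℝ) {t : ℝ} (ht : 1 ≤ t) :
    MemLp (fun x => φ (t • x) - φ x) q (volume.restrict (Metric.closedBall 0 r)) := by
  obtain ⟨f, hf, h⟩ := exists_memLp_comp_smul_sub_eq hφ r t
  refine (((memLp_comp_smul ht hf).sub hf).restrict _).ae_eq ?_
  filter_upwards [ae_restrict_mem Metric.isClosed_closedBall.measurableSet] with x hx
  exact h t ht le_rfl x hx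

theorem tendsto_eLpNorm_restrict_comp_smul_sub {q : ℝ≥0∞} (hq : q ≠ ⊤) (hq1 : 1 ≤ q)
    {φ : Space N → ℝ} (hφ : ∀ r, MemLp φ q (volume.restrict (Metric.closedBall 0 r))) (r : ℝ) :
    Tendsto (fun t : ℝ => eLpNorm (fun x => φ (t • x) - φ x) q
      (volume.restrict (Metric.closedBall 0 r))) (𝓝[>] 1) (𝓝 0) := by
  obtain ⟨f, hf, h⟩ := exists_memLp_comp_smul_sub_eq hφ r 2
  refine tendsto_of_tendsto_of_tendsto_of_le_of_le' tendsto_const_nhds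
    (tendsto_comp_smul hq hq1 hf) (Eventually.of_forall fun _ => zero_le) ?_
  filter_upwards [Ioo_mem_nhdsGT one_lt_two] with t ht
  rw [← eLpNorm_congr_ae (f := fun x => f (t • x) - f x)]
  · exact eLpNorm_mono_measure _ Measure.restrict_le_self
  · filter_upwards [ae_restrict_mem Metric.isClosed_closedBall.measurableSet] with x hx
    exact h t ht.1.le ht.2.le x hx

end Dilation

/-! ### Nonexistence -/

section Nonexistence

variable {N : ℕ} {p q α k r : ℝ}

/-- Comparison with a primitive along a dilation: `c`, `c'` are the values of the coefficient and
`A`, `A'` those of the primitive at `x` and at the dilated point, and `d` is the linearized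
increment of the primitive. -/
theorem mul_sub_mul_sub_le {c c' m A A' d e : ℝ} (hc : c' ≤ c) (hm : |c| ≤ m) (hA : 0 ≤ A')
    (h : |A' - A - d| ≤ e) : c' * A' - c * A - m * e ≤ c * d := by
  have h1 := mul_le_mul_of_nonneg_right hc hA
  have h2 : c * (A' - A - d) ≤ m * e := by
    refine (le_abs_self _).trans ?_
    rw [abs_mul]
    exact mul_le_mul hm h (abs_nonneg _) ((abs_nonneg _).trans hm)
  linarith

/-- Nonexistence for solutions whose nonlinearities lie locally in `L^{p'}`. Nehari's identity is
obtained with the test function `u g(u)`; together with the Pohozaev inequality it gives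
`α ∫ |Dv|^p ≤ ∫ (1 + u g'(u) / g(u)) |Dv|^p`, where the factor on the right is less than `α`. -/
theorem eq_zero_of_memLp_nonlinearity (hpq : p.HolderConjugate q) (hpN : p < N) (hα : 1 < α)
    (hr : r = α * sobolevExp N p) (hk : r ≤ k) {lam β : ℝ} (hlam : 0 < lam) (hβ : 0 < β)
    {V K : Space N → ℝ} (hV0 : ∀ x, 0 ≤ V x) {mV mK : ℝ} (hVb : ∀ x, |V x| ≤ mV)
    (hKb : ∀ x, |K x| ≤ mK)
    (hVt : ∀ t : ℝ, 1 < t → ∀ x, V (t • x) ≤ V x) (hKt : ∀ t : ℝ, 1 < t → ∀ x, K (t • x) ≤ K x)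
    {u : Space N → ℝ} {W : Space N → Space N} (hD : IsD1p p (fun x => G p α (u x)) W)
    (hVi : ∀ ψ Z, IsD1p p ψ Z → Integrable (fun x => V x * nonlinearity p α k (u x) * ψ x))
    (hKi : ∀ ψ Z, IsD1p p ψ Z → Integrable (fun x => K x * nonlinearity p α r (u x) * ψ x))
    (hweak : ∀ ψ Z, IsD1p p ψ Z → ∫ x, ‖W x‖ ^ (p - 2) * inner ℝ (W x) (Z x)
      = ∫ x, (lam * (V x * nonlinearity p α k (u x)) + β * (K x * nonlinearity p α r (u x))) * ψ x)
    (hLk : ∀ R, MemLp (fun x => nonlinearity p α k (u x)) (ENNReal.ofReal q)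
      (volume.restrict (Metric.closedBall 0 R)))
    (hLr : ∀ R, MemLp (fun x => nonlinearity p α r (u x)) (ENNReal.ofReal q)
      (volume.restrict (Metric.closedBall 0 R))) :
    u =ᵐ[volume] 0 := by
  have hp : 1 < p := hpq.lt
  have hp0 : 0 < p := by linarith
  have hα0 : 0 < α := by linarith
  have hP := one_lt_sobolevExp (N := N) hp hpN
  have hrα : α ≤ r := by rw [hr]; exact le_mul_of_one_le_right hα0.le hP.le
  have hkα : α ≤ k := hrα.trans hk
  have hr0 : 0 < r := by linarith
  have hk0 : 0 < k := by linarith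
  have hq1 : 1 ≤ ENNReal.ofReal q := one_le_ofReal_of_one_lt hpq.symm.lt
  have hu : ∀ x, invG hp hα (G p α (u x)) = u x := fun x => invG_G hp hα _
  -- the test function `u g(u)`
  have htest := hD.comp hp hpN (hasDerivAt_mul_g_invG hp hα)
    (continuous_const.add ((continuous_logDerivG hp hα).comp (continuous_invG hp hα)))
    (by
      have h0 : invG hp hα 0 = 0 := by
        have := invG_G (p := p) (α := α) hp hα 0
        rwa [G_zero] at this
      rw [h0, zero_mul])
    (C := α) fun s => by
      have h1 := logDerivG_nonneg (p := p) hα (invG hp hα s)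
      have h2 := logDerivG_lt (p := p) hα (invG hp hα s)
      rw [abs_of_nonneg (by linarith)]
      linarith
  simp only [hu] at htest
  have hVint : Integrable (fun x => V x * |u x| ^ k) := by
    refine (hVi _ _ htest).congr (ae_of_all _ fun x => ?_)
    simp only
    rw [mul_assoc, nonlinearity_mul_mul_g hα (by linarith)]
  have hKint : Integrable (fun x => K x * |u x| ^ r) := by
    refine (hKi _ _ htest).congr (ae_of_all _ fun x => ?_)
    simp only
    rw [mul_assoc, nonlinearity_mul_mul_g hα (by linarith)]
  have hnehari : ∫ x, (1 + logDerivG p α (u x)) * ‖W x‖ ^ p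
      = lam * (∫ x, V x * |u x| ^ k) + β * ∫ x, K x * |u x| ^ r := by
    have h1 := hweak _ _ htest
    rw [← integral_const_mul, ← integral_const_mul,
      ← integral_add (hVint.const_mul _) (hKint.const_mul _)]
    have e1 : ∀ x, ‖W x‖ ^ (p - 2) * inner ℝ (W x) ((1 + logDerivG p α (u x)) • W x)
        = (1 + logDerivG p α (u x)) * ‖W x‖ ^ p := fun x => by
      rw [inner_smul_right, mul_left_comm, norm_rpow_mul_inner_self hp]
    have e2 : ∀ x, (lam * (V x * nonlinearity p α k (u x))
        + β * (K x * nonlinearity p α r (u x))) * (u x * g p α (u x))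
        = lam * (V x * |u x| ^ k) + β * (K x * |u x| ^ r) := fun x => by
      rw [← nonlinearity_mul_mul_g (p := p) hα (by linarith : 1 < k),
        ← nonlinearity_mul_mul_g (p := p) hα (by linarith : 1 < r)]
      ring
    simpa only [e1, e2] using h1
  have hFint : Integrable
      (fun x => lam * (V x * (|u x| ^ k / k)) + β * (K x * (|u x| ^ r / r))) := by
    refine (((hVint.div_const k).const_mul lam).add ((hKint.div_const r).const_mul β)).congr
      (ae_of_all _ fun x => ?_)
    simp only [Pi.add_apply]
    ring
  have hmV : 0 ≤ lam * mV := mul_nonneg hlam.le ((abs_nonneg _).trans (hVb 0))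
  have hmK : 0 ≤ β * mK := mul_nonneg hβ.le ((abs_nonneg _).trans (hKb 0))
  have hpoh := pohozaev_le hpq hpN hD
    (f := fun x => lam * (V x * nonlinearity p α k (u x)) + β * (K x * nonlinearity p α r (u x)))
    (F := fun x => lam * (V x * (|u x| ^ k / k)) + β * (K x * (|u x| ^ r / r)))
    (e := fun t x => lam * mV * |nonlinearity p α k (u (t • x)) - nonlinearity p α k (u x)|
      + β * mK * |nonlinearity p α r (u (t • x)) - nonlinearity p α r (u x)|)
    hFint
    (fun ψ Z hψ => by
      refine (((hVi ψ Z hψ).const_mul lam).add ((hKi ψ Z hψ).const_mul β)).congr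
        (ae_of_all _ fun x => ?_)
      simp only [Pi.add_apply]
      ring)
    hweak
    (fun t ht x => by
      have h1 := mul_sub_mul_sub_le (hVt t ht x) (hVb x)
        (A' := |u (t • x)| ^ k / k) (by positivity)
        (abs_rpow_sub_sub_nonlinearity_mul_le hp hα hkα (u x) (u (t • x)))
      have h2 := mul_sub_mul_sub_le (hKt t ht x) (hKb x)
        (A' := |u (t • x)| ^ r / r) (by positivity)
        (abs_rpow_sub_sub_nonlinearity_mul_le hp hα hrα (u x) (u (t • x)))
      have h3 := mul_le_mul_of_nonneg_left h1 hlam.le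
      have h4 := mul_le_mul_of_nonneg_left h2 hβ.le
      linarith)
    (fun t ht R => ((memLp_restrict_comp_smul_sub hLk R ht.le).abs.const_mul _).add
      ((memLp_restrict_comp_smul_sub hLr R ht.le).abs.const_mul _))
    (fun t x => add_nonneg (mul_nonneg hmV (abs_nonneg _)) (mul_nonneg hmK (abs_nonneg _)))
    (fun R => by
      have h1 := (ENNReal.Tendsto.const_mul (a := ENNReal.ofReal (lam * mV))
        (tendsto_eLpNorm_restrict_comp_smul_sub ENNReal.ofReal_ne_top hq1 hLk R)
        (Or.inr ENNReal.ofReal_ne_top)).add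
        (ENNReal.Tendsto.const_mul (a := ENNReal.ofReal (β * mK))
        (tendsto_eLpNorm_restrict_comp_smul_sub ENNReal.ofReal_ne_top hq1 hLr R)
        (Or.inr ENNReal.ofReal_ne_top))
      rw [mul_zero, mul_zero, add_zero] at h1
      refine tendsto_of_tendsto_of_tendsto_of_le_of_le' tendsto_const_nhds h1
        (Eventually.of_forall fun _ => zero_le) ?_
      filter_upwards [self_mem_nhdsWithin] with t ht
      have m1 := memLp_restrict_comp_smul_sub hLk R (le_of_lt ht)
      have m2 := memLp_restrict_comp_smul_sub hLr R (le_of_lt ht)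
      refine (eLpNorm_add_le (m1.abs.const_mul _).1 (m2.abs.const_mul _).1 hq1).trans ?_
      refine add_le_add (eLpNorm_le_mul_eLpNorm_of_ae_le_mul (ae_of_all _ fun x => ?_) _)
        (eLpNorm_le_mul_eLpNorm_of_ae_le_mul (ae_of_all _ fun x => ?_) _)
      · rw [norm_mul, Real.norm_of_nonneg hmV, Real.norm_eq_abs, Pi.abs_apply, abs_abs,
          Real.norm_eq_abs]
      · rw [norm_mul, Real.norm_of_nonneg hmK, Real.norm_eq_abs, Pi.abs_apply, abs_abs,
          Real.norm_eq_abs])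
  have hWi := integrable_norm_rpow hp hD.memLp_grad
  set E := ∫ x, ‖W x‖ ^ p with hE
  have hFeq : ∫ x, (lam * (V x * (|u x| ^ k / k)) + β * (K x * (|u x| ^ r / r)))
      = lam * (∫ x, V x * |u x| ^ k) / k + β * (∫ x, K x * |u x| ^ r) / r := by
    rw [mul_div_assoc, mul_div_assoc, ← integral_div, ← integral_div, ← integral_const_mul,
      ← integral_const_mul, ← integral_add ((hVint.div_const k).const_mul lam)
        ((hKint.div_const r).const_mul β)]
    refine integral_congr_ae (ae_of_all _ fun x => ?_)
    simp only
    ring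
  rw [hFeq] at hpoh
  have hVnn : 0 ≤ ∫ x, V x * |u x| ^ k :=
    integral_nonneg fun x => mul_nonneg (hV0 x) (by positivity)
  have hαE : α * E ≤ ∫ x, (1 + logDerivG p α (u x)) * ‖W x‖ ^ p := by
    rw [hnehari]
    set IV := ∫ x, V x * |u x| ^ k
    set IK := ∫ x, K x * |u x| ^ r
    have h1 : lam * IV / k ≤ lam * IV / r :=
      div_le_div_of_nonneg_left (mul_nonneg hlam.le hVnn) hr0 hk
    have hN0 : (0 : ℝ) < N := by linarith
    have hNp : (0 : ℝ) < N - p := by linarith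
    have h2 : (N - p) / p * E ≤ N * ((lam * IV + β * IK) / r) := by
      refine hpoh.trans (mul_le_mul_of_nonneg_left ?_ hN0.le)
      rw [add_div]
      linarith
    have h3 : N * ((lam * IV + β * IK) / r) = (N - p) / p * ((lam * IV + β * IK) / α) := by
      rw [hr, sobolevExp]
      field_simp
    rw [h3] at h2
    have h4 := le_of_mul_le_mul_left h2 (div_pos hNp hp0)
    rw [le_div_iff₀ hα0] at h4
    linarith
  have hmeas : AEStronglyMeasurable (fun x => logDerivG p α (u x)) volume := by
    have := ((continuous_logDerivG hp hα).comp (continuous_invG hp hα)).comp_aestronglyMeasurable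
      hD.memLp.1
    simpa only [Function.comp_apply, hu] using this
  have hli : Integrable (fun x => (1 + logDerivG p α (u x)) * ‖W x‖ ^ p) := by
    refine hWi.bdd_mul (c := α) (aestronglyMeasurable_const.add hmeas) (ae_of_all _ fun x => ?_)
    have h1 := logDerivG_nonneg (p := p) hα (u x)
    have h2 := logDerivG_lt (p := p) hα (u x)
    rw [Real.norm_of_nonneg (by linarith)]
    linarith
  have hgap : ∫ x, (α * ‖W x‖ ^ p - (1 + logDerivG p α (u x)) * ‖W x‖ ^ p) ≤ 0 := by
    rw [integral_sub (hWi.const_mul α) hli, integral_const_mul]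
    linarith
  have hnn : ∀ x, 0 ≤ α * ‖W x‖ ^ p - (1 + logDerivG p α (u x)) * ‖W x‖ ^ p := fun x => by
    have h2 := logDerivG_lt (p := p) hα (u x)
    rw [← sub_mul]
    exact mul_nonneg (by linarith) (by positivity)
  have hW0 : W =ᵐ[volume] 0 := by
    have h1 := (integral_eq_zero_iff_of_nonneg hnn ((hWi.const_mul α).sub hli)).1
      (le_antisymm hgap (integral_nonneg hnn))
    filter_upwards [h1] with x hx
    have h2 := logDerivG_lt (p := p) hα (u x)
    simp only [Pi.zero_apply] at hx ⊢
    rw [← sub_mul, mul_eq_zero] at hx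
    rcases hx with hx | hx
    · linarith
    · exact norm_eq_zero.1 ((Real.rpow_eq_zero (norm_nonneg _) hp0.ne').1 hx)
  obtain ⟨S, hS⟩ := exists_sobolev_const (N := N) hp hpN
  have hv0 : eLpNorm (fun x => G p α (u x)) (ENNReal.ofReal (sobolevExp N p)) volume = 0 := by
    have := hS _ _ hD
    rw [eLpNorm_congr_ae hW0, eLpNorm_zero, mul_zero] at this
    exact le_antisymm this zero_le
  rw [eLpNorm_eq_zero_iff hD.memLp.1 (by simp; linarith)] at hv0
  filter_upwards [hv0] with x hx
  refine (strictMono_G hp hα).injective ?_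
  simpa [G_zero] using hx

/-- At the critical exponent the Moser step gives the local `L^{p'}` integrability of the
nonlinearity. -/
theorem IsD1p.memLp_restrict_nonlinearity (hpq : p.HolderConjugate q) (hpN : p < N) (hα : 1 < α)
    {u : Space N → ℝ} {W : Space N → Space N} (hD : IsD1p p (fun x => G p α (u x)) W)
    {c : Space N → ℝ} {m : ℝ} (hc : ∀ x, |c x| ≤ m)
    (hweak : ∀ ψ Z, IsD1p p ψ Z → ∫ x, ‖W x‖ ^ (p - 2) * inner ℝ (W x) (Z x)
      = ∫ x, (c x * nonlinearity p α (α * sobolevExp N p) (u x)) * ψ x) (R : ℝ) :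
    MemLp (fun x => nonlinearity p α (α * sobolevExp N p) (u x)) (ENNReal.ofReal q)
      (volume.restrict (Metric.closedBall 0 R)) := by
  have hp : 1 < p := hpq.lt
  have hP := one_lt_sobolevExp (N := N) hp hpN
  have hq := hpq.symm.lt
  have hq0 : 0 < q := by linarith
  set P := sobolevExp N p with hPdef
  have hP0 : 0 < P := by linarith
  obtain ⟨C, hC, hle⟩ := exists_abs_nonlinearity_le hp hα hP
  have hm : 0 ≤ m := (abs_nonneg _).trans (hc 0)
  have hmoser := hD.memLp_abs_rpow_add_one hp hpN (C := m * C) (by positivity) (fun x => by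
    rw [abs_mul, mul_assoc]
    exact mul_le_mul (hc x) (hle (u x)) (abs_nonneg _) hm) hweak (a := q - 1) (by linarith)
  have h1 : MemLp (fun x => |G p α (u x)| ^ P) (ENNReal.ofReal q) volume := by
    have h2 := hmoser.norm_rpow_div (ENNReal.ofReal (P / q))
    rw [ENNReal.toReal_ofReal (by positivity), ← ENNReal.ofReal_div_of_pos (by positivity),
      ← hPdef, div_div_cancel₀ hP0.ne'] at h2
    refine h2.ae_eq (ae_of_all _ fun x => ?_)
    simp only
    have hz := abs_nonneg (G p α (u x))
    rw [Real.norm_of_nonneg (by positivity)]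
    rcases hz.eq_or_lt with h0 | h0
    · rw [← h0, zero_mul, Real.zero_rpow (by positivity), Real.zero_rpow (by positivity)]
    · rw [mul_comm, ← Real.rpow_add_one h0.ne', sub_add_cancel, ← Real.rpow_mul hz]
      congr 1
      field_simp
  have : IsFiniteMeasure (volume.restrict (Metric.closedBall (0 : Space N) R)) :=
    isFiniteMeasure_restrict.2 measure_closedBall_lt_top.ne
  have humeas : AEStronglyMeasurable u volume := by
    have := (continuous_invG hp hα).comp_aestronglyMeasurable hD.memLp.1
    simpa only [invG_G] using this
  refine ((memLp_const (1 : ℝ)).add (h1.restrict _)).of_le_mul (c := C)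
    ((measurable_nonlinearity hp hα).comp_aemeasurable
      humeas.restrict.aemeasurable).aestronglyMeasurable
    (ae_of_all _ fun x => ?_)
  refine (hle (u x)).trans (mul_le_mul_of_nonneg_left ?_ hC)
  simp only [Pi.add_apply]
  have hz := abs_nonneg (G p α (u x))
  rw [Real.norm_of_nonneg (by positivity)]
  rcases le_total |G p α (u x)| 1 with h | h
  · have : 0 ≤ |G p α (u x)| ^ P := by positivity
    linarith [Real.rpow_le_one hz h (by linarith : 0 ≤ P - 1)]
  · linarith [Real.rpow_le_rpow_of_exponent_le h (by linarith : P - 1 ≤ P)]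

theorem LocallyEssBounded.memLp_restrict_nonlinearity (hp : 1 < p) (hα : 1 < α) (hk : 1 < k)
    {u : Space N → ℝ} (hu : LocallyEssBounded u) (hum : AEStronglyMeasurable u volume)
    (s : ℝ≥0∞) (R : ℝ) :
    MemLp (fun x => nonlinearity p α k (u x)) s (volume.restrict (Metric.closedBall 0 R)) := by
  have : IsFiniteMeasure (volume.restrict (Metric.closedBall (0 : Space N) R)) :=
    isFiniteMeasure_restrict.2 measure_closedBall_lt_top.ne
  obtain ⟨C, hC⟩ := hu _ (isCompact_closedBall (0 : Space N) R)
  refine MemLp.of_bound ((measurable_nonlinearity hp hα).comp_aemeasurable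
    hum.restrict.aemeasurable).aestronglyMeasurable (C ^ (k - 1)) ?_
  filter_upwards [hC] with x hx
  exact abs_nonlinearity_le_of_abs_le hp hα hk hx

end Nonexistence

end

end QuasilinearSchrodinger

open QuasilinearSchrodinger in
theorem mainTheorem4 (N : ℕ) (hN : 3 ≤ N) (p α k lam β : ℝ)
    (hp : 1 < p) (hpN : p < N) (hα : 1 < α) (hlam : 0 < lam) (hβ : 0 < β)
    (V K : EuclideanSpace ℝ (Fin N) → ℝ)
    (hV0 : ∀ x, 0 ≤ V x) (hVd : Differentiable ℝ V)
    (hKb : MemLp K ∞ volume) (hKd : Differentiable ℝ K)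
    (hk : α * QuasilinearSchrodinger.sobolevExp N p ≤ k)
    (hDV : ∀ x, inner ℝ x (∇ V x) ≤ 0) (hDK : ∀ x, inner ℝ x (∇ K x) ≤ 0)
    (u : EuclideanSpace ℝ (Fin N) → ℝ)
    (hu : QuasilinearSchrodinger.IsWeakSolution p α k lam β V K u)
    (hreg : α * QuasilinearSchrodinger.sobolevExp N p < k →
      QuasilinearSchrodinger.LocallyEssBounded u) :
    u =ᵐ[volume] 0 := by
  obtain ⟨W, hD, hsol⟩ := hu
  have hpq : p.HolderConjugate p.conjExponent := Real.HolderConjugate.conjExponent hp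
  have hP := one_lt_sobolevExp (N := N) hp hpN
  have hr1 : 1 < α * sobolevExp N p := one_lt_mul_of_lt_of_le hα hP.le
  obtain ⟨mK, hmK⟩ := exists_abs_le_of_memLp_top hKb hKd.continuous
  have hmV : ∀ x, |V x| ≤ V 0 := fun x => by
    rw [abs_of_nonneg (hV0 x)]
    simpa using comp_smul_le_of_inner_gradient_nonpos hVd hDV x le_rfl zero_le_one
  have hdil : ∀ U : EuclideanSpace ℝ (Fin N) → ℝ, Differentiable ℝ U →
      (∀ x, inner ℝ x (∇ U x) ≤ 0) → ∀ t : ℝ, 1 < t → ∀ x, U (t • x) ≤ U x :=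
    fun U hU h t ht x => by
      simpa using comp_smul_le_of_inner_gradient_nonpos hU h x zero_le_one ht.le
  have hweak : ∀ ψ Z, IsD1p p ψ Z → ∫ x, ‖W x‖ ^ (p - 2) * inner ℝ (W x) (Z x)
      = ∫ x, (lam * (V x * nonlinearity p α k (u x))
        + β * (K x * nonlinearity p α (α * sobolevExp N p) (u x))) * ψ x := by
    intro ψ Z hψ
    obtain ⟨h1, h2, h3⟩ := hsol ψ Z hψ
    rw [← integral_const_mul, ← integral_const_mul, sub_sub, sub_eq_zero,
      ← integral_add (h1.const_mul _) (h2.const_mul _)] at h3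
    rw [h3]
    refine integral_congr_ae (ae_of_all _ fun x => ?_)
    simp only [nonlinearity]
    ring
  have hum : AEStronglyMeasurable u volume := by
    have := (continuous_invG hp hα).comp_aestronglyMeasurable hD.memLp.1
    simpa only [invG_G] using this
  obtain ⟨hLk, hLr⟩ : (∀ R, MemLp (fun x => nonlinearity p α k (u x))
        (ENNReal.ofReal p.conjExponent) (volume.restrict (Metric.closedBall 0 R))) ∧
      ∀ R, MemLp (fun x => nonlinearity p α (α * sobolevExp N p) (u x))
        (ENNReal.ofReal p.conjExponent) (volume.restrict (Metric.closedBall 0 R)) := by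
    rcases hk.eq_or_lt with rfl | hlt
    · have h := hD.memLp_restrict_nonlinearity hpq hpN hα
        (c := fun x => lam * V x + β * K x) (m := lam * V 0 + β * mK) (fun x => by
          refine (abs_add_le _ _).trans ?_
          rw [abs_mul, abs_mul, abs_of_pos hlam, abs_of_pos hβ]
          gcongr
          · exact hmV x
          · exact hmK x) (fun ψ Z hψ => by
          rw [hweak ψ Z hψ]
          refine integral_congr_ae (ae_of_all _ fun x => ?_)
          simp only
          ring)
      exact ⟨h, h⟩
    · exact ⟨(hreg hlt).memLp_restrict_nonlinearity hp hα (hr1.trans hlt) hum _,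
        (hreg hlt).memLp_restrict_nonlinearity hp hα hr1 hum _⟩
  exact eq_zero_of_memLp_nonlinearity hpq hpN hα rfl hk hlam hβ hV0 hmV hmK (hdil V hVd hDV)
    (hdil K hKd hDK) hD (fun ψ Z hψ => (hsol ψ Z hψ).1) (fun ψ Z hψ => (hsol ψ Z hψ).2.1) hweak
    hLk hLr
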